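/- Let $N\in\{2,3\}$, let $Q\subset\mathbb{R}^N$ be a bounded open set (in particular, a bounded smooth domain), let $T>0$ and $1+\frac{2N}{N+2}\le p<\infty$. Let $\mathcal V$ be the set of divergence-free vector fields in $C_0^\infty(Q)^N$, $\mathbb V$ the closure of $\mathcal V$ in $W^{1,p}(Q)^N$ with the gradient norm $\|v\|=\|\nabla v\|_{L^p(Q)}$, and $\mathbb H$ the closure of $\mathcal V$ in $L^2(Q)^N$ with the $L^2$ norm $|\cdot|$. Assume: (A1) $a=(a_{ij})\in L^\infty(\mathbb{R}^{N+1})^{N\times N}$, $a_{ij}=a_{ji}$, and for some $\nu_0>0$, $(a(y,\tau)\lambda)\cdot\lambda\ge\nu_0|\lambda|^2$ for all $\lambda\in\mathbb{R}^N$ and a.e. $(y,\tau)$; (A2) $b\in L^\infty(\mathbb{R}^{N+1})$ and $\nu_1\le b\le\nu_2$ a.e. for some $\nu_1,\nu_2>0$; (A3) $\rho\in L^\infty(\mathbb{R}^N)$ and $\Lambda^{-1}\le\rho\le\Lambda$ a.e. for some $\Lambda>0$; (A4) $f:\mathbb{R}\times\mathbb{R}^N\to\mathbb{R}^N$ is continuous;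 $(\tau,u)\mapsto f(\tau,u(\cdot))$ maps $\mathbb{R}\times\mathbb H$ continuously into $\mathbb H$; and for some $k>0$, $|f(\tau,0)|\le k$ and $|f(\tau,r_1)-f(\tau,r_2)|\le k|r_1-r_2|$ for all $\tau\in\mathbb{R}$ and $r_1,r_2\in\mathbb{R}^N$. Let $u^0\in\mathbb H$. For $\varepsilon>0$ put $\rho^\varepsilon(x)=\rho(x/\varepsilon)$, $a^\varepsilon(x,t)=a(x/\varepsilon,t/\varepsilon^2)$, $b^\varepsilon(x,t)=b(x/\varepsilon,t/\varepsilon^2)$ and $(u,v)_\varepsilon=\int_Q\rho^\varepsilon u\cdot v\,dx$. A weak solution of $$\rho^\varepsilon\partial_t u_\varepsilon-\operatorname{div}\big(a^\varepsilon\nabla u_\varepsilon+b^\varepsilon|\nabla u_\varepsilon|^{p-2}\nabla u_\varepsilon\big)+(u_\varepsilon\cdot\nabla)u_\varepsilon+\nabla q_\varepsilon=\rho^\varepsilon f\big(\tfrac{t}{\varepsilon^2},u_\varepsilon\big),\quad \operatorname{div}u_\varepsilon=0\ \text{ in }Q\times(0,T),$$ $u_\varepsilon=0$ on $\partial Q\times(0,T)$,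 $u_\varepsilon(0)=u^0$, is a function $u_\varepsilon\in L^p(0,T;\mathbb V)\cap L^\infty(0,T;\mathbb H)$ such that for every $v\in\mathbb V$ and a.e. $t\in(0,T)$ $$(u_\varepsilon(t),v)_\varepsilon+\int_0^t\!\Big[\int_Q\big(a^\varepsilon\nabla u_\varepsilon\cdot\nabla v+b^\varepsilon|\nabla u_\varepsilon|^{p-2}\nabla u_\varepsilon\cdot\nabla v\big)dx+\sum_{i,j}\int_Q u_{\varepsilon,i}\,\partial_i u_{\varepsilon,j}\,v_j\,dx\Big]ds=(u^0,v)_\varepsilon+\int_0^t\big(f(\tfrac{s}{\varepsilon^2},u_\varepsilon(s)),v\big)_\varepsilon ds .$$ Then there is a constant $C>0$, independent of $\varepsilon$, such that for every $\varepsilon>0$ every such weak solution $u_\varepsilon$ has a representative in $C([0,T];\mathbb H)$ and, for this representative, $$\sup_{0\le t\le T}|u_\varepsilon(t)|^2\le C,\qquad \int_0^T\|u_\varepsilon(t)\|^p\,dt\le C,\qquad \int_0^T\|u_\varepsilon(t)\|_{H^1(Q)^N}^2\,dt\le C .$$ -/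

import Mathlib

open MeasureTheory Set
open scoped ENNReal ContDiff RealInnerProductSpace

namespace Ladyzhenskaya

/-- `ℝ^N` with the Euclidean norm. -/
abbrev Vec (N : ℕ) : Type := EuclideanSpace ℝ (Fin N)

/-- `N × N` matrices with the Euclidean (Frobenius) norm and inner product; the `(i, j)` entry of the
gradient of a vector field `v` is `∂ v_j / ∂ x_i`. -/
abbrev Mat (N : ℕ) : Type := EuclideanSpace ℝ (Fin N × Fin N)

noncomputable section

/-- The classical gradient `(∂ φ_j / ∂ x_i)_{i,j}` of a vector field. -/
def gradField {N : ℕ} (φ : Vec N → Vec N) (x : Vec N) : Mat N :=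
  WithLp.toLp 2 fun ij => fderiv ℝ φ x (EuclideanSpace.single ij.1 1) ij.2

/-- The classical divergence `∑ i, ∂ φ_i / ∂ x_i` of a vector field. -/
def divField {N : ℕ} (φ : Vec N → Vec N) (x : Vec N) : ℝ :=
  ∑ i, gradField φ x (i, i)

/-- Divergence-free vector fields of class `C^∞` with compact support contained in `Q`. -/
structure IsTestField {N : ℕ} (Q : Set (Vec N)) (φ : Vec N → Vec N) : Prop where
  smooth : ContDiff ℝ ∞ φ
  compact : HasCompactSupport φ
  support : tsupport φ ⊆ Q
  div_eq_zero : ∀ x, divField φ x = 0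

theorem gradField_zero {N : ℕ} (x : Vec N) : gradField (0 : Vec N → Vec N) x = 0 := by
  ext ij
  simp [gradField]

theorem gradField_add {N : ℕ} {φ ψ : Vec N → Vec N} (hφ : ContDiff ℝ ∞ φ) (hψ : ContDiff ℝ ∞ ψ)
    (x : Vec N) : gradField (φ + ψ) x = gradField φ x + gradField ψ x := by
  have h1 : DifferentiableAt ℝ φ x := (hφ.differentiable (by simp)) x
  have h2 : DifferentiableAt ℝ ψ x := (hψ.differentiable (by simp)) x
  ext ij
  simp [gradField, fderiv_add h1 h2]

theorem gradField_smul {N : ℕ} {φ : Vec N → Vec N} (hφ : ContDiff ℝ ∞ φ) (c : ℝ)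
    (x : Vec N) : gradField (c • φ) x = c • gradField φ x := by
  have h1 : DifferentiableAt ℝ φ x := (hφ.differentiable (by simp)) x
  ext ij
  simp [gradField, fderiv_const_smul h1 c]

theorem IsTestField.zero {N : ℕ} (Q : Set (Vec N)) : IsTestField Q (0 : Vec N → Vec N) where
  smooth := contDiff_const
  compact := HasCompactSupport.zero
  support := by simp
  div_eq_zero x := by simp [divField, gradField_zero]

theorem IsTestField.add {N : ℕ} {Q : Set (Vec N)} {φ ψ : Vec N → Vec N}
    (hφ : IsTestField Q φ) (hψ : IsTestField Q ψ) : IsTestField Q (φ + ψ) where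
  smooth := hφ.smooth.add hψ.smooth
  compact := hφ.compact.add hψ.compact
  support := (tsupport_add φ ψ).trans (union_subset hφ.support hψ.support)
  div_eq_zero x := by
    have h1 := hφ.div_eq_zero x
    have h2 := hψ.div_eq_zero x
    simp only [divField] at h1 h2 ⊢
    simp [gradField_add hφ.smooth hψ.smooth, Finset.sum_add_distrib, h1, h2]

theorem IsTestField.smul {N : ℕ} {Q : Set (Vec N)} {φ : Vec N → Vec N}
    (hφ : IsTestField Q φ) (c : ℝ) : IsTestField Q (c • φ) where
  smooth := contDiff_const.smul hφ.smooth
  compact := hφ.compact.smul_left (f := fun _ => c)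
  support := (tsupport_smul_subset_right (fun _ => c) φ).trans hφ.support
  div_eq_zero x := by
    have h1 := hφ.div_eq_zero x
    simp only [divField] at h1 ⊢
    simp [gradField_smul hφ.smooth, ← Finset.mul_sum, h1]

/-- The classes of the divergence-free test fields in `L²(Q)^N`. -/
def testH {N : ℕ} (Q : Set (Vec N)) : Submodule ℝ (Lp (Vec N) 2 (volume.restrict Q)) where
  carrier := {w | ∃ φ, IsTestField Q φ ∧ w =ᵐ[volume.restrict Q] φ}
  zero_mem' := ⟨0, .zero Q, Lp.coeFn_zero _ _ _⟩
  add_mem' := by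
    rintro w z ⟨φ, hφ, hw⟩ ⟨ψ, hψ, hz⟩
    exact ⟨φ + ψ, hφ.add hψ, (Lp.coeFn_add w z).trans (hw.add hz)⟩
  smul_mem' := by
    rintro c w ⟨φ, hφ, hw⟩
    exact ⟨c • φ, hφ.smul c, (Lp.coeFn_smul c w).trans (hw.const_smul c)⟩

/-- The space `ℍ`: the closure in `L²(Q)^N` of the divergence-free test fields, with the
`L²` norm. -/
def SpaceH {N : ℕ} (Q : Set (Vec N)) : Submodule ℝ (Lp (Vec N) 2 (volume.restrict Q)) :=
  (testH Q).topologicalClosure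

/-- The pairs `(φ, ∇φ)`, with `φ` a divergence-free test field, in `L^p(Q)^N × L^p(Q)^{N × N}`. -/
def testV {N : ℕ} (Q : Set (Vec N)) (p : ℝ) [Fact (1 ≤ ENNReal.ofReal p)] :
    Submodule ℝ (Lp (Vec N) (ENNReal.ofReal p) (volume.restrict Q) ×
      Lp (Mat N) (ENNReal.ofReal p) (volume.restrict Q)) where
  carrier := {w | ∃ φ, IsTestField Q φ ∧ w.1 =ᵐ[volume.restrict Q] φ ∧
    w.2 =ᵐ[volume.restrict Q] gradField φ}
  zero_mem' := by
    refine ⟨0, .zero Q, Lp.coeFn_zero _ _ _, (Lp.coeFn_zero _ _ _).trans ?_⟩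
    exact Filter.Eventually.of_forall fun x => (gradField_zero x).symm
  add_mem' := by
    rintro w z ⟨φ, hφ, hw, hw'⟩ ⟨ψ, hψ, hz, hz'⟩
    refine ⟨φ + ψ, hφ.add hψ, (Lp.coeFn_add w.1 z.1).trans (hw.add hz),
      (Lp.coeFn_add w.2 z.2).trans ((hw'.add hz').trans ?_)⟩
    exact Filter.Eventually.of_forall fun x => (gradField_add hφ.smooth hψ.smooth x).symm
  smul_mem' := by
    rintro c w ⟨φ, hφ, hw, hw'⟩
    refine ⟨c • φ, hφ.smul c, (Lp.coeFn_smul c w.1).trans (hw.const_smul c),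
      (Lp.coeFn_smul c w.2).trans ((hw'.const_smul c).trans ?_)⟩
    exact Filter.Eventually.of_forall fun x => (gradField_smul hφ.smooth c x).symm

/-- The space `𝕍`: the closure in `W^{1,p}(Q)^N` of the divergence-free test fields. An element
`v` of `W^{1,p}(Q)^N` is given as the pair `(v, ∇v)` in `L^p(Q)^N × L^p(Q)^{N × N}`; the norm of this
product is equivalent to the `W^{1,p}` norm, and the set of the pairs (function, weak gradient) is
closed in the product, so that the closure may be taken there. -/
def SpaceV {N : ℕ} (Q : Set (Vec N)) (p : ℝ) [Fact (1 ≤ ENNReal.ofReal p)] :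
    Submodule ℝ (Lp (Vec N) (ENNReal.ofReal p) (volume.restrict Q) ×
      Lp (Mat N) (ENNReal.ofReal p) (volume.restrict Q)) :=
  (testV Q p).topologicalClosure

section Fields

variable {N : ℕ} {Q : Set (Vec N)} {p : ℝ} [Fact (1 ≤ ENNReal.ofReal p)]

/-- The vector field underlying an element of `𝕍`. -/
def SpaceV.field (v : SpaceV Q p) : Vec N → Vec N := v.1.1

/-- The weak gradient of an element of `𝕍`: `(i, j) ↦ ∂ v_j / ∂ x_i`. -/
def SpaceV.grad (v : SpaceV Q p) : Vec N → Mat N := v.1.2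

/-- The vector field underlying an element of `ℍ`. -/
def SpaceH.field (h : SpaceH Q) : Vec N → Vec N := h.1

/-- `v ∈ 𝕍` and `h ∈ ℍ` are the same vector field, almost everywhere in `Q`. -/
def SameField (v : SpaceV Q p) (h : SpaceH Q) : Prop :=
  SpaceV.field v =ᵐ[volume.restrict Q] SpaceH.field h

end Fields

/-- Assumption on the viscosity matrix `a`: bounded, symmetric, uniformly coercive. -/
structure AssumptionA1 {N : ℕ} (a : Vec N × ℝ → Matrix (Fin N) (Fin N) ℝ) : Prop where
  bounded : ∀ i j, MemLp (fun z => a z i j) ∞ volume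
  symm : ∀ᵐ z, ∀ i j, a z i j = a z j i
  coercive : ∃ ν₀ : ℝ, 0 < ν₀ ∧
    ∀ᵐ z, ∀ ξ : Vec N, ν₀ * ‖ξ‖ ^ 2 ≤ ∑ i, ∑ j, a z i j * ξ j * ξ i

/-- Assumption on the viscosity `b`: bounded, and bounded from below away from zero. -/
structure AssumptionA2 {N : ℕ} (b : Vec N × ℝ → ℝ) : Prop where
  bounded : MemLp b ∞ volume
  bounds : ∃ ν₁ ν₂ : ℝ, 0 < ν₁ ∧ 0 < ν₂ ∧ ∀ᵐ z, ν₁ ≤ b z ∧ b z ≤ ν₂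

/-- Assumption on the density `ρ`: bounded, and bounded from below away from zero. -/
structure AssumptionA3 {N : ℕ} (ρ : Vec N → ℝ) : Prop where
  bounded : MemLp ρ ∞ volume
  bounds : ∃ Λ : ℝ, 0 < Λ ∧ ∀ᵐ y, Λ⁻¹ ≤ ρ y ∧ ρ y ≤ Λ

/-- Assumption on the force `f`: continuous, acting continuously from `ℝ × ℍ` to `ℍ` by
composition, bounded at `r = 0` and Lipschitz in `r`, uniformly in time. -/
structure AssumptionA4 {N : ℕ} (Q : Set (Vec N)) (f : ℝ → Vec N → Vec N) : Prop where
  continuous : Continuous fun z : ℝ × Vec N => f z.1 z.2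
  maps_H : ∃ F : ℝ × SpaceH Q → SpaceH Q, Continuous F ∧
    ∀ (τ : ℝ) (h : SpaceH Q),
      SpaceH.field (F (τ, h)) =ᵐ[volume.restrict Q] fun x => f τ (SpaceH.field h x)
  lipschitz : ∃ k : ℝ, 0 < k ∧ (∀ τ, ‖f τ 0‖ ≤ k) ∧
    ∀ τ r₁ r₂, ‖f τ r₁ - f τ r₂‖ ≤ k * ‖r₁ - r₂‖

/-- `(u, v)_ε = ∫_Q ρ(x / ε) u(x) · v(x) dx`. -/
def innerEps {N : ℕ} (Q : Set (Vec N)) (ρ : Vec N → ℝ) (ε : ℝ) (u v : Vec N → Vec N) : ℝ :=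
  ∫ x in Q, ρ (ε⁻¹ • x) * ⟪u x, v x⟫

section Forms

variable {N : ℕ} {Q : Set (Vec N)} {p : ℝ} [Fact (1 ≤ ENNReal.ofReal p)]

/-- The viscous form `a_I^ε(t; u, v) = ∫_Q (a^ε ∇u) · ∇v dx + ∫_Q b^ε |∇u|^{p-2} ∇u · ∇v dx`, where
`a^ε(x, t) = a(x / ε, t / ε²)` and `b^ε(x, t) = b(x / ε, t / ε²)`. -/
def viscousForm (a : Vec N × ℝ → Matrix (Fin N) (Fin N) ℝ) (b : Vec N × ℝ → ℝ) (ε t : ℝ)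
    (u v : SpaceV Q p) : ℝ :=
  (∫ x in Q, ∑ i, ∑ j, ∑ k,
    a (ε⁻¹ • x, t / ε ^ 2) i j * SpaceV.grad u x (j, k) * SpaceV.grad v x (i, k)) +
  ∫ x in Q, b (ε⁻¹ • x, t / ε ^ 2) * ‖SpaceV.grad u x‖ ^ (p - 2) *
    ⟪SpaceV.grad u x, SpaceV.grad v x⟫

/-- The convective form `b_I(u, v, w) = ∑ i j, ∫_Q u_i (∂ v_j / ∂ x_i) w_j dx`. -/
def convectiveForm (u v w : SpaceV Q p) : ℝ :=
  ∑ i, ∑ j, ∫ x in Q, SpaceV.field u x i * SpaceV.grad v x (i, j) * SpaceV.field w x j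

/-- `u ∈ L^p(0, T; 𝕍) ∩ L^∞(0, T; ℍ)` is a weak solution, with initial value `u0`, of
`ρ^ε ∂_t u - div (a^ε ∇u + b^ε |∇u|^{p-2} ∇u) + (u · ∇) u + ∇q = ρ^ε f(t / ε², u)`,
`div u = 0` in `Q × (0, T)`, `u = 0` on `∂Q × (0, T)`. -/
structure IsWeakSolution (T : ℝ) (a : Vec N × ℝ → Matrix (Fin N) (Fin N) ℝ) (b : Vec N × ℝ → ℝ)
    (ρ : Vec N → ℝ) (f : ℝ → Vec N → Vec N) (u0 : SpaceH Q) (ε : ℝ) (u : ℝ → SpaceV Q p) :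
    Prop where
  memLp : MemLp u (ENNReal.ofReal p) (volume.restrict (Ioo 0 T))
  memLinfty : ∃ w : ℝ → SpaceH Q, MemLp w ∞ (volume.restrict (Ioo 0 T)) ∧
    ∀ᵐ t ∂(volume.restrict (Ioo 0 T)), SameField (u t) (w t)
  equation : ∀ v : SpaceV Q p, ∀ᵐ t ∂(volume.restrict (Ioo 0 T)),
    innerEps Q ρ ε (SpaceV.field (u t)) (SpaceV.field v) +
      ∫ s in (0 : ℝ)..t, (viscousForm a b ε s (u s) v + convectiveForm (u s) (u s) v) =
    innerEps Q ρ ε (SpaceH.field u0) (SpaceV.field v) +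
      ∫ s in (0 : ℝ)..t,
        innerEps Q ρ ε (fun x => f (s / ε ^ 2) (SpaceV.field (u s) x)) (SpaceV.field v)

end Forms

end

end Ladyzhenskaya

namespace Ladyzhenskaya
open Filter Topology

/-! Formally one tests the equation with `u` itself. The convective term vanishes because `div u =
0`, coercivity of `a` and `b` controls the gradient in `L²` and `L^p`, the force grows linearly, and
Gronwall's lemma closes the estimate. The constants depend only on the coefficient bounds, `|Q|`,
`T` and `|u⁰|`; since `ε` enters the coefficients only through rescalings that preserve null sets,
it does not enter the constants. The work lies in justifying the test, as the equation is known only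
after integration in time and against fixed `v`.

Duality. Every term must be bounded in the dual of `𝕍` by a function in `L^{p'}(0, T)`. Viscosity
and force have growth at most `p - 1`. For convection, antisymmetry gives `|b(u,u,v)| = |b(u,v,u)| ≤
K ‖u‖_r² ‖v‖`, with `p₀ = 1 + 2N/(N+2)` and `1/p₀ + 2/r = 1`. The inequality `‖u‖_r^r ≤ C |u|^{2α}
‖∇u‖_{p₀}^{p₀}` (`gagliardoNirenberg_two`, `gagliardoNirenberg_three`) turns this, for bounded
`|u|`, into growth `p₀ - 1`; the lower bound on `p` is exactly `p₀ ≤ p`.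

Energy identity. Abstractly, `B(x_t, v) = B(u0, v) + ∫₀ᵗ g v`. The increment from `s` to `t` of
`F(t) = B(x_t, x_t) - 2 ∫₀ᵗ g(x)` is the integral over `(s, t]` of `g_τ((x_t - x_τ) + (x_s - x_τ))`.
Hölder's inequality and continuity of translations in `L^p` make the `L¹` norm of `F(· + h) - F` of
order `o(h)`; cutting a step into `n` equal parts then shows that it vanishes, so `F` is a.e.
constant (`exists_energy_eq`). No regularization in time is needed.

Continuity. The identity also bounds `|x_t - x_s|²` by a multiple of `‖x‖_{L^p} ‖m‖_{L^{p'}(s,t)}`,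
where `m` bounds `g`, by passing through an intermediate time at which `‖x‖` is at most its mean
(`ofReal_sq_norm_sub_le`). Hence `x` is uniformly continuous into `ℍ` on a set of full measure and
extends to `[0, T]`; the extension starts at `u0`. -/

/-! ### Time translations, and functions whose increments are `o(h)` in `L¹` -/

theorem tendsto_eLpNorm_translate {V : Type*} [NormedAddCommGroup V] {p : ℝ≥0∞} (hp1 : 1 ≤ p)
    (hp : p ≠ ⊤) {x : ℝ → V} (hx : MemLp x p volume) :
    Tendsto (fun σ : ℝ => eLpNorm (fun t => x (t + σ) - x t) p volume) (𝓝 0) (𝓝 0) := by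
  have : Fact (1 ≤ p) := ⟨hp1⟩
  let f := hx.toLp x
  -- Translations form a continuous curve of measure-preserving maps for the compact-open topology;
  -- composition with such a curve is continuous in `L^p` for finite `p`.
  let g : C(ℝ, C(ℝ, ℝ)) := (ContinuousMap.mk (fun a : ℝ × ℝ => a.1 + a.2) (by fun_prop)).curry
  have hmp : ∀ σ : ℝ, MeasurePreserving (g σ) volume volume := fun σ =>
    measurePreserving_add_left _ _
  have h1 : Continuous fun σ : ℝ => Lp.compMeasurePreserving (g σ) (hmp σ) f :=
    continuous_const.compMeasurePreservingLp g.continuous hmp hp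
  have h0 : Lp.compMeasurePreserving (g 0) (hmp 0) f = f := by
    refine Lp.ext ((Lp.coeFn_compMeasurePreserving f (hmp 0)).trans ?_)
    refine Eventually.of_forall fun t => ?_
    simp [g]
  have h2 : Tendsto (fun σ : ℝ => ‖Lp.compMeasurePreserving (g σ) (hmp σ) f - f‖ₑ) (𝓝 0) (𝓝 0) := by
    have := ((h1.sub (continuous_const (y := f))).enorm).tendsto 0
    simp only [Pi.sub_apply] at this
    rwa [h0, sub_self, enorm_zero] at this
  refine h2.congr fun σ => ?_
  rw [Lp.enorm_def]
  refine eLpNorm_congr_ae ?_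
  have h3 := Lp.coeFn_compMeasurePreserving f (hmp σ)
  have h4 : f =ᵐ[volume] x := hx.coeFn_toLp
  have h5 := (hmp σ).quasiMeasurePreserving.ae h4
  filter_upwards [Lp.coeFn_sub (Lp.compMeasurePreserving (g σ) (hmp σ) f) f, h3, h4, h5]
    with t a b c d
  rw [a, Pi.sub_apply, b, c, Function.comp_apply, d]
  simp [g, add_comm]

theorem lintegral_enorm_mul_le {α E F : Type*} [MeasurableSpace α] {μ : Measure α}
    [NormedAddCommGroup E] [NormedAddCommGroup F] {p q : ℝ≥0∞} [ENNReal.HolderConjugate p q]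
    {f : α → E} {g : α → F} (hf : AEStronglyMeasurable f μ) (hg : AEStronglyMeasurable g μ) :
    ∫⁻ x, ‖f x‖ₑ * ‖g x‖ₑ ∂μ ≤ eLpNorm f p μ * eLpNorm g q μ := by
  have h := eLpNorm_smul_le_mul_eLpNorm (p := p) (q := q) (r := 1) (μ := μ)
    (f := fun x => ‖g x‖) (φ := fun x => ‖f x‖) hg.norm hf.norm
  rw [eLpNorm_norm, eLpNorm_norm, eLpNorm_one_eq_lintegral_enorm] at h
  simpa [enorm_mul] using h

theorem setLIntegral_Ioc_eq_translate (φ : ℝ → ℝ≥0∞) (t h : ℝ) :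
    ∫⁻ τ in Ioc t (t + h), φ τ = ∫⁻ σ in Ioc 0 h, φ (t + σ) := by
  rw [← lintegral_indicator measurableSet_Ioc, ← lintegral_indicator measurableSet_Ioc,
    ← lintegral_add_left_eq_self _ t]
  refine lintegral_congr fun σ => ?_
  simp [indicator]

/-- The `L¹` norm of the increment of `F` with step `h`, over the part of `(0, T)` on which it is
defined. -/
noncomputable def incrementNorm (T : ℝ) (F : ℝ → ℝ) (h : ℝ) : ℝ≥0∞ :=
  ∫⁻ t in Ioo 0 (T - h), ‖F (t + h) - F t‖ₑ

/-- Telescoping. The domain of integration shrinks with the step, so that each translated increment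
of step `h` still lies over `(0, T - h)`. -/
theorem incrementNorm_nsmul_le {T : ℝ} {F : ℝ → ℝ} (hF : Measurable F) {h : ℝ} (hh : 0 ≤ h)
    (n : ℕ) : incrementNorm T F (n * h) ≤ n * incrementNorm T F h := by
  induction n with
  | zero => simp [incrementNorm]
  | succ n ih =>
    have hnh : 0 ≤ (n : ℝ) * h := by positivity
    have h1 : incrementNorm T F ((n + 1 : ℕ) * h) ≤
        (∫⁻ t in Ioo 0 (T - (n + 1 : ℕ) * h), ‖F (t + n * h + h) - F (t + n * h)‖ₑ) +
        ∫⁻ t in Ioo 0 (T - (n + 1 : ℕ) * h), ‖F (t + n * h) - F t‖ₑ := by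
      rw [← lintegral_add_right _ (by fun_prop)]
      refine lintegral_mono fun t => ?_
      have : F (t + ((n + 1 : ℕ) : ℝ) * h) - F t =
          (F (t + n * h + h) - F (t + n * h)) + (F (t + n * h) - F t) := by
        push_cast; ring_nf
      rw [this]
      exact enorm_add_le _ _
    have h2 : (∫⁻ t in Ioo 0 (T - (n + 1 : ℕ) * h), ‖F (t + n * h) - F t‖ₑ) ≤
        incrementNorm T F (n * h) := by
      refine lintegral_mono_set (Ioo_subset_Ioo_right ?_)
      push_cast; linarith
    have h3 : (∫⁻ t in Ioo 0 (T - (n + 1 : ℕ) * h), ‖F (t + n * h + h) - F (t + n * h)‖ₑ) ≤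
        incrementNorm T F h := by
      rw [incrementNorm, ← lintegral_indicator measurableSet_Ioo,
        ← lintegral_indicator measurableSet_Ioo,
        ← lintegral_add_right_eq_self ((Ioo 0 (T - h)).indicator _) (n * h)]
      refine lintegral_mono fun t => ?_
      by_cases ht : t ∈ Ioo 0 (T - (n + 1 : ℕ) * h)
      · have : t + n * h ∈ Ioo 0 (T - h) := by
          have := ht.2
          push_cast at this
          exact ⟨by linarith [ht.1], by linarith⟩
        rw [indicator_of_mem ht, indicator_of_mem this]
      · simp only [indicator_of_notMem ht]; exact zero_le
    calc _ ≤ _ := h1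
      _ ≤ incrementNorm T F h + n * incrementNorm T F h := add_le_add h3 (h2.trans ih)
      _ = _ := by push_cast; ring

section Increments

variable {V : Type*} [NormedAddCommGroup V] {p q : ℝ≥0∞} [ENNReal.HolderConjugate p q]

/-- Writing `τ = t + σ` and exchanging integrals, for fixed `σ` the two differences of `x` become,
after a shift of `t`, translates by `h - σ` and `-σ`, both of size at most `h`. Hölder's inequality
in `t` then yields `η`, and the integral over `σ` yields the factor `h`. The gain over a Lipschitz
bound is that `η` may be taken small with `h`. -/
theorem incrementNorm_le {T : ℝ} {x : ℝ → V} {m F : ℝ → ℝ}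
    (hx : StronglyMeasurable x) (hm : Measurable m)
    {E : Set ℝ} (hE : ∀ᵐ t, t ∈ Ioo 0 T → t ∈ E)
    (hFE : ∀ s ∈ E, ∀ t ∈ E, s < t →
      ‖F t - F s‖ₑ ≤ ∫⁻ τ in Ioc s t, ‖m τ‖ₑ * (‖x t - x τ‖ₑ + ‖x s - x τ‖ₑ))
    {h : ℝ} (hh : 0 < h) {η : ℝ≥0∞}
    (hη : ∀ σ : ℝ, |σ| ≤ h → eLpNorm (fun t => x (t + σ) - x t) p volume ≤ η) :
    incrementNorm T F h ≤ ENNReal.ofReal h * (2 * η * eLpNorm m q volume) := by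
  have hE' : ∀ᵐ t : ℝ, t + h ∈ Ioo 0 T → t + h ∈ E :=
    (measurePreserving_add_right (volume : Measure ℝ) h).quasiMeasurePreserving.ae hE
  have hcx : ∀ (c : ℝ) , StronglyMeasurable fun t => x (t + c) := fun c =>
    hx.comp_measurable (by fun_prop)
  have key : ∀ σ ∈ Ioc 0 h, ∫⁻ t, ‖m (t + σ)‖ₑ * (‖x (t + h) - x (t + σ)‖ₑ + ‖x t - x (t + σ)‖ₑ)
      ≤ 2 * η * eLpNorm m q volume := by
    intro σ hσ
    have h1 : ∫⁻ t, ‖m (t + σ)‖ₑ * (‖x (t + h) - x (t + σ)‖ₑ + ‖x t - x (t + σ)‖ₑ) =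
        ∫⁻ t, (‖x (t + (h - σ)) - x t‖ₑ * ‖m t‖ₑ + ‖x (t + (-σ)) - x t‖ₑ * ‖m t‖ₑ) := by
      rw [← lintegral_add_right_eq_self (fun t => ‖x (t + (h - σ)) - x t‖ₑ * ‖m t‖ₑ +
        ‖x (t + (-σ)) - x t‖ₑ * ‖m t‖ₑ) σ]
      refine lintegral_congr fun t => ?_
      rw [show t + σ + (h - σ) = t + h by ring, show t + σ + -σ = t by ring]
      ring
    have hms : ∀ c : ℝ, AEStronglyMeasurable (fun t => x (t + c) - x t) volume := fun c =>
      ((hcx c).sub hx).aestronglyMeasurable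
    rw [h1, lintegral_add_left' (AEMeasurable.fun_mul (hms _).enorm hm.enorm.aemeasurable)]
    have h2 := lintegral_enorm_mul_le (p := p) (q := q) (hms (h - σ)) hm.aestronglyMeasurable
    have h3 := lintegral_enorm_mul_le (p := p) (q := q) (hms (-σ)) hm.aestronglyMeasurable
    have h4 := hη (h - σ) (by rw [abs_of_nonneg] <;> linarith [hσ.1, hσ.2])
    have h5 := hη (-σ) (by rw [abs_neg, abs_of_pos hσ.1]; exact hσ.2)
    calc _ ≤ η * eLpNorm m q volume + η * eLpNorm m q volume := by
          refine add_le_add (h2.trans ?_) (h3.trans ?_) <;> gcongr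
      _ = _ := by ring
  have hmeas : Measurable (Function.uncurry fun t σ : ℝ =>
      ‖m (t + σ)‖ₑ * (‖x (t + h) - x (t + σ)‖ₑ + ‖x t - x (t + σ)‖ₑ)) := by
    have e1 : StronglyMeasurable fun z : ℝ × ℝ => x (z.1 + z.2) := hx.comp_measurable (by fun_prop)
    have e2 : StronglyMeasurable fun z : ℝ × ℝ => x (z.1 + h) := hx.comp_measurable (by fun_prop)
    have e3 : StronglyMeasurable fun z : ℝ × ℝ => x z.1 := hx.comp_measurable (by fun_prop)
    have e4 : Measurable fun z : ℝ × ℝ => m (z.1 + z.2) := hm.comp (by fun_prop)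
    exact e4.enorm.mul ((e2.sub e1).enorm.add (e3.sub e1).enorm)
  calc incrementNorm T F h
      ≤ ∫⁻ t in Ioo 0 (T - h), ∫⁻ σ in Ioc 0 h,
        ‖m (t + σ)‖ₑ * (‖x (t + h) - x (t + σ)‖ₑ + ‖x t - x (t + σ)‖ₑ) := by
        refine setLIntegral_mono_ae' measurableSet_Ioo ?_
        filter_upwards [hE, hE'] with t h1 h2 ht
        rw [← setLIntegral_Ioc_eq_translate
          (fun τ => ‖m τ‖ₑ * (‖x (t + h) - x τ‖ₑ + ‖x t - x τ‖ₑ))]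
        exact hFE t (h1 ⟨ht.1, by linarith [ht.2]⟩) (t + h)
          (h2 ⟨by linarith [ht.1], by linarith [ht.2]⟩) (by linarith)
    _ ≤ ∫⁻ t, ∫⁻ σ in Ioc 0 h,
        ‖m (t + σ)‖ₑ * (‖x (t + h) - x (t + σ)‖ₑ + ‖x t - x (t + σ)‖ₑ) := setLIntegral_le_lintegral _ _
    _ = ∫⁻ σ in Ioc 0 h, ∫⁻ t,
        ‖m (t + σ)‖ₑ * (‖x (t + h) - x (t + σ)‖ₑ + ‖x t - x (t + σ)‖ₑ) :=
        lintegral_lintegral_swap hmeas.aemeasurable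
    _ ≤ ∫⁻ σ in Ioc 0 h, 2 * η * eLpNorm m q volume := setLIntegral_mono' measurableSet_Ioc key
    _ = _ := by rw [setLIntegral_const, Real.volume_Ioc, sub_zero, mul_comm]

/-- By Fubini, for a.e. `t` the equality `F s = F t` holds for a.e. later `s`. Two such times are
compared through a common later `s`, so no continuity of `F` is needed. -/
theorem ae_eq_const_of_increment {T : ℝ} (hT : 0 < T) {F : ℝ → ℝ} (hF : Measurable F)
    (h0 : ∀ h, 0 < h → incrementNorm T F h = 0) :
    ∃ c, ∀ᵐ t ∂(volume.restrict (Ioo 0 T)), F t = c := by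
  have h1 : ∀ᵐ h : ℝ, ∀ᵐ t : ℝ, 0 < h → 0 < t → t + h < T → F (t + h) = F t := by
    refine Eventually.of_forall fun h => ?_
    by_cases hh : 0 < h
    · have := h0 h hh
      rw [incrementNorm, lintegral_eq_zero_iff (by fun_prop),
        EventuallyEq, ae_restrict_iff' measurableSet_Ioo] at this
      filter_upwards [this] with t ht _ h2 h3
      have := ht ⟨h2, by linarith⟩
      simpa [sub_eq_zero] using this
    · simp [hh]
  have h2 : ∀ᵐ t : ℝ, ∀ᵐ h : ℝ, 0 < h → 0 < t → t + h < T → F (t + h) = F t := by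
    rw [Measure.ae_ae_comm] at h1
    · exact h1
    -- Exchanging the two a.e. quantifiers requires a measurable set; the implications are rewritten
    -- as a union of measurable conditions.
    · have e : {z : ℝ × ℝ | 0 < z.1 → 0 < z.2 → z.2 + z.1 < T → F (z.2 + z.1) = F z.2} =
        {z | z.1 ≤ 0} ∪ {z | z.2 ≤ 0} ∪ {z | T ≤ z.2 + z.1} ∪ {z | F (z.2 + z.1) = F z.2} := by
        ext z
        simp only [mem_ofPred_eq, mem_union, ← not_lt]
        tauto
      rw [e]
      exact (((measurableSet_le (by fun_prop) (by fun_prop)).union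
        (measurableSet_le (by fun_prop) (by fun_prop))).union
        (measurableSet_le (by fun_prop) (by fun_prop))).union
        (measurableSet_eq_fun (by fun_prop) (by fun_prop))
  have h3 : ∀ᵐ t : ℝ, ∀ᵐ s : ℝ, 0 < t → t < s → s < T → F s = F t := by
    filter_upwards [h2] with t ht
    have := (measurePreserving_add_right (volume : Measure ℝ) (-t)).quasiMeasurePreserving.ae ht
    filter_upwards [this] with s hs a b c
    have := hs (by linarith) a (by linarith)
    rwa [show t + (s + -t) = s by ring] at this
  have h4 : ∀ t₁ t₂ : ℝ, (∀ᵐ s : ℝ, 0 < t₁ → t₁ < s → s < T → F s = F t₁) →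
      (∀ᵐ s : ℝ, 0 < t₂ → t₂ < s → s < T → F s = F t₂) → t₁ ∈ Ioo 0 T → t₂ ∈ Ioo 0 T →
      F t₁ = F t₂ := by
    intro t₁ t₂ a₁ a₂ b₁ b₂
    have hne : (ae (volume.restrict (Ioo (max t₁ t₂) T))).NeBot := by
      rw [ae_neBot, Ne, Measure.restrict_eq_zero, Real.volume_Ioo]
      simp [b₁.2, b₂.2]
    have a₁' := ae_restrict_of_ae (s := Ioo (max t₁ t₂) T) a₁
    have a₂' := ae_restrict_of_ae (s := Ioo (max t₁ t₂) T) a₂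
    obtain ⟨s, s1, s2, s3⟩ := (a₁'.and (a₂'.and (ae_restrict_mem measurableSet_Ioo))).exists
    have := max_lt_iff.1 s3.1
    rw [← s1 b₁.1 this.1 s3.2, ← s2 b₂.1 this.2 s3.2]
  have hne : (ae (volume.restrict (Ioo 0 T))).NeBot := by
    rw [ae_neBot, Ne, Measure.restrict_eq_zero, Real.volume_Ioo]
    simp [hT]
  obtain ⟨t₀, a₀, b₀⟩ := ((ae_restrict_of_ae (s := Ioo 0 T) h3).and
    (ae_restrict_mem measurableSet_Ioo)).exists
  refine ⟨F t₀, ?_⟩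
  filter_upwards [ae_restrict_of_ae (s := Ioo 0 T) h3, ae_restrict_mem measurableSet_Ioo]
    with t ht ht'
  exact h4 t t₀ ht a₀ ht' b₀

/-- A step `h` is cut into `n` steps `h / n`, each costing at most `(h / n) · 2η‖m‖_q`. The total
`2hη‖m‖_q` does not depend on `n`, while `η` is arbitrarily small once `h / n` is below the
corresponding modulus of translation continuity. -/
theorem ae_eq_const_of_increment_le_of_measurable {T : ℝ} (hT : 0 < T) {x : ℝ → V} {m F : ℝ → ℝ}
    (hp : p ≠ ⊤) (hx : StronglyMeasurable x) (hm : Measurable m) (hF : Measurable F)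
    (hxp : MemLp x p volume) (hmq : MemLp m q volume)
    {E : Set ℝ} (hE : ∀ᵐ t, t ∈ Ioo 0 T → t ∈ E)
    (hFE : ∀ s ∈ E, ∀ t ∈ E, s < t →
      ‖F t - F s‖ₑ ≤ ∫⁻ τ in Ioc s t, ‖m τ‖ₑ * (‖x t - x τ‖ₑ + ‖x s - x τ‖ₑ)) :
    ∃ c, ∀ᵐ t ∂(volume.restrict (Ioo 0 T)), F t = c := by
  refine ae_eq_const_of_increment hT hF fun h hh => ?_
  have htr := tendsto_eLpNorm_translate (ENNReal.HolderConjugate.one_le p q) hp hxp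
  by_contra hne
  set K : ℝ≥0∞ := ENNReal.ofReal h * (2 * eLpNorm m q volume) with hK
  have hKt : K ≠ ⊤ := by
    have := hmq.2.ne
    finiteness
  obtain ⟨η, hη0, hη⟩ : ∃ η : ℝ≥0∞, 0 < η ∧ K * η < incrementNorm T F h := by
    have : Tendsto (fun η => K * η) (𝓝 0) (𝓝 (K * 0)) :=
      ENNReal.Tendsto.const_mul tendsto_id (Or.inr hKt)
    rw [mul_zero] at this
    have h1 := this.eventually (gt_mem_nhds (pos_iff_ne_zero.2 hne))
    have h2 : ∃ᶠ η : ℝ≥0∞ in 𝓝 0, 0 < η := by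
      have : (𝓝[>] (0 : ℝ≥0∞)).NeBot := inferInstance
      exact (frequently_nhdsWithin_iff.1 (eventually_mem_nhdsWithin (s := Ioi 0) (a := (0:ℝ≥0∞))).frequently).mono fun a ha => ha.1
    obtain ⟨η, a, b⟩ := (h2.and_eventually h1).exists
    exact ⟨η, a, b⟩
  have h1 := htr.eventually (ge_mem_nhds hη0)
  obtain ⟨δ, hδ, hδη⟩ := Metric.eventually_nhds_iff.1 h1
  obtain ⟨n, hn⟩ := exists_nat_gt (h / δ)
  have hn0 : (0 : ℝ) < n := lt_trans (by positivity) hn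
  have hhn : h / n < δ := by
    rw [div_lt_iff₀ hδ] at hn
    rw [div_lt_iff₀ hn0]; linarith
  have h2 := incrementNorm_le (p := p) (q := q) (T := T) hx hm hE hFE (h := h / n) (by positivity)
    (η := η) (fun σ hσ => hδη (by simpa using hσ.trans_lt hhn))
  have h3 := incrementNorm_nsmul_le (T := T) hF (h := h / n) (by positivity) n
  rw [mul_div_cancel₀ _ hn0.ne'] at h3
  have h4 : incrementNorm T F h ≤ K * η := by
    refine h3.trans ((mul_le_mul_right h2 _).trans (le_of_eq ?_))
    have : (n : ℝ≥0∞) * ENNReal.ofReal (h / n) = ENNReal.ofReal h := by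
      rw [← ENNReal.ofReal_natCast, ← ENNReal.ofReal_mul (by positivity), mul_div_cancel₀ _ hn0.ne']
    rw [← mul_assoc, this, hK]
    ring
  exact absurd hη (not_lt.2 h4)

theorem ae_eq_const_of_increment_le {T : ℝ} (hT : 0 < T) {x : ℝ → V} {m F : ℝ → ℝ}
    (hp : p ≠ ⊤) (hx : MemLp x p (volume.restrict (Ioo 0 T)))
    (hm : MemLp m q (volume.restrict (Ioo 0 T)))
    (hF : AEStronglyMeasurable F (volume.restrict (Ioo 0 T)))
    {E : Set ℝ} (hE : ∀ᵐ t ∂(volume.restrict (Ioo 0 T)), t ∈ E)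
    (hFE : ∀ s ∈ E, ∀ t ∈ E, s ∈ Ioo 0 T → t ∈ Ioo 0 T → s < t →
      ‖F t - F s‖ₑ ≤ ∫⁻ τ in Ioc s t, ‖m τ‖ₑ * (‖x t - x τ‖ₑ + ‖x s - x τ‖ₑ)) :
    ∃ c, ∀ᵐ t ∂(volume.restrict (Ioo 0 T)), F t = c := by
  obtain ⟨x', hx's, hx'⟩ := hx.1
  obtain ⟨F', hF's, hF'⟩ := hF
  obtain ⟨m', hm's, hm'⟩ := hm.1
  have hmI : MemLp ((Ioo 0 T).indicator m') q volume :=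
    (memLp_indicator_iff_restrict measurableSet_Ioo).2 ((memLp_congr_ae hm').1 hm)
  have hxI : MemLp ((Ioo 0 T).indicator x') p volume :=
    (memLp_indicator_iff_restrict measurableSet_Ioo).2 ((memLp_congr_ae hx').1 hx)
  -- Strongly measurable representatives are extended by zero to the line. The jumps at `0` and `T`
  -- are harmless, since the increment inequality is only required between times of `(0, T)` at
  -- which the representatives agree with the given functions.
  have key := ae_eq_const_of_increment_le_of_measurable (p := p) (q := q) hT (F := F') hp
    (hx's.indicator measurableSet_Ioo) (hm's.indicator measurableSet_Ioo).measurable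
    hF's.measurable hxI hmI (E := {t | t ∈ Ioo 0 T ∧ t ∈ E ∧ x t = x' t ∧ F t = F' t}) ?_ ?_
  · obtain ⟨c, hc⟩ := key
    refine ⟨c, ?_⟩
    filter_upwards [hc, hF'] with t h1 h2
    rw [h2, h1]
  · rw [← ae_restrict_iff' measurableSet_Ioo]
    filter_upwards [hE, hx', hF', ae_restrict_mem measurableSet_Ioo] with t h1 h2 h3 h4
    exact ⟨h4, h1, h2, h3⟩
  · rintro s ⟨hs, hsE, hsx, hsF⟩ t ⟨ht, htE, htx, htF⟩ hst
    rw [← hsF, ← htF]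
    refine (hFE s hsE t htE hs ht hst).trans (le_of_eq ?_)
    have hsub : Ioc s t ⊆ Ioo 0 T := fun τ hτ => ⟨hs.1.trans hτ.1, hτ.2.trans_lt ht.2⟩
    refine lintegral_congr_ae ?_
    filter_upwards [ae_restrict_of_ae_restrict_of_subset hsub hx',
      ae_restrict_of_ae_restrict_of_subset hsub hm', ae_restrict_mem measurableSet_Ioc]
      with τ h1 h2 h3
    rw [indicator_of_mem (hsub h3), indicator_of_mem (hsub h3), indicator_of_mem hs,
      indicator_of_mem ht, ← h1, ← h2, ← hsx, ← htx]

end Increments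

/-! ### Measurability of compositions, and the energy identity for weak evolutions -/

/-- Clear for simple `x`, then by pointwise limits of simple approximations. It makes `s ↦ g s (y
s)` measurable when `g` is only scalarly measurable in the dual, where strong measurability is not
assumed. -/
theorem aestronglyMeasurable_caratheodory_comp {α X : Type*} [MeasurableSpace α] {μ : Measure α}
    [TopologicalSpace X] {G : α → X → ℝ} {x : α → X}
    (hG : ∀ᵐ s ∂μ, Continuous (G s)) (hm : ∀ v, AEStronglyMeasurable (fun s => G s v) μ)
    (hx : AEStronglyMeasurable x μ) : AEStronglyMeasurable (fun s => G s (x s)) μ := by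
  obtain ⟨x', hx's, hx'⟩ := hx
  have h1 : ∀ φ : SimpleFunc α X, AEStronglyMeasurable (fun s => G s (φ s)) μ := by
    intro φ
    have : (fun s => G s (φ s)) =
        ∑ v ∈ φ.range, (φ ⁻¹' {v}).indicator (fun s => G s v) := by
      funext s
      rw [Finset.sum_apply, Finset.sum_eq_single (φ s)]
      · simp
      · intro v _ hv
        exact indicator_of_notMem (by simpa using hv.symm) _
      · intro h; exact absurd (SimpleFunc.mem_range_self φ s) h
    rw [this]
    exact Finset.aestronglyMeasurable_sum _ fun v _ =>
      (hm v).indicator (φ.measurableSet_preimage _)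
  have h2 : AEStronglyMeasurable (fun s => G s (x' s)) μ := by
    refine aestronglyMeasurable_of_tendsto_ae atTop (fun n => h1 (hx's.approx n)) ?_
    filter_upwards [hG] with s hs
    exact (hs.tendsto _).comp (hx's.tendsto_approx s)
  refine h2.congr ?_
  filter_upwards [hx'] with s hs
  rw [hs]

section Energy

variable {V H : Type*} [NormedAddCommGroup V] [NormedSpace ℝ V]
  [NormedAddCommGroup H] [NormedSpace ℝ H]
  {p q : ℝ≥0∞} [ENNReal.HolderConjugate p q]
  {T : ℝ} {B : H →L[ℝ] H →L[ℝ] ℝ} {ι : V →L[ℝ] H} {u0 : H} {x : ℝ → V}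
  {g : ℝ → V →L[ℝ] ℝ} {m : ℝ → ℝ}

theorem integrableOn_dual_apply (hg : ∀ v, AEStronglyMeasurable (fun s => g s v) (volume.restrict (Ioo 0 T)))
    (hm : MemLp m q (volume.restrict (Ioo 0 T)))
    (hgm : ∀ᵐ s ∂(volume.restrict (Ioo 0 T)), ‖g s‖ ≤ m s)
    {y : ℝ → V} (hy : MemLp y p (volume.restrict (Ioo 0 T))) :
    IntegrableOn (fun s => g s (y s)) (Ioo 0 T) := by
  have h1 : AEStronglyMeasurable (fun s => g s (y s)) (volume.restrict (Ioo 0 T)) :=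
    aestronglyMeasurable_caratheodory_comp (Eventually.of_forall fun s => (g s).continuous) hg hy.1
  have h2 : Integrable (fun s => ‖y s‖ * m s) (volume.restrict (Ioo 0 T)) :=
    hy.norm.integrable_mul hm
  refine h2.mono' h1 ?_
  filter_upwards [hgm] with s hs
  rw [mul_comm]
  exact ((g s).le_opNorm _).trans (by gcongr)

/-- The exceptional set of times is made independent of `v`: a countable dense set of `v` is handled
at once, and both sides are continuous in `v`. This is what permits the choice `v = x t`. -/
theorem ae_forall_weak_equation [TopologicalSpace.SeparableSpace V]
    (hg : ∀ v, AEStronglyMeasurable (fun s => g s v) (volume.restrict (Ioo 0 T)))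
    (hq : 1 ≤ q) (hm : MemLp m q (volume.restrict (Ioo 0 T)))
    (hgm : ∀ᵐ s ∂(volume.restrict (Ioo 0 T)), ‖g s‖ ≤ m s)
    (heq : ∀ v, ∀ᵐ t ∂(volume.restrict (Ioo 0 T)),
      B (ι (x t)) (ι v) = B u0 (ι v) + ∫ s in (0 : ℝ)..t, g s v) :
    ∀ᵐ t ∂(volume.restrict (Ioo 0 T)), ∀ v,
      B (ι (x t)) (ι v) = B u0 (ι v) + ∫ s in (0 : ℝ)..t, g s v := by
  have h1 := ae_all_iff.2 fun n => heq (TopologicalSpace.denseSeq V n)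
  have hmi : IntegrableOn m (Ioo 0 T) := hm.integrable hq
  filter_upwards [h1, ae_restrict_mem measurableSet_Ioo] with t ht htT
  have hsub : Ioc 0 t ⊆ Ioo 0 T := fun τ hτ => ⟨hτ.1, hτ.2.trans_lt htT.2⟩
  have hgi : ∀ v, IntervalIntegrable (fun s => g s v) volume 0 t := fun v => by
    rw [intervalIntegrable_iff_integrableOn_Ioc_of_le htT.1.le]
    refine IntegrableOn.mono_set ?_ hsub
    refine (hmi.mul_const ‖v‖).mono' (hg v) ?_
    filter_upwards [hgm] with s hs
    exact ((g s).le_opNorm _).trans (by gcongr)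
  have hcont : Continuous fun v => ∫ s in (0 : ℝ)..t, g s v := by
    let L : V →ₗ[ℝ] ℝ :=
      { toFun := fun v => ∫ s in (0 : ℝ)..t, g s v
        map_add' := fun v w => by
          simp only [map_add]
          exact intervalIntegral.integral_add (hgi v) (hgi w)
        map_smul' := fun c v => by
          simp only [map_smul]
          exact intervalIntegral.integral_smul c _ }
    refine (L.mkContinuous (∫ s in (0 : ℝ)..t, m s) fun v => ?_).continuous
    change ‖∫ s in (0 : ℝ)..t, g s v‖ ≤ _
    rw [← intervalIntegral.integral_mul_const]
    refine intervalIntegral.norm_integral_le_of_norm_le htT.1.le ?_ ?_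
    · rw [← ae_restrict_iff' measurableSet_Ioc]
      filter_upwards [ae_restrict_of_ae_restrict_of_subset hsub hgm] with s hs
      exact ((g s).le_opNorm _).trans (by gcongr)
    · exact ((intervalIntegrable_iff_integrableOn_Ioc_of_le htT.1.le).2
        (hmi.mono_set hsub)).mul_const _
  have hl : Continuous fun v => B (ι (x t)) (ι v) := by fun_prop
  have hr : Continuous fun v => B u0 (ι v) + ∫ s in (0 : ℝ)..t, g s v :=
    Continuous.add (by fun_prop) hcont
  have := (TopologicalSpace.denseRange_denseSeq V).equalizer hl hr (funext ht)
  exact fun v => congrFun this v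

theorem enorm_setIntegral_dual_le {J : Set ℝ}
    (hgm : ∀ᵐ s ∂(volume.restrict J), ‖g s‖ ≤ m s) (y : ℝ → V) :
    ‖∫ s in J, g s (y s)‖ₑ ≤ ∫⁻ s in J, ‖m s‖ₑ * ‖y s‖ₑ := by
  refine (enorm_integral_le_lintegral_enorm _).trans (lintegral_mono_ae ?_)
  filter_upwards [hgm] with s hs
  have h : ‖g s‖ₑ ≤ ‖m s‖ₑ :=
    enorm_le_iff_norm_le.2 (hs.trans (le_abs_self _))
  exact ((g s).le_opENorm _).trans (by gcongr)

/-- `x` satisfies, on `(0, T)`, the time-integrated evolution equation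
`B (ι (x t)) (ι v) = B u0 (ι v) + ∫ s in 0..t, g s v` for all `v`, with a right-hand side that is
bounded in the dual space by a function of the dual exponent. -/
structure IsWeakEvolution (T : ℝ) (B : H →L[ℝ] H →L[ℝ] ℝ) (ι : V →L[ℝ] H) (u0 : H) (x : ℝ → V)
    (g : ℝ → V →L[ℝ] ℝ) (m : ℝ → ℝ) (p q : ℝ≥0∞) : Prop where
  pos : 0 < T
  memLp : MemLp x p (volume.restrict (Ioo 0 T))
  meas : ∀ v, AEStronglyMeasurable (fun s => g s v) (volume.restrict (Ioo 0 T))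
  memLp_bound : MemLp m q (volume.restrict (Ioo 0 T))
  bound : ∀ᵐ s ∂(volume.restrict (Ioo 0 T)), ‖g s‖ ≤ m s
  equation : ∀ᵐ t ∂(volume.restrict (Ioo 0 T)), ∀ v,
    B (ι (x t)) (ι v) = B u0 (ι v) + ∫ s in (0 : ℝ)..t, g s v

namespace IsWeakEvolution

theorem integrableOn_apply (h : IsWeakEvolution T B ι u0 x g m p q)
    {y : ℝ → V} (hy : MemLp y p (volume.restrict (Ioo 0 T))) :
    IntegrableOn (fun s => g s (y s)) (Ioo 0 T) :=
  integrableOn_dual_apply h.meas h.memLp_bound h.bound hy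

theorem intervalIntegrable_apply (h : IsWeakEvolution T B ι u0 x g m p q)
    {y : ℝ → V} (hy : MemLp y p (volume.restrict (Ioo 0 T))) :
    IntervalIntegrable (fun s => g s (y s)) volume 0 T := by
  rw [intervalIntegrable_iff_integrableOn_Ioo_of_le h.pos.le]
  exact h.integrableOn_apply hy

theorem integral_sub_integral (h : IsWeakEvolution T B ι u0 x g m p q)
    {y : ℝ → V} (hy : MemLp y p (volume.restrict (Ioo 0 T))) {s t : ℝ} (hs : s ∈ Ioo 0 T)
    (ht : t ∈ Ioo 0 T) (hst : s ≤ t) :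
    (∫ τ in (0 : ℝ)..t, g τ (y τ)) - ∫ τ in (0 : ℝ)..s, g τ (y τ) =
      ∫ τ in Ioc s t, g τ (y τ) := by
  have hi := h.intervalIntegrable_apply hy
  rw [intervalIntegral.integral_interval_sub_left
    (hi.mono_set (uIcc_subset_uIcc_left ⟨by simpa [h.pos.le] using ht.1.le, by simpa [h.pos.le] using ht.2.le⟩))
    (hi.mono_set (uIcc_subset_uIcc_left ⟨by simpa [h.pos.le] using hs.1.le, by simpa [h.pos.le] using hs.2.le⟩)),
    intervalIntegral.integral_of_le hst]

theorem increment (h : IsWeakEvolution T B ι u0 x g m p q) {s t : ℝ} (hs : s ∈ Ioo 0 T)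
    (ht : t ∈ Ioo 0 T) (hst : s ≤ t)
    (hes : ∀ v, B (ι (x s)) (ι v) = B u0 (ι v) + ∫ τ in (0 : ℝ)..s, g τ v)
    (het : ∀ v, B (ι (x t)) (ι v) = B u0 (ι v) + ∫ τ in (0 : ℝ)..t, g τ v) (v : V) :
    B (ι (x t)) (ι v) - B (ι (x s)) (ι v) = ∫ τ in Ioc s t, g τ v := by
  rw [hes, het, ← h.integral_sub_integral (memLp_const v) hs ht hst]
  ring

/-- By symmetry, `B(x_t, x_t) - B(x_s, x_s)` is the equation between `s` and `t` tested with `x_t +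
x_s`. Subtracting `2 ∫ g_τ(x_τ)` leaves a trapezoidal error that contains only differences `x_t -
x_τ` and `x_s - x_τ`, as `ae_eq_const_of_increment_le` requires. -/
theorem exists_energy_eq (h : IsWeakEvolution T B ι u0 x g m p q) (hp : p ≠ ⊤)
    (hB : ∀ a b, B a b = B b a) :
    ∃ c, ∀ᵐ t ∂(volume.restrict (Ioo 0 T)),
      B (ι (x t)) (ι (x t)) = c + 2 * ∫ τ in (0 : ℝ)..t, g τ (x τ) := by
  have hFm : AEStronglyMeasurable
      (fun t => B (ι (x t)) (ι (x t)) - 2 * ∫ τ in (0 : ℝ)..t, g τ (x τ))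
      (volume.restrict (Ioo 0 T)) := by
    have hc : Continuous fun v : V => B (ι v) (ι v) := by fun_prop
    refine (hc.comp_aestronglyMeasurable h.memLp.1).sub (AEStronglyMeasurable.const_mul ?_ 2)
    have h1 := intervalIntegral.continuousOn_primitive_interval'
      (h.intervalIntegrable_apply h.memLp) (left_mem_uIcc)
    rw [uIcc_of_le h.pos.le] at h1
    exact (h1.mono Ioo_subset_Icc_self).aestronglyMeasurable measurableSet_Ioo
  suffices key : ∃ c, ∀ᵐ t ∂(volume.restrict (Ioo 0 T)),
      B (ι (x t)) (ι (x t)) - 2 * ∫ τ in (0 : ℝ)..t, g τ (x τ) = c by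
    obtain ⟨c, hc⟩ := key
    refine ⟨c, ?_⟩
    filter_upwards [hc] with t ht
    linarith
  refine ae_eq_const_of_increment_le (p := p) (q := q) h.pos hp h.memLp h.memLp_bound hFm
    (E := {t | ∀ v, B (ι (x t)) (ι v) = B u0 (ι v) + ∫ s in (0 : ℝ)..t, g s v}) h.equation ?_
  · intro s hes t het hs ht hst
    have hsub : Ioc s t ⊆ Ioo 0 T := fun τ hτ => ⟨hs.1.trans hτ.1, hτ.2.trans_lt ht.2⟩
    have hgi : ∀ {y : ℝ → V}, MemLp y p (volume.restrict (Ioo 0 T)) →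
      IntegrableOn (fun s => g s (y s)) (Ioc s t) := fun hy => (h.integrableOn_apply hy).mono_set hsub
    have e1 : B (ι (x t)) (ι (x t)) - B (ι (x s)) (ι (x s)) =
        (∫ τ in Ioc s t, g τ (x t)) + ∫ τ in Ioc s t, g τ (x s) := by
      rw [← h.increment hs ht hst.le hes het, ← h.increment hs ht hst.le hes het,
        hB (ι (x s)) (ι (x t))]
      ring
    have e2 : (B (ι (x t)) (ι (x t)) - 2 * ∫ τ in (0 : ℝ)..t, g τ (x τ)) -
        (B (ι (x s)) (ι (x s)) - 2 * ∫ τ in (0 : ℝ)..s, g τ (x τ)) =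
        ∫ τ in Ioc s t, g τ ((x t - x τ) + (x s - x τ)) := by
      have e3 := h.integral_sub_integral h.memLp hs ht hst.le
      have e4 : ∫ τ in Ioc s t, g τ ((x t - x τ) + (x s - x τ)) =
          ((∫ τ in Ioc s t, g τ (x t)) - ∫ τ in Ioc s t, g τ (x τ)) +
          ((∫ τ in Ioc s t, g τ (x s)) - ∫ τ in Ioc s t, g τ (x τ)) := by
        simp only [map_add]
        rw [integral_add (hgi (y := fun τ => x t - x τ) ((memLp_const _).sub h.memLp))
          (hgi (y := fun τ => x s - x τ) ((memLp_const _).sub h.memLp))]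
        simp only [map_sub]
        rw [integral_sub (hgi (memLp_const _)) (hgi h.memLp),
          integral_sub (hgi (memLp_const _)) (hgi h.memLp)]
      rw [e4, ← e3]
      linarith
    rw [e2]
    refine (enorm_setIntegral_dual_le
      (ae_restrict_of_ae_restrict_of_subset hsub h.bound) _).trans (lintegral_mono fun τ => ?_)
    gcongr
    exact enorm_add_le _ _

theorem sq_norm_sub_le (h : IsWeakEvolution T B ι u0 x g m p q) 
    (hB : ∀ a b, B a b = B b a) {c₀ : ℝ} (hc : ∀ a, c₀ * ‖a‖ ^ 2 ≤ B a a)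
    {s t c : ℝ} (hs : s ∈ Ioo 0 T)
    (ht : t ∈ Ioo 0 T) (hst : s ≤ t)
    (hes : ∀ v, B (ι (x s)) (ι v) = B u0 (ι v) + ∫ τ in (0 : ℝ)..s, g τ v)
    (het : ∀ v, B (ι (x t)) (ι v) = B u0 (ι v) + ∫ τ in (0 : ℝ)..t, g τ v)
    (hcs : B (ι (x s)) (ι (x s)) = c + 2 * ∫ τ in (0 : ℝ)..s, g τ (x τ))
    (hct : B (ι (x t)) (ι (x t)) = c + 2 * ∫ τ in (0 : ℝ)..t, g τ (x τ)) (r : ℝ)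
    (hr : r = s ∨ r = t) :
    ENNReal.ofReal (c₀ * ‖ι (x t) - ι (x s)‖ ^ 2) ≤
      2 * ((∫⁻ τ in Ioc s t, ‖m τ‖ₑ * ‖x τ‖ₑ) + (∫⁻ τ in Ioc s t, ‖m τ‖ₑ) * ‖x r‖ₑ) := by
  have hsub : Ioc s t ⊆ Ioo 0 T := fun τ hτ => ⟨hs.1.trans hτ.1, hτ.2.trans_lt ht.2⟩
  have hgi : ∀ {y : ℝ → V}, MemLp y p (volume.restrict (Ioo 0 T)) →
    IntegrableOn (fun s => g s (y s)) (Ioc s t) := fun hy => (h.integrableOn_apply hy).mono_set hsub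
  have e3 := h.integral_sub_integral h.memLp hs ht hst
  have e1 := h.increment hs ht hst hes het
  have hbound := ae_restrict_of_ae_restrict_of_subset hsub h.bound
  -- Expanding the square, the diagonal terms come from the energy identity and the mixed term from
  -- the equation tested with `x_r`. The sign is `+` for `r = s` and `-` for `r = t`.
  have e2 : ∃ ζ : ℝ, |ζ| = 2 ∧ B (ι (x t) - ι (x s)) (ι (x t) - ι (x s)) =
      ζ * ((∫ τ in Ioc s t, g τ (x τ)) - ∫ τ in Ioc s t, g τ (x r)) := by
    have e0 : B (ι (x t) - ι (x s)) (ι (x t) - ι (x s)) = B (ι (x t)) (ι (x t)) +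
        B (ι (x s)) (ι (x s)) - 2 * B (ι (x t)) (ι (x s)) := by
      simp only [map_sub, _root_.sub_apply, hB (ι (x s)) (ι (x t))]
      ring
    rcases hr with rfl | rfl
    · refine ⟨2, by norm_num, ?_⟩
      rw [e0, ← e1, ← e3]
      linarith
    · refine ⟨-2, by norm_num, ?_⟩
      rw [e0, ← e1, ← e3, hB (ι (x s)) (ι (x r))]
      linarith
  obtain ⟨ζ, hζ, e2⟩ := e2
  have e4 : ‖B (ι (x t) - ι (x s)) (ι (x t) - ι (x s))‖ₑ ≤
      2 * ((∫⁻ τ in Ioc s t, ‖m τ‖ₑ * ‖x τ‖ₑ) + ∫⁻ τ in Ioc s t, ‖m τ‖ₑ * ‖x r‖ₑ) := by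
    have : ‖ζ‖ₑ = 2 := by
      rw [Real.enorm_eq_ofReal_abs, hζ]; simp
    rw [e2, enorm_mul, this]
    gcongr
    exact (enorm_sub_le).trans (add_le_add (enorm_setIntegral_dual_le hbound _)
      (enorm_setIntegral_dual_le hbound _))
  rw [lintegral_mul_const'' _
    (h.memLp_bound.1.mono_measure (Measure.restrict_mono_set _ hsub)).enorm] at e4
  refine le_trans ?_ e4
  rw [Real.enorm_eq_ofReal_abs]
  exact ENNReal.ofReal_le_ofReal ((hc _).trans (le_abs_self _))

end IsWeakEvolution

end Energy

/-! ### Continuity in time of weak evolutions -/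

/-- Hölder's inequality against `1` for each factor produces `|J|^{1/p}` and `|J|^{1/q}`; their
product cancels the denominator of the average, so the bound has no factor depending on the length
of `J`. -/
theorem lintegral_mul_setLAverage_le {V : Type*} [NormedAddCommGroup V]
    {p q : ℝ≥0∞} [ENNReal.HolderConjugate p q] {J : Set ℝ}
    (hJ0 : volume J ≠ 0) (hJ : volume J ≠ ⊤) {m : ℝ → ℝ} {x : ℝ → V}
    (hm : AEStronglyMeasurable m (volume.restrict J))
    (hx : AEStronglyMeasurable x (volume.restrict J)) :
    (∫⁻ τ in J, ‖m τ‖ₑ) * ⨍⁻ τ in J, ‖x τ‖ₑ ∂volume ≤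
      eLpNorm x p (volume.restrict J) * eLpNorm m q (volume.restrict J) := by
  have hp0 : p ≠ 0 := (zero_lt_one.trans_le (ENNReal.HolderConjugate.one_le p q)).ne'
  have hq0 : q ≠ 0 := (zero_lt_one.trans_le (ENNReal.HolderConjugate.one_le q p)).ne'
  have hv : volume.restrict J ≠ 0 := by simpa [Measure.restrict_eq_zero] using hJ0
  have h1 := lintegral_enorm_mul_le (p := q) (q := p) (μ := volume.restrict J) hm
    (aestronglyMeasurable_const (b := (1 : ℝ)))
  have h2 := lintegral_enorm_mul_le (p := p) (q := q) (μ := volume.restrict J) hx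
    (aestronglyMeasurable_const (b := (1 : ℝ)))
  rw [eLpNorm_const _ hp0 hv] at h1
  rw [eLpNorm_const _ hq0 hv] at h2
  simp only [enorm_one, mul_one, one_mul, Measure.restrict_apply_univ] at h1 h2
  rw [setLAverage_eq]
  have h3 : volume J ^ (1 / p.toReal) * volume J ^ (1 / q.toReal) = volume J := by
    rw [← ENNReal.rpow_add _ _ hJ0 hJ]
    have : 1 / p.toReal + 1 / q.toReal = 1 := by
      have h := ENNReal.HolderConjugate.inv_add_inv_eq_one p q
      rw [one_div, one_div, ← ENNReal.toReal_inv, ← ENNReal.toReal_inv, ← ENNReal.toReal_add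
        (ENNReal.inv_ne_top.2 hp0) (ENNReal.inv_ne_top.2 hq0), h, ENNReal.toReal_one]
    rw [this, ENNReal.rpow_one]
  calc _ ≤ (eLpNorm m q (volume.restrict J) * volume J ^ (1 / p.toReal)) *
        ((eLpNorm x p (volume.restrict J) * volume J ^ (1 / q.toReal)) / volume J) := by gcongr
    _ = eLpNorm x p (volume.restrict J) * eLpNorm m q (volume.restrict J) *
        ((volume J ^ (1 / p.toReal) * volume J ^ (1 / q.toReal)) / volume J) := by
        simp only [div_eq_mul_inv]; ring
    _ = _ := by rw [h3, ENNReal.div_self hJ0 hJ, mul_one]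

section Energy

variable {V H : Type*} [NormedAddCommGroup V] [NormedSpace ℝ V]
  [NormedAddCommGroup H] [NormedSpace ℝ H]
  {p q : ℝ≥0∞} [ENNReal.HolderConjugate p q]
  {T : ℝ} {B : H →L[ℝ] H →L[ℝ] ℝ} {ι : V →L[ℝ] H} {u0 : H} {x : ℝ → V}
  {g : ℝ → V →L[ℝ] ℝ} {m : ℝ → ℝ}

namespace IsWeakEvolution

/-- The times at which the integrated equation and the energy identity hold. -/
def goodTimes (T : ℝ) (B : H →L[ℝ] H →L[ℝ] ℝ) (ι : V →L[ℝ] H) (u0 : H) (x : ℝ → V)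
    (g : ℝ → V →L[ℝ] ℝ) (c : ℝ) : Set ℝ :=
  {t | t ∈ Ioo 0 T ∧ (∀ v, B (ι (x t)) (ι v) = B u0 (ι v) + ∫ τ in (0 : ℝ)..t, g τ v) ∧
    B (ι (x t)) (ι (x t)) = c + 2 * ∫ τ in (0 : ℝ)..t, g τ (x τ)}

/-- In `sq_norm_sub_le` the norm in `V` at an endpoint is uncontrolled as the interval shrinks.
Hence the increment is split at an intermediate good time `r` where `‖x r‖` is at most its mean over
`(s, t]`; `r` is an endpoint of both halves. Each half costs `4A`, and `‖a + b‖² ≤ 2‖a‖² + 2‖b‖²`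
gives `16A`. -/
theorem ofReal_sq_norm_sub_le (h : IsWeakEvolution T B ι u0 x g m p q)
    (hB : ∀ a b, B a b = B b a) {c₀ : ℝ} (hc₀ : 0 ≤ c₀) (hc : ∀ a, c₀ * ‖a‖ ^ 2 ≤ B a a) {c : ℝ}
    (hS : ∀ᵐ t ∂(volume.restrict (Ioo 0 T)), t ∈ goodTimes T B ι u0 x g c) {s t : ℝ}
    (hs : s ∈ goodTimes T B ι u0 x g c) (ht : t ∈ goodTimes T B ι u0 x g c) (hst : s < t) :
    ENNReal.ofReal (c₀ * ‖ι (x t) - ι (x s)‖ ^ 2) ≤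
      16 * (eLpNorm x p (volume.restrict (Ioo 0 T)) * eLpNorm m q (volume.restrict (Ioc s t))) := by
  have hsub : Ioc s t ⊆ Ioo 0 T := fun τ hτ => ⟨hs.1.1.trans hτ.1, hτ.2.trans_lt ht.1.2⟩
  have hJ0 : volume (Ioc s t) ≠ 0 := by simp [hst]
  have hJ : volume (Ioc s t) ≠ ⊤ := by simp
  have hmJ := h.memLp_bound.1.mono_measure (Measure.restrict_mono_set volume hsub)
  have hxJ := h.memLp.1.mono_measure (Measure.restrict_mono_set volume hsub)
  obtain ⟨r, hrS, hr⟩ : ∃ r, (r ∈ goodTimes T B ι u0 x g c ∧ r ∈ Ioc s t) ∧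
      ‖x r‖ₑ ≤ ⨍⁻ τ in Ioc s t, ‖x τ‖ₑ ∂volume := by
    have hN : ∀ᵐ τ ∂(volume.restrict (Ioc s t)),
        τ ∈ goodTimes T B ι u0 x g c ∧ τ ∈ Ioc s t :=
      (ae_restrict_of_ae_restrict_of_subset hsub hS).and (ae_restrict_mem measurableSet_Ioc)
    obtain ⟨r, h1, h2⟩ := exists_notMem_null_le_laverage
      (by simpa [Measure.restrict_eq_zero] using hJ0) hxJ.enorm (ae_iff.1 hN)
    exact ⟨r, by simpa using h1, h2⟩
  set A := eLpNorm x p (volume.restrict (Ioo 0 T)) * eLpNorm m q (volume.restrict (Ioc s t))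
  have hA1 : ∫⁻ τ in Ioc s t, ‖m τ‖ₑ * ‖x τ‖ₑ ≤ A := by
    simp_rw [mul_comm ‖m _‖ₑ]
    refine (lintegral_enorm_mul_le (p := p) (q := q) hxJ hmJ).trans ?_
    exact mul_le_mul_left (eLpNorm_mono_measure _ (Measure.restrict_mono_set volume hsub)) _
  have hA2 : (∫⁻ τ in Ioc s t, ‖m τ‖ₑ) * ‖x r‖ₑ ≤ A := by
    refine (mul_le_mul_right hr _).trans
      ((lintegral_mul_setLAverage_le (p := p) (q := q) hJ0 hJ hmJ hxJ).trans ?_)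
    exact mul_le_mul_left (eLpNorm_mono_measure _ (Measure.restrict_mono_set volume hsub)) _
  have k1 : ENNReal.ofReal (c₀ * ‖ι (x r) - ι (x s)‖ ^ 2) ≤ 2 * (A + A) := by
    refine (h.sq_norm_sub_le hB hc hs.1 hrS.1.1 hrS.2.1.le hs.2.1 hrS.1.2.1 hs.2.2 hrS.1.2.2 r
      (Or.inr rfl)).trans ?_
    have hss : Ioc s r ⊆ Ioc s t := Ioc_subset_Ioc_right hrS.2.2
    gcongr
    · exact (lintegral_mono_set hss).trans hA1
    · exact (mul_le_mul_left (lintegral_mono_set hss) _).trans hA2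
  have k2 : ENNReal.ofReal (c₀ * ‖ι (x t) - ι (x r)‖ ^ 2) ≤ 2 * (A + A) := by
    refine (h.sq_norm_sub_le hB hc hrS.1.1 ht.1 hrS.2.2 hrS.1.2.1 ht.2.1 hrS.1.2.2 ht.2.2 r
      (Or.inl rfl)).trans ?_
    have hss : Ioc r t ⊆ Ioc s t := Ioc_subset_Ioc_left hrS.2.1.le
    gcongr
    · exact (lintegral_mono_set hss).trans hA1
    · exact (mul_le_mul_left (lintegral_mono_set hss) _).trans hA2
  have k3 : c₀ * ‖ι (x t) - ι (x s)‖ ^ 2 ≤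
      2 * (c₀ * ‖ι (x t) - ι (x r)‖ ^ 2) + 2 * (c₀ * ‖ι (x r) - ι (x s)‖ ^ 2) := by
    have e1 := norm_sub_le_norm_sub_add_norm_sub (ι (x t)) (ι (x r)) (ι (x s))
    have e2 : ‖ι (x t) - ι (x s)‖ ^ 2 ≤
        2 * ‖ι (x t) - ι (x r)‖ ^ 2 + 2 * ‖ι (x r) - ι (x s)‖ ^ 2 := by
      nlinarith [norm_nonneg (ι (x t) - ι (x s)), norm_nonneg (ι (x t) - ι (x r)),
        norm_nonneg (ι (x r) - ι (x s)), sq_nonneg (‖ι (x t) - ι (x r)‖ - ‖ι (x r) - ι (x s)‖)]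
    nlinarith
  calc _ ≤ _ := ENNReal.ofReal_le_ofReal k3
    _ = 2 * ENNReal.ofReal (c₀ * ‖ι (x t) - ι (x r)‖ ^ 2) +
        2 * ENNReal.ofReal (c₀ * ‖ι (x r) - ι (x s)‖ ^ 2) := by
        rw [ENNReal.ofReal_add (by positivity) (by positivity), ENNReal.ofReal_mul zero_le_two,
          ENNReal.ofReal_mul zero_le_two, ENNReal.ofReal_ofNat]
    _ ≤ 2 * (2 * (A + A)) + 2 * (2 * (A + A)) := by gcongr
    _ = 16 * A := by ring

theorem uniformContinuousOn_goodTimes (h : IsWeakEvolution T B ι u0 x g m p q)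
    (hq : q ≠ ⊤) (hB : ∀ a b, B a b = B b a) {c₀ : ℝ} (hc₀ : 0 < c₀)
    (hc : ∀ a, c₀ * ‖a‖ ^ 2 ≤ B a a) {c : ℝ}
    (hS : ∀ᵐ t ∂(volume.restrict (Ioo 0 T)), t ∈ goodTimes T B ι u0 x g c) :
    UniformContinuousOn (fun t => ι (x t)) (goodTimes T B ι u0 x g c) := by
  rw [Metric.uniformContinuousOn_iff]
  intro ε hε
  set A := eLpNorm x p (volume.restrict (Ioo 0 T)) with hA
  have hAt : A ≠ ⊤ := h.memLp.2.ne
  obtain ⟨η, hη, hηA⟩ : ∃ η : ℝ, 0 < η ∧ 16 * (A.toReal * η) < c₀ * ε ^ 2 := by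
    refine ⟨c₀ * ε ^ 2 / (16 * (A.toReal + 1)), by positivity, ?_⟩
    have hA0 : 0 ≤ A.toReal := ENNReal.toReal_nonneg
    have : 16 * (A.toReal * (c₀ * ε ^ 2 / (16 * (A.toReal + 1)))) =
      c₀ * ε ^ 2 * (A.toReal / (A.toReal + 1)) := by field_simp
    rw [this]
    refine mul_lt_of_lt_one_right (by positivity) ?_
    rw [div_lt_one (by positivity)]; linarith
  -- Absolute continuity of the `L^q` norm of `m`, where `q < ∞` is essential: it is small on all
  -- short intervals uniformly.
  obtain ⟨δ, hδ, hδm⟩ := h.memLp_bound.eLpNorm_indicator_le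
    (ENNReal.HolderConjugate.one_le q p) hq hη
  refine ⟨δ, hδ, ?_⟩
  have key : ∀ s ∈ goodTimes T B ι u0 x g c, ∀ t ∈ goodTimes T B ι u0 x g c, s < t →
      t - s < δ → dist (ι (x t)) (ι (x s)) < ε := by
    intro s hs t ht hst hd
    have hsub : Ioc s t ⊆ Ioo 0 T := fun τ hτ => ⟨hs.1.1.trans hτ.1, hτ.2.trans_lt ht.1.2⟩
    have h1 := h.ofReal_sq_norm_sub_le hB hc₀.le hc hS hs ht hst
    have h2 : eLpNorm m q (volume.restrict (Ioc s t)) ≤ ENNReal.ofReal η := by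
      have := hδm (Ioc s t) measurableSet_Ioc (by
        refine (Measure.restrict_apply_le _ _).trans ?_
        rw [Real.volume_Ioc]
        exact ENNReal.ofReal_le_ofReal hd.le)
      rwa [eLpNorm_indicator_eq_eLpNorm_restrict measurableSet_Ioc,
        Measure.restrict_restrict measurableSet_Ioc, inter_eq_left.2 hsub] at this
    have h3 : ENNReal.ofReal (c₀ * ‖ι (x t) - ι (x s)‖ ^ 2) < ENNReal.ofReal (c₀ * ε ^ 2) := by
      refine lt_of_le_of_lt (h1.trans (mul_le_mul_right (mul_le_mul_right h2 _) _)) ?_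
      rw [← hA, ← ENNReal.ofReal_toReal hAt, ← ENNReal.ofReal_mul (by positivity),
        show (16 : ℝ≥0∞) = ENNReal.ofReal 16 by simp, ← ENNReal.ofReal_mul (by norm_num)]
      exact (ENNReal.ofReal_lt_ofReal_iff (by positivity)).2 hηA
    rw [ENNReal.ofReal_lt_ofReal_iff (by positivity), mul_lt_mul_iff_right₀ hc₀] at h3
    rw [dist_eq_norm]
    exact lt_of_pow_lt_pow_left₀ 2 hε.le h3
  intro s hs t ht hd
  rw [Real.dist_eq] at hd
  rcases lt_trichotomy s t with hst | rfl | hst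
  · rw [dist_comm]
    exact key s hs t ht hst (by rw [abs_sub_comm, abs_of_pos (by linarith)] at hd; exact hd)
  · simpa using hε
  · exact key t ht s hs hst (by rwa [abs_of_pos (by linarith)] at hd)

theorem subset_closure_of_ae {T : ℝ} (hT : 0 < T) {S : Set ℝ}
    (hS : ∀ᵐ t ∂(volume.restrict (Ioo 0 T)), t ∈ S) :
    Icc 0 T ⊆ closure (S ∩ Ioo 0 T) := by
  rw [← closure_Ioo hT.ne]
  refine closure_minimal ?_ isClosed_closure
  intro t ht
  rw [_root_.mem_closure_iff]
  intro U hU htU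
  have ho : IsOpen (U ∩ Ioo 0 T) := hU.inter isOpen_Ioo
  have hpos : 0 < volume (U ∩ Ioo 0 T) := ho.measure_pos _ ⟨t, htU, ht⟩
  have hne : (ae (volume.restrict (U ∩ Ioo 0 T))).NeBot := by
    rw [ae_neBot, Ne, Measure.restrict_eq_zero]; exact hpos.ne'
  obtain ⟨r, h1, h2⟩ := ((ae_restrict_of_ae_restrict_of_subset inter_subset_right hS).and
    (ae_restrict_mem ho.measurableSet)).exists
  exact ⟨r, h2.1, h1, h2.2⟩

/-- A weak evolution has a continuous representative, which satisfies the energy identity. -/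
theorem exists_continuousOn [CompleteSpace H] (h : IsWeakEvolution T B ι u0 x g m p q)
    (hp : p ≠ ⊤) (hq : q ≠ ⊤) (hB : ∀ a b, B a b = B b a) {c₀ : ℝ} (hc₀ : 0 < c₀)
    (hc : ∀ a, c₀ * ‖a‖ ^ 2 ≤ B a a) (hι : DenseRange ι) :
    ∃ w : ℝ → H, ContinuousOn w (Icc 0 T) ∧
      (∀ᵐ t ∂(volume.restrict (Ioo 0 T)), ι (x t) = w t) ∧
      ∀ t ∈ Icc 0 T, B (w t) (w t) = B u0 u0 + 2 * ∫ τ in (0 : ℝ)..t, g τ (x τ) := by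
  obtain ⟨c, hc'⟩ := h.exists_energy_eq hp hB
  have hS : ∀ᵐ t ∂(volume.restrict (Ioo 0 T)), t ∈ goodTimes T B ι u0 x g c := by
    filter_upwards [hc', h.equation, ae_restrict_mem measurableSet_Ioo] with t h1 h2 h3
    exact ⟨h3, h2, h1⟩
  have huc := h.uniformContinuousOn_goodTimes hq hB hc₀ hc hS
  set S := goodTimes T B ι u0 x g c with hSdef
  have hcl : Icc 0 T ⊆ closure S :=
    (subset_closure_of_ae h.pos hS).trans (closure_mono inter_subset_left)
  have hlim : ∀ t ∈ Icc 0 T, ∃ y, Tendsto (fun t => ι (x t)) (𝓝[S] t) (𝓝 y) := by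
    intro t ht
    have : (𝓝[S] t).NeBot := mem_closure_iff_nhdsWithin_neBot.1 (hcl ht)
    have hcau : Cauchy (map (fun t => ι (x t)) (𝓝[S] t)) := by
      rw [Metric.cauchy_iff]
      refine ⟨inferInstance, fun ε hε => ?_⟩
      obtain ⟨δ, hδ, hd⟩ := Metric.uniformContinuousOn_iff.1 huc ε hε
      refine ⟨(fun t => ι (x t)) '' (Metric.ball t (δ / 2) ∩ S), image_mem_map ?_, ?_⟩
      · exact inter_comm (Metric.ball t (δ / 2)) S ▸ inter_mem_nhdsWithin S (Metric.ball_mem_nhds t (half_pos hδ))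
      · rintro _ ⟨a, ha, rfl⟩ _ ⟨b, hb, rfl⟩
        refine hd a ha.2 b hb.2 ?_
        have := dist_triangle_right a b t
        have h1 := Metric.mem_ball.1 ha.1
        have h2 := Metric.mem_ball.1 hb.1
        linarith
    obtain ⟨y, hy⟩ := CompleteSpace.complete hcau
    exact ⟨y, hy⟩
  let w := extendFrom S fun t => ι (x t)
  have hw : ContinuousOn w (Icc 0 T) := continuousOn_extendFrom hcl hlim
  have hwS : ∀ t ∈ S, w t = ι (x t) := extendFrom_extends huc.continuousOn
  have hprim : ∀ {y : ℝ → V}, MemLp y p (volume.restrict (Ioo 0 T)) →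
      ContinuousOn (fun t => ∫ τ in (0 : ℝ)..t, g τ (y τ)) (Icc 0 T) := by
    intro y hy
    have := intervalIntegral.continuousOn_primitive_interval'
      (h.intervalIntegrable_apply hy) left_mem_uIcc
    rwa [uIcc_of_le h.pos.le] at this
  -- Both the energy identity and the tested equation pass from the dense set `S` to all of `[0,
  -- T]`, their two sides being continuous.
  have hext : ∀ {φ ψ : ℝ → ℝ}, ContinuousOn φ (Icc 0 T) → ContinuousOn ψ (Icc 0 T) →
      (∀ t ∈ S, φ t = ψ t) → ∀ t ∈ Icc 0 T, φ t = ψ t := by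
    intro φ ψ hφ hψ heq
    have : EqOn φ ψ S := heq
    exact this.of_subset_closure hφ hψ (fun t ht => Ioo_subset_Icc_self ht.1) hcl
  have h1 : ∀ t ∈ Icc 0 T, B (w t) (w t) = c + 2 * ∫ τ in (0 : ℝ)..t, g τ (x τ) := by
    refine hext ?_ ?_ fun t ht => ?_
    · exact (B.continuous.comp_continuousOn hw).clm_apply hw
    · exact continuousOn_const.add (continuousOn_const.mul (hprim h.memLp))
    · rw [hwS t ht]; exact ht.2.2
  have h2 : ∀ v, ∀ t ∈ Icc 0 T, B (w t) (ι v) = B u0 (ι v) + ∫ τ in (0 : ℝ)..t, g τ v := by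
    intro v
    refine hext ?_ ?_ fun t ht => ?_
    · exact (B.continuous.comp_continuousOn hw).clm_apply continuousOn_const
    · exact continuousOn_const.add (hprim (memLp_const v))
    · rw [hwS t ht]; exact ht.2.1 v
  have h0 : (0 : ℝ) ∈ Icc 0 T := ⟨le_rfl, h.pos.le⟩
  -- At time `0` the equation reads `B (w 0 - u0) (ι v) = 0`. Density of the range of `ι` and
  -- coercivity of `B` force `w 0 = u0`, which identifies the energy constant.
  have h3 : w 0 = u0 := by
    have e1 : ∀ v, B (w 0 - u0) (ι v) = 0 := fun v => by
      have := h2 v 0 h0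
      simp only [intervalIntegral.integral_same, add_zero] at this
      simp [this]
    have e2 : ∀ a, B (w 0 - u0) a = 0 := fun a =>
      congrFun (hι.equalizer (B (w 0 - u0)).continuous continuous_const (funext e1)) a
    have e3 := hc (w 0 - u0)
    rw [e2] at e3
    have e4 : ‖w 0 - u0‖ ^ 2 ≤ 0 := by
      by_contra hcon
      push Not at hcon
      nlinarith [mul_pos hc₀ hcon]
    have e5 : ‖w 0 - u0‖ = 0 := by nlinarith [norm_nonneg (w 0 - u0)]
    exact sub_eq_zero.1 (norm_eq_zero.1 e5)
  have h4 : c = B u0 u0 := by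
    have := h1 0 h0
    rw [h3] at this
    simpa using this.symm
  refine ⟨w, hw, ?_, ?_⟩
  · filter_upwards [hS] with t ht
    exact (hwS t ht).symm
  · rw [← h4]; exact h1

end IsWeakEvolution

end Energy

/-! ### Gagliardo-Nirenberg inequalities for test fields -/

section Spaces

variable {N : ℕ} {Q : Set (Vec N)}

/-- The operator norm is at most the Frobenius norm, by Cauchy-Schwarz in each component. It
converts Sobolev inequalities for `fderiv` into ones for `gradField`. -/
theorem norm_fderiv_le_norm_gradField (φ : Vec N → Vec N) (x : Vec N) :
    ‖fderiv ℝ φ x‖ ≤ ‖gradField φ x‖ := by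
  refine ContinuousLinearMap.opNorm_le_bound _ (norm_nonneg _) fun h => ?_
  have h1 : fderiv ℝ φ x h = ∑ i, h i • fderiv ℝ φ x (EuclideanSpace.single i 1) := by
    conv_lhs => rw [← (EuclideanSpace.basisFun (Fin N) ℝ).sum_repr h]
    simp
  rw [← abs_of_nonneg (norm_nonneg (fderiv ℝ φ x h)),
    ← abs_of_nonneg (mul_nonneg (norm_nonneg (gradField φ x)) (norm_nonneg h)), ← sq_le_sq, mul_pow,
    EuclideanSpace.real_norm_sq_eq, EuclideanSpace.real_norm_sq_eq, EuclideanSpace.real_norm_sq_eq,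
    Fintype.sum_prod_type_right, Finset.sum_mul]
  refine Finset.sum_le_sum fun j _ => ?_
  rw [h1]
  simp only [WithLp.ofLp_sum, WithLp.ofLp_smul, Finset.sum_apply, Pi.smul_apply, smul_eq_mul,
    gradField]
  rw [mul_comm]
  exact Finset.sum_mul_sq_le_sq_mul_sq _ _ _

theorem gradField_eq_zero_of_fderiv {φ : Vec N → Vec N} {x : Vec N} (h : fderiv ℝ φ x = 0) :
    gradField φ x = 0 := by
  ext ij
  simp [gradField, h]

theorem IsTestField.contDiff_one {φ : Vec N → Vec N} (h : IsTestField Q φ) : ContDiff ℝ 1 φ :=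
  h.smooth.of_le (by simp)

theorem IsTestField.fderiv_eq_zero {φ : Vec N → Vec N} (h : IsTestField Q φ) {x : Vec N}
    (hx : x ∉ Q) : fderiv ℝ φ x = 0 :=
  image_eq_zero_of_notMem_tsupport fun hx' => hx (h.support (tsupport_fderiv_subset ℝ hx'))

theorem IsTestField.continuous_gradField {φ : Vec N → Vec N} (h : IsTestField Q φ) :
    Continuous (gradField φ) := by
  have h1 : Continuous (fderiv ℝ φ) := h.contDiff_one.continuous_fderiv (by simp)
  refine (PiLp.continuous_toLp 2 _).comp (continuous_pi fun ij => ?_)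
  exact (EuclideanSpace.proj (𝕜 := ℝ) ij.2).continuous.comp (h1.clm_apply continuous_const)

/-- A Gagliardo-Nirenberg inequality for test fields. -/
def GagliardoNirenberg (Q : Set (Vec N)) (p₀ r α : ℝ) (C : ℝ≥0∞) : Prop :=
  ∀ φ : Vec N → Vec N, IsTestField Q φ → ∫⁻ x in Q, ‖φ x‖ₑ ^ r ≤
    C * (∫⁻ x in Q, ‖φ x‖ₑ ^ (2 : ℝ)) ^ α * ∫⁻ x in Q, ‖gradField φ x‖ₑ ^ p₀

theorem enorm_fderiv_le {φ : Vec N → Vec N} (x : Vec N) : ‖fderiv ℝ φ x‖ₑ ≤ ‖gradField φ x‖ₑ :=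
  enorm_le_iff_norm_le.2 (norm_fderiv_le_norm_gradField φ x)

/-- Ladyzhenskaya's argument: the planar embedding of `W^{1,1}` into `L²` is applied to `|φ|²`,
whose derivative is at most `2 |φ| |∇φ|`, and Cauchy-Schwarz separates the two factors. The constant
`4` is the square of this `2`. -/
theorem gagliardoNirenberg_two {Q : Set (Vec 2)} :
    ∃ C : ℝ≥0∞, C ≠ ⊤ ∧ GagliardoNirenberg Q 2 4 1 C := by
  have hfin : Module.finrank ℝ (Vec 2) = 2 := by simp
  refine ⟨lintegralPowLePowLIntegralFDerivConst (volume : Measure (Vec 2)) 2 * 4, by finiteness,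
    fun φ hφ => ?_⟩
  have hu : ContDiff ℝ 1 fun x => ‖φ x‖ ^ 2 := hφ.contDiff_one.norm_sq ℝ
  have hus : HasCompactSupport fun x => ‖φ x‖ ^ 2 :=
    hφ.compact.comp_left (g := fun y => ‖y‖ ^ 2) (by simp)
  have h1 := lintegral_pow_le_pow_lintegral_fderiv (volume : Measure (Vec 2)) hu hus (p := 2)
    (by rw [hfin]; exact ⟨by norm_num, by norm_num, by norm_num⟩)
  have hd : ∀ x, ‖fderiv ℝ (fun x => ‖φ x‖ ^ 2) x‖ₑ ≤ 2 * (‖φ x‖ₑ * ‖fderiv ℝ φ x‖ₑ) := by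
    intro x
    have hdiff : HasFDerivAt φ (fderiv ℝ φ x) x :=
      ((hφ.contDiff_one.differentiable (by simp)) x).hasFDerivAt
    have h : ‖fderiv ℝ (fun x => ‖φ x‖ ^ 2) x‖ ≤ ‖(2 : ℝ) * (‖φ x‖ * ‖fderiv ℝ φ x‖)‖ := by
      rw [hdiff.norm_sq.fderiv, ← Nat.cast_smul_eq_nsmul ℝ, norm_smul, norm_mul, norm_mul, norm_norm,
        norm_norm]
      gcongr
      · simp
      · refine (ContinuousLinearMap.opNorm_comp_le _ _).trans ?_
        rw [innerSL_apply_norm]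
    refine (enorm_le_iff_norm_le.2 h).trans (le_of_eq ?_)
    rw [enorm_mul, enorm_mul, enorm_norm, enorm_norm]
    simp [Real.enorm_eq_ofReal_abs]
  have h2 : ∫⁻ x, ‖fderiv ℝ (fun x => ‖φ x‖ ^ 2) x‖ₑ ≤
      2 * ∫⁻ x in Q, ‖φ x‖ₑ * ‖gradField φ x‖ₑ := by
    rw [← lintegral_const_mul' _ _ (by simp)]
    calc _ ≤ ∫⁻ x, 2 * (‖φ x‖ₑ * ‖fderiv ℝ φ x‖ₑ) := lintegral_mono hd
      _ = ∫⁻ x in Q, 2 * (‖φ x‖ₑ * ‖fderiv ℝ φ x‖ₑ) := by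
        refine (setLIntegral_eq_of_support_subset fun x hx => ?_).symm
        by_contra hxQ
        refine hx ?_
        change 2 * (‖φ x‖ₑ * ‖fderiv ℝ φ x‖ₑ) = 0
        rw [← ofReal_norm (fderiv ℝ φ x), hφ.fderiv_eq_zero hxQ, norm_zero, ENNReal.ofReal_zero,
          mul_zero, mul_zero]
      _ ≤ _ := lintegral_mono fun x => by gcongr; exact enorm_fderiv_le x
  have h3 : (∫⁻ x in Q, ‖φ x‖ₑ * ‖gradField φ x‖ₑ) ^ (2 : ℝ) ≤
      (∫⁻ x in Q, ‖φ x‖ₑ ^ (2 : ℝ)) * ∫⁻ x in Q, ‖gradField φ x‖ₑ ^ (2 : ℝ) := by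
    have := ENNReal.lintegral_mul_norm_pow_le (μ := volume.restrict Q)
      (f := fun x => ‖φ x‖ₑ ^ (2 : ℝ)) (g := fun x => ‖gradField φ x‖ₑ ^ (2 : ℝ))
      (hφ.smooth.continuous.enorm.measurable.pow_const _).aemeasurable
      (hφ.continuous_gradField.enorm.measurable.pow_const _).aemeasurable
      (p := 1 / 2) (q := 1 / 2) (by norm_num) (by norm_num) (by norm_num)
    simp only [← ENNReal.rpow_mul] at this
    norm_num at this
    calc _ ≤ _ := ENNReal.rpow_le_rpow this (by norm_num : (0 : ℝ) ≤ 2)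
      _ = _ := by
        rw [ENNReal.mul_rpow_of_nonneg _ _ (by norm_num), ← ENNReal.rpow_mul, ← ENNReal.rpow_mul]
        norm_num
  have h4 : ∀ x, ‖‖φ x‖ ^ 2‖ₑ ^ (2 : ℝ) = ‖φ x‖ₑ ^ (4 : ℝ) := fun x => by
    rw [enorm_pow, enorm_norm, ← ENNReal.rpow_natCast, ← ENNReal.rpow_mul]
    norm_num
  simp only [h4] at h1
  calc _ ≤ _ := setLIntegral_le_lintegral _ _
    _ ≤ _ := h1
    _ ≤ lintegralPowLePowLIntegralFDerivConst (volume : Measure (Vec 2)) 2 *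
        (2 * ∫⁻ x in Q, ‖φ x‖ₑ * ‖gradField φ x‖ₑ) ^ (2 : ℝ) := by gcongr
    _ = lintegralPowLePowLIntegralFDerivConst (volume : Measure (Vec 2)) 2 * 4 *
        (∫⁻ x in Q, ‖φ x‖ₑ * ‖gradField φ x‖ₑ) ^ (2 : ℝ) := by
        rw [ENNReal.mul_rpow_of_nonneg _ _ (by norm_num), mul_assoc]
        norm_num
    _ ≤ _ := by
        rw [ENNReal.rpow_one, mul_assoc _ _ (∫⁻ x in Q, ‖gradField φ x‖ₑ ^ (2 : ℝ))]
        gcongr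

/-- The Sobolev exponent of `11/5` in dimension three is `33/4`, since `5/11 - 1/3 = 4/33`.
Interpolation writes `|φ|^{11/3}` as `(|φ|²)^{11/15} (|φ|^{33/4})^{4/15}`, and `33/4 · 4/15 = 11/5`
gives the gradient exactly the power `p₀`. -/
theorem gagliardoNirenberg_three {Q : Set (Vec 3)} (hQb : Bornology.IsBounded Q) :
    ∃ C : ℝ≥0∞, C ≠ ⊤ ∧ GagliardoNirenberg Q (11 / 5) (11 / 3) (11 / 15) C := by
  have hfin : Module.finrank ℝ (Vec 3) = 3 := by simp
  set K := eLpNormLESNormFDerivOfLeConst (Vec 3) (volume : Measure (Vec 3)) Q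
    (11 / 5 : NNReal) (33 / 4 : NNReal) with hK
  refine ⟨(K : ℝ≥0∞) ^ (11 / 5 : ℝ), ENNReal.rpow_ne_top_of_nonneg (by norm_num) (by simp),
    fun φ hφ => ?_⟩
  have hsupp : Function.support φ ⊆ Q := (subset_tsupport φ).trans hφ.support
  have h1 := eLpNorm_le_eLpNorm_fderiv_of_le (volume : Measure (Vec 3)) hφ.contDiff_one
    hsupp (p := (11 / 5 : NNReal)) (q := (33 / 4 : NNReal))
    (by rw [← NNReal.coe_le_coe]; norm_num)
    (by rw [hfin, ← NNReal.coe_lt_coe]; norm_num) (by rw [hfin]; norm_num) hQb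
  have hd : (Function.support (fderiv ℝ φ)) ⊆ Q := fun x hx => by
    by_contra hxQ
    exact hx (hφ.fderiv_eq_zero hxQ)
  have h2 : eLpNorm φ (33 / 4 : NNReal) (volume.restrict Q) ≤
      K * eLpNorm (gradField φ) (11 / 5 : NNReal) (volume.restrict Q) := by
    rw [eLpNorm_restrict_eq_of_support_subset hsupp]
    refine h1.trans (mul_le_mul_right ?_ _)
    rw [← eLpNorm_restrict_eq_of_support_subset hd]
    exact eLpNorm_mono_enorm fun x => enorm_fderiv_le x
  have h3 := ENNReal.lintegral_mul_norm_pow_le (μ := volume.restrict Q)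
      (f := fun x => ‖φ x‖ₑ ^ (2 : ℝ)) (g := fun x => ‖φ x‖ₑ ^ (33 / 4 : ℝ))
      (hφ.smooth.continuous.enorm.measurable.pow_const _).aemeasurable
      (hφ.smooth.continuous.enorm.measurable.pow_const _).aemeasurable
      (p := 11 / 15) (q := 4 / 15) (by norm_num) (by norm_num) (by norm_num)
  have h4 : ∀ x, (‖φ x‖ₑ ^ (2 : ℝ)) ^ (11 / 15 : ℝ) * (‖φ x‖ₑ ^ (33 / 4 : ℝ)) ^ (4 / 15 : ℝ) =
      ‖φ x‖ₑ ^ (11 / 3 : ℝ) := fun x => by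
    rw [← ENNReal.rpow_mul, ← ENNReal.rpow_mul, ← ENNReal.rpow_add_of_nonneg _ _ (by norm_num)
      (by norm_num)]
    norm_num
  simp only [h4] at h3
  have h5 := eLpNorm_nnreal_pow_eq_lintegral (μ := volume.restrict Q) (f := φ)
    (p := (33 / 4 : NNReal)) (by norm_num)
  have h6 := eLpNorm_nnreal_pow_eq_lintegral (μ := volume.restrict Q) (f := gradField φ)
    (p := (11 / 5 : NNReal)) (by norm_num)
  have e1 : ((33 / 4 : NNReal) : ℝ) = 33 / 4 := by norm_num
  have e2 : ((11 / 5 : NNReal) : ℝ) = 11 / 5 := by norm_num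
  rw [e1] at h5
  rw [e2] at h6
  refine h3.trans ?_
  rw [← h5, ← h6, ← ENNReal.rpow_mul, mul_comm _ ((∫⁻ x in Q, ‖φ x‖ₑ ^ (2 : ℝ)) ^ (11 / 15 : ℝ)),
    mul_assoc, ← ENNReal.mul_rpow_of_nonneg _ _ (by norm_num)]
  refine mul_le_mul_right ?_ _
  have e3 : (33 / 4 * (4 / 15) : ℝ) = 11 / 5 := by norm_num
  rw [e3]
  exact ENNReal.rpow_le_rpow h2 (by norm_num)

/-- The exponents and constants of the Gagliardo-Nirenberg inequality used below. -/
theorem exists_gagliardoNirenberg (hN : N = 2 ∨ N = 3) (hQb : Bornology.IsBounded Q)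
    {p : ℝ} (hp : 1 + 2 * (N : ℝ) / ((N : ℝ) + 2) ≤ p) :
    ∃ (p₀ r α : ℝ) (C : ℝ≥0∞), 2 ≤ p₀ ∧ p₀ ≤ p ∧ 2 ≤ r ∧ 1 / p₀ + 2 / r = 1 ∧ 0 ≤ α ∧
      2 * α + p₀ = r ∧ C ≠ ⊤ ∧ GagliardoNirenberg Q p₀ r α C := by
  -- In both dimensions `p₀ = 1 + 2N/(N+2)` is the smallest admissible `p`, and `r = 2p₀/(p₀ - 1)`.
  rcases hN with rfl | rfl
  · obtain ⟨C, h1, h2⟩ := gagliardoNirenberg_two (Q := Q)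
    exact ⟨2, 4, 1, C, le_rfl, by norm_num at hp ⊢; linarith, by norm_num, by norm_num,
      by norm_num, by norm_num, h1, h2⟩
  · obtain ⟨C, h1, h2⟩ := gagliardoNirenberg_three hQb
    exact ⟨11 / 5, 11 / 3, 11 / 15, C, by norm_num, by norm_num at hp ⊢; linarith, by norm_num,
      by norm_num, by norm_num, by norm_num, h1, h2⟩

end Spaces

/-! ### Inclusions of `L^p` spaces, and the embedding of `𝕍` into `ℍ` -/

section Inclusion

variable {α E : Type*} [MeasurableSpace α] [NormedAddCommGroup E] [NormedSpace ℝ E]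
  {P q : ℝ≥0∞} [Fact (1 ≤ P)] [Fact (1 ≤ q)]

/-- The inclusion of `L^P` into `L^q`, `q ≤ P`, over a finite measure. -/
noncomputable def lpIncl (E : Type*) [NormedAddCommGroup E] [NormedSpace ℝ E] (μ : Measure α)
    [IsFiniteMeasure μ] (h : q ≤ P) : Lp E P μ →L[ℝ] Lp E q μ :=
  LinearMap.mkContinuous
    { toFun := fun f => ((Lp.memLp f).mono_exponent h).toLp f
      map_add' := fun f g => by
        rw [← MemLp.toLp_add]
        exact MemLp.toLp_congr _ _ (Lp.coeFn_add f g)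
      map_smul' := fun c f => by
        rw [RingHom.id_apply, ← MemLp.toLp_const_smul]
        exact MemLp.toLp_congr _ _ (Lp.coeFn_smul c f) }
    (μ univ ^ (1 / q.toReal - 1 / P.toReal)).toReal fun f => by
      have h1 := eLpNorm_le_eLpNorm_mul_rpow_measure_univ (μ := μ) h (Lp.aestronglyMeasurable f)
      have hq : 0 < q := zero_lt_one.trans_le Fact.out
      have h2 : μ univ ^ (1 / q.toReal - 1 / P.toReal) ≠ ⊤ := by
        refine ENNReal.rpow_ne_top_of_nonneg ?_ (measure_ne_top _ _)
        rw [sub_nonneg]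
        by_cases hP : P = ⊤
        · simp [hP]
        · exact one_div_le_one_div_of_le (ENNReal.toReal_pos hq.ne' (ne_top_of_le_ne_top hP h))
            (ENNReal.toReal_mono hP h)
      change ‖((Lp.memLp f).mono_exponent h).toLp f‖ ≤ _
      rw [Lp.norm_toLp, Lp.norm_def, mul_comm, ← ENNReal.toReal_mul]
      exact ENNReal.toReal_mono (ENNReal.mul_ne_top (Lp.eLpNorm_ne_top f) h2) h1

theorem coeFn_lpIncl {μ : Measure α} [IsFiniteMeasure μ] (h : q ≤ P) (f : Lp E P μ) :
    lpIncl E μ h f =ᵐ[μ] f :=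
  MemLp.coeFn_toLp ((Lp.memLp f).mono_exponent h)

theorem enorm_lpIncl {μ : Measure α} [IsFiniteMeasure μ] (h : q ≤ P) (f : Lp E P μ) :
    ‖lpIncl E μ h f‖ₑ = eLpNorm f q μ := by
  rw [Lp.enorm_def]
  exact eLpNorm_congr_ae (coeFn_lpIncl h f)

theorem eLpNorm_ofReal_rpow {α E : Type*} [MeasurableSpace α] [NormedAddCommGroup E]
    {μ : Measure α} {s : ℝ} (hs : 0 < s) (f : α → E) :
    eLpNorm f (ENNReal.ofReal s) μ ^ s = ∫⁻ x, ‖f x‖ₑ ^ s ∂μ := by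
  have := eLpNorm_nnreal_pow_eq_lintegral (μ := μ) (f := f) (p := s.toNNReal)
    (by simpa using hs)
  rwa [Real.coe_toNNReal _ hs.le] at this

end Inclusion

section Spaces

variable {N : ℕ} {Q : Set (Vec N)} {p : ℝ}

theorem two_le_ofReal (hp : 2 ≤ p) : (2 : ℝ≥0∞) ≤ ENNReal.ofReal p := by
  rw [← ENNReal.ofReal_ofNat]
  exact ENNReal.ofReal_le_ofReal hp

variable [Fact (1 ≤ ENNReal.ofReal p)]

/-- The underlying field of an element of `𝕍`, as a continuous linear map into `L^p`. -/
noncomputable def fieldLp : SpaceV Q p →L[ℝ] Lp (Vec N) (ENNReal.ofReal p) (volume.restrict Q) :=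
  (ContinuousLinearMap.fst ℝ _ _).comp (SpaceV Q p).subtypeL

/-- The gradient of an element of `𝕍`, as a continuous linear map into `L^p`. -/
noncomputable def gradLp : SpaceV Q p →L[ℝ] Lp (Mat N) (ENNReal.ofReal p) (volume.restrict Q) :=
  (ContinuousLinearMap.snd ℝ _ _).comp (SpaceV Q p).subtypeL

/-- The elements of `𝕍` given by test fields. -/
def IsTest (v : SpaceV Q p) : Prop := v.1 ∈ testV Q p

theorem dense_isTest : Dense {v : SpaceV Q p | IsTest v} := by
  intro v
  rw [mem_closure_iff_seq_limit]
  obtain ⟨u, hu, hlim⟩ := mem_closure_iff_seq_limit.1 (show v.1 ∈ closure (testV Q p : Set _) from v.2)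
  refine ⟨fun n => ⟨u n, subset_closure (hu n)⟩, fun n => hu n, ?_⟩
  exact tendsto_subtype_rng.2 hlim

theorem IsTest.exists_field {v : SpaceV Q p} (h : IsTest v) : ∃ φ, IsTestField Q φ ∧
    SpaceV.field v =ᵐ[volume.restrict Q] φ ∧ SpaceV.grad v =ᵐ[volume.restrict Q] gradField φ := h

theorem IsTestField.memLp {φ : Vec N → Vec N} (h : IsTestField Q φ) (P : ℝ≥0∞) :
    MemLp φ P (volume.restrict Q) :=
  (h.smooth.continuous.memLp_of_hasCompactSupport h.compact).restrict Q

theorem IsTestField.memLp_gradField {φ : Vec N → Vec N} (h : IsTestField Q φ) (P : ℝ≥0∞) :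
    MemLp (gradField φ) P (volume.restrict Q) := by
  refine (h.continuous_gradField.memLp_of_hasCompactSupport ?_).restrict Q
  exact (h.compact.fderiv ℝ).mono fun x hx hx' => hx (gradField_eq_zero_of_fderiv hx')

theorem exists_isTest {φ : Vec N → Vec N} (h : IsTestField Q φ) : ∃ v : SpaceV Q p, IsTest v ∧
    SpaceV.field v =ᵐ[volume.restrict Q] φ :=
  have hm : ((h.memLp _).toLp φ, (h.memLp_gradField _).toLp (gradField φ)) ∈ testV Q p :=
    ⟨φ, h, MemLp.coeFn_toLp (h.memLp _), MemLp.coeFn_toLp (h.memLp_gradField _)⟩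
  ⟨⟨_, subset_closure hm⟩, hm, MemLp.coeFn_toLp (h.memLp _)⟩

variable [IsFiniteMeasure (volume.restrict Q)]

theorem fieldL2_mem_spaceH (hp : 2 ≤ p) (v : SpaceV Q p) :
    lpIncl (Vec N) (volume.restrict Q) (two_le_ofReal hp) (fieldLp v) ∈ SpaceH Q := by
  have hc : Continuous fun v : SpaceV Q p =>
      lpIncl (Vec N) (volume.restrict Q) (two_le_ofReal hp) (fieldLp v) := by fun_prop
  have h := image_closure_subset_closure_image hc (mem_image_of_mem _ (dense_isTest v))
  refine closure_mono ?_ h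
  rintro _ ⟨u, hu, rfl⟩
  obtain ⟨φ, h1, h2, -⟩ := IsTest.exists_field hu
  exact ⟨φ, h1, (coeFn_lpIncl _ _).trans h2⟩

/-- The embedding of `𝕍` into `ℍ`. -/
noncomputable def embH (hp : 2 ≤ p) : SpaceV Q p →L[ℝ] SpaceH Q :=
  ((lpIncl (Vec N) (volume.restrict Q) (two_le_ofReal hp)).comp fieldLp).codRestrict (SpaceH Q)
    (fieldL2_mem_spaceH hp)

theorem embH_field (hp : 2 ≤ p) (v : SpaceV Q p) :
    SpaceH.field (embH hp v) =ᵐ[volume.restrict Q] SpaceV.field v :=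
  coeFn_lpIncl (two_le_ofReal hp) (fieldLp v)

theorem sameField_iff (hp : 2 ≤ p) (v : SpaceV Q p) (h : SpaceH Q) :
    SameField v h ↔ embH hp v = h := by
  constructor
  · intro hs
    exact Subtype.ext (Lp.ext ((embH_field hp v).trans hs))
  · rintro rfl
    exact (embH_field hp v).symm

theorem enorm_embH (hp : 2 ≤ p) (v : SpaceV Q p) :
    ‖embH hp v‖ₑ = eLpNorm (SpaceV.field v) 2 (volume.restrict Q) :=
  enorm_lpIncl (two_le_ofReal hp) (fieldLp v)

theorem denseRange_embH (hp : 2 ≤ p) : DenseRange (embH hp : SpaceV Q p → SpaceH Q) := by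
  intro h
  rw [mem_closure_iff_seq_limit]
  obtain ⟨u, hu, hlim⟩ := mem_closure_iff_seq_limit.1 (show h.1 ∈ closure (testH Q : Set _) from h.2)
  refine ⟨fun n => ⟨u n, subset_closure (hu n)⟩, fun n => ?_, tendsto_subtype_rng.2 hlim⟩
  obtain ⟨φ, h1, h2⟩ := hu n
  obtain ⟨v, -, hv⟩ := exists_isTest (p := p) h1
  exact ⟨v, (sameField_iff hp v _).1 (hv.trans h2.symm)⟩

variable {p₀ r α : ℝ} {C : ℝ≥0∞} [Fact (1 ≤ ENNReal.ofReal p₀)]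

/-- The gradient of an element of `𝕍`, as a continuous linear map into `L^{p₀}`, `p₀ ≤ p`. -/
noncomputable def gradLpOfLe (hp₀ : p₀ ≤ p) :
    SpaceV Q p →L[ℝ] Lp (Mat N) (ENNReal.ofReal p₀) (volume.restrict Q) :=
  (lpIncl (Mat N) (volume.restrict Q) (ENNReal.ofReal_le_ofReal hp₀)).comp gradLp

theorem coeFn_gradLpOfLe (hp₀ : p₀ ≤ p) (v : SpaceV Q p) :
    gradLpOfLe hp₀ v =ᵐ[volume.restrict Q] SpaceV.grad v :=
  coeFn_lpIncl (ENNReal.ofReal_le_ofReal hp₀) (gradLp v)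

/-- The right-hand side of the Gagliardo-Nirenberg inequality in `𝕍`. -/
noncomputable def gnBound (hp : 2 ≤ p) (hp₀ : p₀ ≤ p) (α : ℝ) (C : ℝ≥0∞) (v : SpaceV Q p) : ℝ≥0∞ :=
  C * ENNReal.ofReal ((‖embH hp v‖ ^ (2 : ℝ)) ^ α * ‖gradLpOfLe hp₀ v‖ ^ p₀)

theorem mul_ofReal_rpow_mul_rpow {a b : ℝ} (ha : 0 ≤ a) (hb : 0 ≤ b) (hp₀ : 0 ≤ p₀) (hα : 0 ≤ α) :
    C * ENNReal.ofReal ((a ^ (2 : ℝ)) ^ α * b ^ p₀) =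
      C * (ENNReal.ofReal a ^ (2 : ℝ)) ^ α * ENNReal.ofReal b ^ p₀ := by
  rw [mul_assoc, ENNReal.ofReal_mul (by positivity), ← ENNReal.ofReal_rpow_of_nonneg
    (by positivity) hα, ← ENNReal.ofReal_rpow_of_nonneg ha (by norm_num),
    ← ENNReal.ofReal_rpow_of_nonneg hb hp₀]

theorem continuous_gnBound (hp : 2 ≤ p) (hp₀ : p₀ ≤ p) (hp₀0 : 0 < p₀) (hα : 0 ≤ α) (hC : C ≠ ⊤) :
    Continuous (gnBound hp hp₀ α C : SpaceV Q p → ℝ≥0∞) := by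
  refine (ENNReal.continuous_const_mul hC).comp (ENNReal.continuous_ofReal.comp ?_)
  have h1 : Continuous fun v : SpaceV Q p => ‖embH hp v‖ := (embH hp).continuous.norm
  have h2 : Continuous fun v : SpaceV Q p => ‖gradLpOfLe hp₀ v‖ := (gradLpOfLe hp₀).continuous.norm
  exact ((h1.rpow_const fun _ => Or.inr zero_le_two).rpow_const fun _ => Or.inr hα).mul
    (h2.rpow_const fun _ => Or.inr hp₀0.le)

theorem GagliardoNirenberg.lintegral_le_of_isTest (hGN : GagliardoNirenberg Q p₀ r α C)
    (hp : 2 ≤ p) (hp₀ : p₀ ≤ p) (hp₀0 : 0 < p₀) (hα : 0 ≤ α) {v : SpaceV Q p} (hv : IsTest v) :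
    ∫⁻ x in Q, ‖SpaceV.field v x‖ₑ ^ r ≤ gnBound hp hp₀ α C v := by
  obtain ⟨φ, h1, h2, h3⟩ := hv.exists_field
  have h := hGN φ h1
  have e1 : ∫⁻ x in Q, ‖SpaceV.field v x‖ₑ ^ r = ∫⁻ x in Q, ‖φ x‖ₑ ^ r :=
    lintegral_congr_ae (by filter_upwards [h2] with x hx; rw [hx])
  have e2 : ‖embH hp v‖ₑ ^ (2 : ℝ) = ∫⁻ x in Q, ‖φ x‖ₑ ^ (2 : ℝ) := by
    rw [enorm_embH, eLpNorm_congr_ae h2, ← eLpNorm_ofReal_rpow two_pos, ENNReal.ofReal_ofNat]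
  have e3 : ‖gradLpOfLe hp₀ v‖ₑ ^ p₀ = ∫⁻ x in Q, ‖gradField φ x‖ₑ ^ p₀ := by
    rw [Lp.enorm_def, eLpNorm_congr_ae ((coeFn_gradLpOfLe hp₀ v).trans h3),
      eLpNorm_ofReal_rpow hp₀0]
  rw [e1, gnBound, mul_ofReal_rpow_mul_rpow (norm_nonneg _) (norm_nonneg _) hp₀0.le hα,
    ofReal_norm, ofReal_norm, e2, e3]
  exact h

/-- Approximation by test fields: a subsequence converges a.e., Fatou's lemma handles the left side,
and the right side is continuous on `𝕍`. -/
theorem GagliardoNirenberg.lintegral_le (hGN : GagliardoNirenberg Q p₀ r α C) (hC : C ≠ ⊤)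
    (hp : 2 ≤ p) (hp₀ : p₀ ≤ p) (hp₀0 : 0 < p₀) (hα : 0 ≤ α) (v : SpaceV Q p) :
    ∫⁻ x in Q, ‖SpaceV.field v x‖ₑ ^ r ≤ gnBound hp hp₀ α C v := by
  obtain ⟨u, hu, hlim⟩ := mem_closure_iff_seq_limit.1 (dense_isTest v)
  have hlim' : Tendsto (fun n => fieldLp (u n)) atTop (𝓝 (fieldLp v)) :=
    ((fieldLp (Q := Q) (p := p)).continuous.tendsto v).comp hlim
  have hm := tendstoInMeasure_of_tendsto_Lp hlim'
  obtain ⟨ns, hns, hae⟩ := hm.exists_seq_tendsto_ae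
  have hfat : ∫⁻ x in Q, ‖SpaceV.field v x‖ₑ ^ r ≤
      liminf (fun k => ∫⁻ x in Q, ‖SpaceV.field (u (ns k)) x‖ₑ ^ r) atTop := by
    refine le_trans (lintegral_mono_ae ?_) (lintegral_liminf_le' fun k => ?_)
    · filter_upwards [hae] with x hx
      have hc : Continuous fun y : Vec N => ‖y‖ₑ ^ r :=
        (ENNReal.continuous_rpow_const).comp continuous_enorm
      exact ((hc.tendsto _).comp hx).liminf_eq.ge
    · exact (Lp.aestronglyMeasurable (fieldLp (u (ns k)))).enorm.pow_const _
  refine hfat.trans ?_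
  have hlim2 : Tendsto (fun k => gnBound hp hp₀ α C (u (ns k))) atTop (𝓝 (gnBound hp hp₀ α C v)) :=
    ((continuous_gnBound hp hp₀ hp₀0 hα hC).tendsto v).comp (hlim.comp hns.tendsto_atTop)
  rw [← hlim2.liminf_eq]
  exact liminf_le_liminf (Eventually.of_forall fun k =>
    hGN.lintegral_le_of_isTest hp hp₀ hp₀0 hα (hu (ns k)))

end Spaces

/-! ### The convective form: integration by parts, continuity, antisymmetry -/

section Trilinear

variable {α : Type*} [MeasurableSpace α] {μ : Measure α} {p₁ p₂ p₃ s : ℝ≥0∞}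
  [Fact (1 ≤ p₁)] [Fact (1 ≤ p₂)] [Fact (1 ≤ p₃)] [Fact (1 ≤ s)]
  [ENNReal.HolderTriple p₁ p₂ s] [ENNReal.HolderConjugate s p₃]

/-- The trilinear form `(f, g, h) ↦ ∫ f g h` on a Hölder triple of `L^p` spaces. -/
noncomputable def lpTrilin (μ : Measure α) (p₁ p₂ p₃ s : ℝ≥0∞)
    [Fact (1 ≤ p₁)] [Fact (1 ≤ p₂)] [Fact (1 ≤ p₃)] [Fact (1 ≤ s)]
    [ENNReal.HolderTriple p₁ p₂ s] [ENNReal.HolderConjugate s p₃] :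
    Lp ℝ p₁ μ →L[ℝ] Lp ℝ p₂ μ →L[ℝ] Lp ℝ p₃ μ →L[ℝ] ℝ :=
  (ContinuousLinearMap.compL ℝ (Lp ℝ p₂ μ) (Lp ℝ s μ) (Lp ℝ p₃ μ →L[ℝ] ℝ)
    ((ContinuousLinearMap.mul ℝ ℝ).lpPairing μ s p₃)).comp
    ((ContinuousLinearMap.mul ℝ ℝ).holderL μ p₁ p₂ s)

theorem lpTrilin_apply (f : Lp ℝ p₁ μ) (g : Lp ℝ p₂ μ) (h : Lp ℝ p₃ μ) :
    lpTrilin μ p₁ p₂ p₃ s f g h = ∫ x, f x * g x * h x ∂μ := by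
  change (ContinuousLinearMap.mul ℝ ℝ).lpPairing μ s p₃
    ((ContinuousLinearMap.mul ℝ ℝ).holderL μ p₁ p₂ s f g) h = _
  rw [ContinuousLinearMap.lpPairing_eq_integral]
  refine integral_congr_ae ?_
  filter_upwards [(ContinuousLinearMap.mul ℝ ℝ).coeFn_holder (r := s) f g] with x hx
  rw [ContinuousLinearMap.holderL_apply_apply, hx]
  rfl

/-- The `i`-th coordinate of an `L^p` function with values in a Euclidean space. -/
noncomputable def lpCoord {ι : Type*} [Fintype ι] (μ : Measure α) (p : ℝ≥0∞) [Fact (1 ≤ p)] (i : ι) :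
    Lp (EuclideanSpace ℝ ι) p μ →L[ℝ] Lp ℝ p μ :=
  (EuclideanSpace.proj (𝕜 := ℝ) i).compLpL p μ

theorem coeFn_lpCoord {ι : Type*} [Fintype ι] (i : ι) (f : Lp (EuclideanSpace ℝ ι) p₁ μ) :
    lpCoord μ p₁ i f =ᵐ[μ] fun x => f x i :=
  ContinuousLinearMap.coeFn_compLpL _ f

end Trilinear

section TestFields

variable {N : ℕ} {Q : Set (Vec N)}

theorem IsTestField.differentiable {φ : Vec N → Vec N} (h : IsTestField Q φ) :
    Differentiable ℝ φ := h.contDiff_one.differentiable (by simp)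

theorem IsTestField.contDiff_coord {φ : Vec N → Vec N} (h : IsTestField Q φ) (i : Fin N) :
    ContDiff ℝ 1 fun x => φ x i :=
  (EuclideanSpace.proj (𝕜 := ℝ) i).contDiff.comp h.contDiff_one

theorem IsTestField.fderiv_coord {φ : Vec N → Vec N} (h : IsTestField Q φ) (i j : Fin N)
    (x : Vec N) :
    fderiv ℝ (fun x => φ x j) x (EuclideanSpace.single i 1) = gradField φ x (i, j) := by
  have := ((EuclideanSpace.proj (𝕜 := ℝ) j).hasFDerivAt.comp x (h.differentiable x).hasFDerivAt)
  have e : fderiv ℝ (fun x => φ x j) x =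
    (EuclideanSpace.proj (𝕜 := ℝ) j).comp (fderiv ℝ φ x) := this.fderiv
  rw [e]
  rfl

theorem IsTestField.continuous_grad_coord {φ : Vec N → Vec N} (h : IsTestField Q φ)
    (ij : Fin N × Fin N) : Continuous fun x => gradField φ x ij :=
  (EuclideanSpace.proj (𝕜 := ℝ) ij).continuous.comp h.continuous_gradField

theorem IsTestField.hasCompactSupport_coord {φ : Vec N → Vec N} (h : IsTestField Q φ) (i : Fin N) :
    HasCompactSupport fun x => φ x i :=
  h.compact.comp_left (g := fun y : Vec N => y i) rfl

theorem IsTestField.hasCompactSupport_grad_coord {φ : Vec N → Vec N} (h : IsTestField Q φ)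
    (ij : Fin N × Fin N) : HasCompactSupport fun x => gradField φ x ij :=
  (h.compact.fderiv ℝ).mono fun x hx hx' => hx (by simp [gradField_eq_zero_of_fderiv hx'])

theorem IsTestField.eq_zero_of_notMem {φ : Vec N → Vec N} (h : IsTestField Q φ) {x : Vec N}
    (hx : x ∉ Q) : φ x = 0 :=
  image_eq_zero_of_notMem_tsupport fun hx' => hx (h.support hx')

/-- Integration by parts of `φ_i ∂_i(ψ_j χ_j)`: the remaining term carries `∂_i φ_i`, and summing
over `i` produces the divergence of `φ`, which is zero. -/
theorem sum_integral_convective_test {φ ψ χ : Vec N → Vec N} (hφ : IsTestField Q φ)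
    (hψ : IsTestField Q ψ) (hχ : IsTestField Q χ) :
    (∑ i, ∑ j, ∫ x in Q, φ x i * gradField ψ x (i, j) * χ x j) =
      -∑ i, ∑ j, ∫ x in Q, φ x i * gradField χ x (i, j) * ψ x j := by
  have hset : ∀ {ξ ζ : Vec N → Vec N} (i j : Fin N), ∫ x in Q, φ x i * gradField ξ x (i, j) * ζ x j =
      ∫ x, φ x i * gradField ξ x (i, j) * ζ x j := by
    intro ξ ζ i j
    refine setIntegral_eq_integral_of_forall_compl_eq_zero fun x hx => ?_
    simp [hφ.eq_zero_of_notMem hx]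
  have hint : ∀ {ξ ζ : Vec N → Vec N}, IsTestField Q ξ → IsTestField Q ζ → ∀ (i j : Fin N),
      Integrable fun x => φ x i * gradField ξ x (i, j) * ζ x j := by
    intro ξ ζ hξ hζ i j
    refine Continuous.integrable_of_hasCompactSupport ?_ ?_
    · exact ((hφ.contDiff_coord i).continuous.mul (hξ.continuous_grad_coord _)).mul
        (hζ.contDiff_coord j).continuous
    · exact (hζ.hasCompactSupport_coord j).mul_left
  have hint2 : ∀ i j : Fin N, Integrable fun x => gradField φ x (i, i) * (ψ x j * χ x j) := by
    intro i j
    refine Continuous.integrable_of_hasCompactSupport ?_ ?_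
    · exact (hφ.continuous_grad_coord _).mul
        ((hψ.contDiff_coord j).continuous.mul (hχ.contDiff_coord j).continuous)
    · exact (hφ.hasCompactSupport_grad_coord _).mul_right
  have hmain : ∀ i j : Fin N, (∫ x, φ x i * gradField ψ x (i, j) * χ x j) +
      ∫ x, φ x i * gradField χ x (i, j) * ψ x j =
      -∫ x, gradField φ x (i, i) * (ψ x j * χ x j) := by
    intro i j
    have hψχ : ∀ x, fderiv ℝ (fun x => ψ x j * χ x j) x (EuclideanSpace.single i 1) =
        gradField ψ x (i, j) * χ x j + gradField χ x (i, j) * ψ x j := by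
      intro x
      rw [fderiv_fun_mul ((hψ.contDiff_coord j).differentiable (by simp) x)
        ((hχ.contDiff_coord j).differentiable (by simp) x)]
      simp only [_root_.add_apply, _root_.smul_apply, smul_eq_mul,
        hψ.fderiv_coord, hχ.fderiv_coord]
      ring
    have hsum : ∀ x, φ x i * fderiv ℝ (fun x => ψ x j * χ x j) x (EuclideanSpace.single i 1) =
        φ x i * gradField ψ x (i, j) * χ x j + φ x i * gradField χ x (i, j) * ψ x j := by
      intro x; rw [hψχ]; ring
    have hparts := integral_mul_fderiv_eq_neg_fderiv_mul_of_integrable (μ := volume)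
      (f := fun x => φ x i) (g := fun x => ψ x j * χ x j) (v := EuclideanSpace.single i 1)
      (by simp only [hφ.fderiv_coord]; exact hint2 i j)
      (by simp only [hsum]; exact (hint hψ hχ i j).add (hint hχ hψ i j))
      (Continuous.integrable_of_hasCompactSupport
        ((hφ.contDiff_coord i).continuous.mul
          ((hψ.contDiff_coord j).continuous.mul (hχ.contDiff_coord j).continuous))
        (hφ.hasCompactSupport_coord i).mul_right)
      (fun x _ => (hφ.contDiff_coord i).differentiable (by simp) x)
      (fun x _ => ((hψ.contDiff_coord j).mul (hχ.contDiff_coord j)).differentiable (by simp) x)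
    simp only [hsum, hφ.fderiv_coord] at hparts
    rw [← hparts, integral_add (hint hψ hχ i j) (hint hχ hψ i j)]
  rw [eq_neg_iff_add_eq_zero, ← Finset.sum_add_distrib]
  simp only [← Finset.sum_add_distrib, hset, hmain]
  rw [Finset.sum_comm]
  refine Finset.sum_eq_zero fun j _ => ?_
  rw [Finset.sum_neg_distrib, ← integral_finsetSum _ fun i _ => hint2 i j]
  simp only [← Finset.sum_mul]
  have : ∀ x, ∑ i, gradField φ x (i, i) = 0 := hφ.div_eq_zero
  simp [this]

end TestFields

section Convective

variable {N : ℕ} {Q : Set (Vec N)} {p : ℝ} [Fact (1 ≤ ENNReal.ofReal p)]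
  [IsFiniteMeasure (volume.restrict Q)]
  {p₀ r α : ℝ} {C : ℝ≥0∞} [Fact (1 ≤ ENNReal.ofReal p₀)] [Fact (1 ≤ ENNReal.ofReal r)]

theorem field_add (v w : SpaceV Q p) :
    SpaceV.field (v + w) =ᵐ[volume.restrict Q] SpaceV.field v + SpaceV.field w :=
  Lp.coeFn_add v.1.1 w.1.1

theorem field_smul (c : ℝ) (v : SpaceV Q p) :
    SpaceV.field (c • v) =ᵐ[volume.restrict Q] c • SpaceV.field v :=
  Lp.coeFn_smul c v.1.1

theorem toReal_mul_ofReal_rpow {a b : ℝ} (ha : 0 ≤ a) (hb : 0 ≤ b) :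
    (C * ENNReal.ofReal ((a ^ (2 : ℝ)) ^ α * b ^ p₀)).toReal =
      C.toReal * ((a ^ (2 : ℝ)) ^ α * b ^ p₀) := by
  rw [ENNReal.toReal_mul, ENNReal.toReal_ofReal (by positivity)]

/-- Exponents and constant for which the Gagliardo-Nirenberg inequality holds, and for which the
convective form can be estimated. -/
structure ConvectiveExponents (Q : Set (Vec N)) (p p₀ r α : ℝ) (C : ℝ≥0∞) : Prop where
  two_le : 2 ≤ p₀
  le : p₀ ≤ p
  two_le_r : 2 ≤ r
  holder : 1 / p₀ + 2 / r = 1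
  nonneg : 0 ≤ α
  scaling : 2 * α + p₀ = r
  ne_top : C ≠ ⊤
  ineq : GagliardoNirenberg Q p₀ r α C

namespace ConvectiveExponents

theorem two_le_p (h : ConvectiveExponents Q p p₀ r α C) : 2 ≤ p := h.two_le.trans h.le

theorem pos (h : ConvectiveExponents Q p p₀ r α C) : 0 < p₀ := by linarith [h.two_le]

theorem r_pos (h : ConvectiveExponents Q p p₀ r α C) : 0 < r := by linarith [h.two_le_r]

theorem eLpNorm_rpow_le (h : ConvectiveExponents Q p p₀ r α C) (v : SpaceV Q p) :
    eLpNorm (SpaceV.field v) (ENNReal.ofReal r) (volume.restrict Q) ^ r ≤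
      gnBound h.two_le_p h.le α C v := by
  rw [eLpNorm_ofReal_rpow h.r_pos]
  exact h.ineq.lintegral_le h.ne_top h.two_le_p h.le h.pos h.nonneg v

theorem memLp_field (h : ConvectiveExponents Q p p₀ r α C) (v : SpaceV Q p) :
    MemLp (SpaceV.field v) (ENNReal.ofReal r) (volume.restrict Q) := by
  refine ⟨Lp.aestronglyMeasurable (fieldLp v), ?_⟩
  have h1 : gnBound h.two_le_p h.le α C v < ⊤ :=
    (ENNReal.mul_ne_top h.ne_top ENNReal.ofReal_ne_top).lt_top
  exact (ENNReal.rpow_lt_top_iff_of_pos h.r_pos).1 ((h.eLpNorm_rpow_le v).trans_lt h1)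

theorem norm_toLp_rpow_le (h : ConvectiveExponents Q p p₀ r α C) (v : SpaceV Q p) :
    ‖(h.memLp_field v).toLp (SpaceV.field v)‖ ^ r ≤
      C.toReal * ((‖embH h.two_le_p v‖ ^ (2 : ℝ)) ^ α * ‖gradLpOfLe h.le v‖ ^ p₀) := by
  have h0 : gnBound h.two_le_p h.le α C v ≠ ⊤ :=
    ENNReal.mul_ne_top h.ne_top ENNReal.ofReal_ne_top
  have h1 := ENNReal.toReal_mono h0 (h.eLpNorm_rpow_le v)
  rw [← ENNReal.toReal_rpow, ← Lp.norm_toLp _ (h.memLp_field v)] at h1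
  exact h1.trans (le_of_eq (toReal_mul_ofReal_rpow (norm_nonneg _) (norm_nonneg _)))

/-- The relation `2α + p₀ = r` makes the right side of the Gagliardo-Nirenberg inequality
homogeneous of degree `r`, so its `r`-th root is a linear bound in `‖v‖`. -/
theorem exists_norm_toLp_le (h : ConvectiveExponents Q p p₀ r α C) : ∃ K : ℝ, ∀ v : SpaceV Q p,
    ‖(h.memLp_field v).toLp (SpaceV.field v)‖ ≤ K * ‖v‖ := by
  obtain ⟨k₁, hk₁, e1⟩ := (embH h.two_le_p : SpaceV Q p →L[ℝ] SpaceH Q).bound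
  obtain ⟨k₂, hk₂, e2⟩ := (gradLpOfLe h.le : SpaceV Q p →L[ℝ] _).bound
  refine ⟨(C.toReal * ((k₁ ^ (2 : ℝ)) ^ α * k₂ ^ p₀)) ^ (1 / r), fun v => ?_⟩
  have hr := h.r_pos
  have hα := h.nonneg
  have hp₀ := h.pos.le
  have hv := norm_nonneg v
  have hC : 0 ≤ C.toReal := ENNReal.toReal_nonneg
  rw [← Real.rpow_le_rpow_iff (norm_nonneg _) (by positivity) hr, Real.mul_rpow (by positivity) hv,
    ← Real.rpow_mul (by positivity), one_div_mul_cancel hr.ne', Real.rpow_one]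
  refine (h.norm_toLp_rpow_le v).trans ?_
  have e3 : ‖v‖ ^ r = (‖v‖ ^ (2 : ℝ)) ^ α * ‖v‖ ^ p₀ := by
    rw [← Real.rpow_mul hv, ← Real.rpow_add_of_nonneg hv (by positivity) hp₀, h.scaling]
  calc _ ≤ C.toReal * (((k₁ * ‖v‖) ^ (2 : ℝ)) ^ α * (k₂ * ‖v‖) ^ p₀) := by
        gcongr
        · exact e1 v
        · exact e2 v
    _ = _ := by
      rw [e3, Real.mul_rpow hk₁.le hv, Real.mul_rpow hk₂.le hv, Real.mul_rpow (by positivity)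
        (by positivity)]
      ring

/-- The embedding of `𝕍` into `L^r`, as a linear map. -/
noncomputable def embRₗ (h : ConvectiveExponents Q p p₀ r α C) :
    SpaceV Q p →ₗ[ℝ] Lp (Vec N) (ENNReal.ofReal r) (volume.restrict Q) where
  toFun v := (h.memLp_field v).toLp (SpaceV.field v)
  map_add' v w := (MemLp.toLp_congr _ ((h.memLp_field v).add (h.memLp_field w))
    (field_add v w)).trans (MemLp.toLp_add _ _)
  map_smul' c v := (MemLp.toLp_congr _ ((h.memLp_field v).const_smul c)
    (field_smul c v)).trans (MemLp.toLp_const_smul c _)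

/-- The embedding of `𝕍` into `L^r`. -/
noncomputable def embR (h : ConvectiveExponents Q p p₀ r α C) :
    SpaceV Q p →L[ℝ] Lp (Vec N) (ENNReal.ofReal r) (volume.restrict Q) :=
  h.embRₗ.mkContinuousOfExistsBound h.exists_norm_toLp_le

theorem coeFn_embR (h : ConvectiveExponents Q p p₀ r α C) (v : SpaceV Q p) :
    h.embR v =ᵐ[volume.restrict Q] SpaceV.field v :=
  MemLp.coeFn_toLp (h.memLp_field v)

theorem norm_embR_rpow_le (h : ConvectiveExponents Q p p₀ r α C) (v : SpaceV Q p) :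
    ‖h.embR v‖ ^ r ≤
      C.toReal * ((‖embH h.two_le_p v‖ ^ (2 : ℝ)) ^ α * ‖gradLpOfLe h.le v‖ ^ p₀) :=
  h.norm_toLp_rpow_le v

end ConvectiveExponents

end Convective

set_option maxSynthPendingDepth 3 in
theorem exists_sum_trilinear_bound {ι R A D V : Type*} [Fintype ι]
    [NormedAddCommGroup A] [NormedSpace ℝ A] [NormedAddCommGroup D] [NormedSpace ℝ D]
    [NormedAddCommGroup R] [NormedSpace ℝ R] [NormedAddCommGroup V] [NormedSpace ℝ V]
    (T : A →L[ℝ] A →L[ℝ] D →L[ℝ] ℝ) (c : ι → R →L[ℝ] A) (d : ι × ι → V →L[ℝ] D) :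
    ∃ K : ℝ, 0 ≤ K ∧ ∀ a b v,
      ‖∑ i, ∑ j, T (c i a) (c j b) (d (i, j) v)‖ ≤ K * ‖a‖ * ‖b‖ * ‖v‖ := by
  refine ⟨∑ i, ∑ j, ‖T‖ * ‖c i‖ * ‖c j‖ * ‖d (i, j)‖, by positivity, fun a b v => ?_⟩
  simp only [Finset.sum_mul]
  refine (norm_sum_le _ _).trans (Finset.sum_le_sum fun i _ => ?_)
  refine (norm_sum_le _ _).trans (Finset.sum_le_sum fun j _ => ?_)
  calc _ ≤ ‖T (c i a) (c j b)‖ * ‖d (i, j) v‖ := ContinuousLinearMap.le_opNorm _ _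
    _ ≤ (‖T‖ * ‖c i a‖ * ‖c j b‖) * ‖d (i, j) v‖ := by
        gcongr
        exact T.le_opNorm₂ _ _
    _ ≤ (‖T‖ * (‖c i‖ * ‖a‖) * (‖c j‖ * ‖b‖)) * (‖d (i, j)‖ * ‖v‖) := by
        gcongr
        · exact (c i).le_opNorm a
        · exact (c j).le_opNorm b
        · exact (d (i, j)).le_opNorm v
    _ = _ := by ring

theorem continuous_sum_trilinear {ι A D V : Type*} [Fintype ι]
    [NormedAddCommGroup A] [NormedSpace ℝ A] [NormedAddCommGroup D] [NormedSpace ℝ D]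
    [NormedAddCommGroup V] [NormedSpace ℝ V]
    (T : A →L[ℝ] A →L[ℝ] D →L[ℝ] ℝ) (c : ι → V →L[ℝ] A) (d : ι × ι → V →L[ℝ] D) :
    Continuous fun z : V × V × V =>
      ∑ i, ∑ j, T (c i z.1) (c j z.2.2) (d (i, j) z.2.1) := by
  fun_prop

namespace ConvectiveExponents

variable {N : ℕ} {Q : Set (Vec N)} {p p₀ r α : ℝ} {C : ℝ≥0∞}

theorem holderTriple (h : ConvectiveExponents Q p p₀ r α C) :
    ENNReal.HolderTriple (ENNReal.ofReal r) (ENNReal.ofReal r) (ENNReal.ofReal (r / 2)) := by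
  have hr : 0 < r := by linarith [h.two_le_r]
  constructor
  rw [← ENNReal.ofReal_inv_of_pos hr, ← ENNReal.ofReal_inv_of_pos (by positivity),
    ← ENNReal.ofReal_add (by positivity) (by positivity)]
  congr 1
  field_simp
  norm_num

theorem holderConjugate (h : ConvectiveExponents Q p p₀ r α C) :
    ENNReal.HolderConjugate (ENNReal.ofReal (r / 2)) (ENNReal.ofReal p₀) := by
  have hr : 0 < r := by linarith [h.two_le_r]
  have hp₀ : 0 < p₀ := by linarith [h.two_le]
  constructor
  rw [← ENNReal.ofReal_inv_of_pos hp₀, ← ENNReal.ofReal_inv_of_pos (by positivity),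
    ← ENNReal.ofReal_add (by positivity) (by positivity), inv_one, ← ENNReal.ofReal_one]
  congr 1
  rw [← h.holder, inv_div, one_div]
  ring

theorem fact_half (h : ConvectiveExponents Q p p₀ r α C) : Fact (1 ≤ ENNReal.ofReal (r / 2)) :=
  ⟨by rw [← ENNReal.ofReal_one]; exact ENNReal.ofReal_le_ofReal (by linarith [h.two_le_r])⟩

variable [Fact (1 ≤ ENNReal.ofReal p)] [IsFiniteMeasure (volume.restrict Q)]
  [Fact (1 ≤ ENNReal.ofReal p₀)] [Fact (1 ≤ ENNReal.ofReal r)]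

/-- The trilinear form `∫ f g h` on `L^r × L^r × L^{p₀}`. -/
noncomputable def trilin (h : ConvectiveExponents Q p p₀ r α C) :
    Lp ℝ (ENNReal.ofReal r) (volume.restrict Q) →L[ℝ] Lp ℝ (ENNReal.ofReal r) (volume.restrict Q)
      →L[ℝ] Lp ℝ (ENNReal.ofReal p₀) (volume.restrict Q) →L[ℝ] ℝ :=
  have := h.fact_half
  have := h.holderTriple
  have := h.holderConjugate
  lpTrilin (volume.restrict Q) (ENNReal.ofReal r) (ENNReal.ofReal r) (ENNReal.ofReal p₀)
    (ENNReal.ofReal (r / 2))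

theorem trilin_apply (h : ConvectiveExponents Q p p₀ r α C)
    (f g : Lp ℝ (ENNReal.ofReal r) (volume.restrict Q))
    (k : Lp ℝ (ENNReal.ofReal p₀) (volume.restrict Q)) :
    h.trilin f g k = ∫ x in Q, f x * g x * k x := by
  have := h.fact_half
  have := h.holderTriple
  have := h.holderConjugate
  exact lpTrilin_apply f g k

/-- The `i`-th component of an element of `𝕍`, in `L^r`. -/
noncomputable def fieldCoord (h : ConvectiveExponents Q p p₀ r α C) (i : Fin N) :
    SpaceV Q p →L[ℝ] Lp ℝ (ENNReal.ofReal r) (volume.restrict Q) :=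
  (lpCoord (volume.restrict Q) (ENNReal.ofReal r) i).comp h.embR

/-- The `(i, j)` component of the gradient of an element of `𝕍`, in `L^{p₀}`. -/
noncomputable def gradCoord (h : ConvectiveExponents Q p p₀ r α C) (ij : Fin N × Fin N) :
    SpaceV Q p →L[ℝ] Lp ℝ (ENNReal.ofReal p₀) (volume.restrict Q) :=
  (lpCoord (volume.restrict Q) (ENNReal.ofReal p₀) ij).comp (gradLpOfLe h.le)

theorem coeFn_fieldCoord (h : ConvectiveExponents Q p p₀ r α C) (i : Fin N) (v : SpaceV Q p) :
    h.fieldCoord i v =ᵐ[volume.restrict Q] fun x => SpaceV.field v x i := by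
  filter_upwards [coeFn_lpCoord i (h.embR v), h.coeFn_embR v] with x h1 h2
  exact h1.trans (by rw [h2])

theorem coeFn_gradCoord (h : ConvectiveExponents Q p p₀ r α C) (ij : Fin N × Fin N)
    (v : SpaceV Q p) :
    h.gradCoord ij v =ᵐ[volume.restrict Q] fun x => SpaceV.grad v x ij := by
  filter_upwards [coeFn_lpCoord ij (gradLpOfLe h.le v), coeFn_gradLpOfLe h.le v] with x h1 h2
  exact h1.trans (by rw [h2])

theorem convectiveForm_eq (h : ConvectiveExponents Q p p₀ r α C) (u v w : SpaceV Q p) :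
    convectiveForm u v w =
      ∑ i, ∑ j, h.trilin (h.fieldCoord i u) (h.fieldCoord j w) (h.gradCoord (i, j) v) := by
  refine Finset.sum_congr rfl fun i _ => Finset.sum_congr rfl fun j _ => ?_
  rw [h.trilin_apply]
  refine integral_congr_ae ?_
  filter_upwards [h.coeFn_fieldCoord i u, h.coeFn_fieldCoord j w, h.coeFn_gradCoord (i, j) v]
    with x h1 h2 h3
  rw [h1, h2, h3]
  ring

theorem continuous_convectiveForm (h : ConvectiveExponents Q p p₀ r α C) :
    Continuous fun z : SpaceV Q p × SpaceV Q p × SpaceV Q p =>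
      convectiveForm z.1 z.2.1 z.2.2 := by
  have hc := continuous_sum_trilinear h.trilin h.fieldCoord h.gradCoord
  exact hc.congr fun z => (h.convectiveForm_eq z.1 z.2.1 z.2.2).symm

omit [IsFiniteMeasure (volume.restrict Q)] [Fact (1 ≤ ENNReal.ofReal p₀)]
  [Fact (1 ≤ ENNReal.ofReal r)] in
theorem convectiveForm_of_ae {u v w : SpaceV Q p} {φ ψ χ : Vec N → Vec N}
    (hu : SpaceV.field u =ᵐ[volume.restrict Q] φ)
    (hv : SpaceV.grad v =ᵐ[volume.restrict Q] gradField ψ)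
    (hw : SpaceV.field w =ᵐ[volume.restrict Q] χ) :
    convectiveForm u v w = ∑ i, ∑ j, ∫ x in Q, φ x i * gradField ψ x (i, j) * χ x j := by
  refine Finset.sum_congr rfl fun i _ => Finset.sum_congr rfl fun j _ => ?_
  refine integral_congr_ae ?_
  filter_upwards [hu, hv, hw] with x h1 h2 h3
  rw [h1, h2, h3]

theorem convectiveForm_antisymm_of_isTest {u v w : SpaceV Q p} (hu : IsTest u) (hv : IsTest v)
    (hw : IsTest w) : convectiveForm u v w = -convectiveForm u w v := by
  obtain ⟨φ, φ1, φ2, -⟩ := hu.exists_field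
  obtain ⟨ψ, ψ1, ψ2, ψ3⟩ := hv.exists_field
  obtain ⟨χ, χ1, χ2, χ3⟩ := hw.exists_field
  rw [convectiveForm_of_ae φ2 ψ3 χ2, convectiveForm_of_ae φ2 χ3 ψ2]
  exact sum_integral_convective_test φ1 ψ1 χ1

/-- Holds for triples of test fields by integration by parts; both sides are continuous on `𝕍³`,
where such triples are dense. -/
theorem convectiveForm_antisymm (h : ConvectiveExponents Q p p₀ r α C) (u v w : SpaceV Q p) :
    convectiveForm u v w = -convectiveForm u w v := by
  have hc := h.continuous_convectiveForm
  have hd := (dense_isTest (Q := Q) (p := p)).prod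
    ((dense_isTest (Q := Q) (p := p)).prod (dense_isTest (Q := Q) (p := p)))
  have hsw : Continuous fun z : SpaceV Q p × SpaceV Q p × SpaceV Q p => (z.1, z.2.2, z.2.1) := by
    fun_prop
  have heq : EqOn (fun z : SpaceV Q p × SpaceV Q p × SpaceV Q p => convectiveForm z.1 z.2.1 z.2.2)
      (fun z => -convectiveForm z.1 z.2.2 z.2.1)
      ({v | IsTest v} ×ˢ ({v | IsTest v} ×ˢ {v | IsTest v})) := fun z hz =>
    convectiveForm_antisymm_of_isTest hz.1 hz.2.1 hz.2.2
  exact congrFun (Continuous.ext_on hd hc (hc.comp hsw).neg heq) (u, v, w)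

theorem convectiveForm_self (h : ConvectiveExponents Q p p₀ r α C) (u v : SpaceV Q p) :
    convectiveForm u v v = 0 := by
  have := h.convectiveForm_antisymm u v v
  linarith

/-- `v ↦ convectiveForm u u v`, as a continuous linear form. -/
noncomputable def convectiveL (h : ConvectiveExponents Q p p₀ r α C) (u : SpaceV Q p) :
    SpaceV Q p →L[ℝ] ℝ :=
  ∑ i, ∑ j, ((h.trilin (h.fieldCoord i u)).flip (h.gradCoord (i, j) u)).comp (h.fieldCoord j)

theorem convectiveL_apply (h : ConvectiveExponents Q p p₀ r α C) (u v : SpaceV Q p) :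
    h.convectiveL u v = convectiveForm u u v := by
  rw [h.convectiveForm_eq]
  simp [convectiveL]

/-- Antisymmetry moves the derivative from `u` onto `v`. The dual norm is then quadratic in `‖u‖_r`
with no factor `∇u`, which is what leads to growth `p₀ - 1` instead of one power more. -/
theorem exists_abs_convectiveForm_le (h : ConvectiveExponents Q p p₀ r α C) :
    ∃ K : ℝ, 0 ≤ K ∧ ∀ u v : SpaceV Q p,
      |convectiveForm u u v| ≤ K * ‖h.embR u‖ * ‖h.embR u‖ * ‖v‖ := by
  obtain ⟨K, hK, hb⟩ := exists_sum_trilinear_bound h.trilin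
    (fun i => lpCoord (volume.restrict Q) (ENNReal.ofReal r) i) h.gradCoord
  refine ⟨K, hK, fun u v => ?_⟩
  have e1 : |convectiveForm u u v| = |convectiveForm u v u| := by
    have := congrArg abs (h.convectiveForm_antisymm u u v)
    exact this.trans (abs_neg _)
  have e2 := congrArg abs (h.convectiveForm_eq u v u)
  exact (e1.trans e2).le.trans (hb (h.embR u) (h.embR u) v)

end ConvectiveExponents

/-! ### Viscous integrands and their growth and continuity -/

section Kernel

variable {α E : Type*} [MeasurableSpace α] {μ : Measure α} [NormedAddCommGroup E]

theorem lintegral_rpow_one_div {q : ℝ} (hq : 0 < q) (f : α → E) :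
    (∫⁻ x, ‖f x‖ₑ ^ q ∂μ) ^ (1 / q) = eLpNorm f (ENNReal.ofReal q) μ := by
  rw [← eLpNorm_ofReal_rpow hq, ← ENNReal.rpow_mul, mul_one_div_cancel hq.ne', ENNReal.rpow_one]

/-- Hölder's inequality for three factors with weights `(q-2)/q`, `1/q`, `1/q`; the first weight may
be zero, which covers the linear case `q = 2`. -/
theorem lintegral_rpow_mul_mul_le {q : ℝ} (hq : 2 ≤ q) {f : α → ℝ} {g h : α → E}
    (hf : AEStronglyMeasurable f μ) (hg : AEStronglyMeasurable g μ)
    (hh : AEStronglyMeasurable h μ) :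
    ∫⁻ x, ‖f x‖ₑ ^ (q - 2) * ‖g x‖ₑ * ‖h x‖ₑ ∂μ ≤
      eLpNorm f (ENNReal.ofReal q) μ ^ (q - 2) * eLpNorm g (ENNReal.ofReal q) μ *
        eLpNorm h (ENNReal.ofReal q) μ := by
  have hq0 : 0 < q := by linarith
  have key := ENNReal.lintegral_prod_norm_pow_le (μ := μ) (Finset.univ : Finset (Fin 3))
    (f := ![fun x => ‖f x‖ₑ ^ q, fun x => ‖g x‖ₑ ^ q, fun x => ‖h x‖ₑ ^ q])
    (p := ![(q - 2) / q, 1 / q, 1 / q])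
    (by
      intro i _
      fin_cases i
      · exact hf.enorm.pow_const _
      · exact hg.enorm.pow_const _
      · exact hh.enorm.pow_const _)
    (by
      simp [Fin.sum_univ_three]
      field_simp
      ring)
    (by
      intro i _
      fin_cases i
      · exact div_nonneg (by linarith) hq0.le
      · exact (one_div_pos.2 hq0).le
      · exact (one_div_pos.2 hq0).le)
  simp only [Fin.prod_univ_three, Matrix.cons_val_zero, Matrix.cons_val_one, Matrix.cons_val,
    ← ENNReal.rpow_mul, mul_div_cancel₀ _ hq0.ne', ENNReal.rpow_one] at key
  rw [lintegral_rpow_one_div hq0, lintegral_rpow_one_div hq0,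
    show (q - 2) / q = 1 / q * (q - 2) by ring, ENNReal.rpow_mul, lintegral_rpow_one_div hq0] at key
  exact key

variable [InnerProductSpace ℝ E]

/-- Integrands `k x A B`, linear in `B`, of `(q - 1)`-growth and locally Lipschitz in `A`. -/
structure IsViscousKernel (μ : Measure α) (q M : ℝ) (k : α → E → E → ℝ) : Prop where
  two_le : 2 ≤ q
  nonneg : 0 ≤ M
  meas : ∀ G H : α → E, AEStronglyMeasurable G μ → AEStronglyMeasurable H μ →
    AEStronglyMeasurable (fun x => k x (G x) (H x)) μ
  zero : ∀ x B, k x 0 B = 0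
  add : ∀ x A B B', k x A (B + B') = k x A B + k x A B'
  smul : ∀ x A (c : ℝ) B, k x A (c • B) = c * k x A B
  bound : ∀ᵐ x ∂μ, ∀ A A' B,
    |k x A B - k x A' B| ≤ M * ((‖A‖ + ‖A'‖) ^ (q - 2) * ‖A - A'‖ * ‖B‖)

namespace IsViscousKernel

variable {q M : ℝ} {k : α → E → E → ℝ} {P : ℝ≥0∞} [Fact (1 ≤ P)]

/-- Stated for any `P` equal to `ENNReal.ofReal q`, so that the matrix part can be used with the
numeral `2` as exponent. Continuity, integrability and growth of the integrated form all follow from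
this estimate. -/
theorem lintegral_sub_le (hk : IsViscousKernel μ q M k) (hP : P = ENNReal.ofReal q) (G G' H : Lp E P μ) :
    ∫⁻ x, ‖k x (G x) (H x) - k x (G' x) (H x)‖ₑ ∂μ ≤
      ENNReal.ofReal (M * ((‖G‖ + ‖G'‖) ^ (q - 2) * ‖G - G'‖ * ‖H‖)) := by
  subst hP
  have hq2 : 0 ≤ q - 2 := by linarith [hk.two_le]
  have hM := hk.nonneg
  have hGs := Lp.aestronglyMeasurable G
  have hGs' := Lp.aestronglyMeasurable G'
  have hHs := Lp.aestronglyMeasurable H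
  have h1 := lintegral_rpow_mul_mul_le (μ := μ) hk.two_le (f := fun x => ‖G x‖ + ‖G' x‖)
    (g := fun x => G x - G' x) (h := H) (hGs.norm.add hGs'.norm) (hGs.sub hGs') hHs
  have h2 : eLpNorm (fun x => ‖G x‖ + ‖G' x‖) (ENNReal.ofReal q) μ ≤ ENNReal.ofReal (‖G‖ + ‖G'‖) := by
    refine (eLpNorm_add_le hGs.norm hGs'.norm Fact.out).trans ?_
    rw [eLpNorm_norm, eLpNorm_norm, ENNReal.ofReal_add (norm_nonneg _) (norm_nonneg _), ofReal_norm,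
      ofReal_norm, Lp.enorm_def, Lp.enorm_def]
  have h3 : eLpNorm (fun x => G x - G' x) (ENNReal.ofReal q) μ = ENNReal.ofReal ‖G - G'‖ := by
    rw [ofReal_norm, Lp.enorm_def]
    exact eLpNorm_congr_ae (Lp.coeFn_sub G G').symm
  have h4 : eLpNorm H (ENNReal.ofReal q) μ = ENNReal.ofReal ‖H‖ := by
    rw [ofReal_norm, Lp.enorm_def]
  calc ∫⁻ x, ‖k x (G x) (H x) - k x (G' x) (H x)‖ₑ ∂μ
      ≤ ∫⁻ x, ENNReal.ofReal M * (‖‖G x‖ + ‖G' x‖‖ₑ ^ (q - 2) * ‖G x - G' x‖ₑ * ‖H x‖ₑ) ∂μ := by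
        refine lintegral_mono_ae ?_
        filter_upwards [hk.bound] with x hx
        have h5 : ∀ {A A' B : E}, ENNReal.ofReal (M * ((‖A‖ + ‖A'‖) ^ (q - 2) * ‖A - A'‖ * ‖B‖)) =
            ENNReal.ofReal M * (‖‖A‖ + ‖A'‖‖ₑ ^ (q - 2) * ‖A - A'‖ₑ * ‖B‖ₑ) := by
          intro A A' B
          rw [ENNReal.ofReal_mul hM, ENNReal.ofReal_mul (by positivity),
            ENNReal.ofReal_mul (by positivity), ← ENNReal.ofReal_rpow_of_nonneg (by positivity) hq2,
            ofReal_norm, ofReal_norm, Real.enorm_of_nonneg (by positivity)]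
        rw [← h5, Real.enorm_eq_ofReal_abs]
        exact ENNReal.ofReal_le_ofReal (hx _ _ _)
    _ = ENNReal.ofReal M * ∫⁻ x, ‖‖G x‖ + ‖G' x‖‖ₑ ^ (q - 2) * ‖G x - G' x‖ₑ * ‖H x‖ₑ ∂μ :=
        lintegral_const_mul' _ _ ENNReal.ofReal_ne_top
    _ ≤ ENNReal.ofReal M * (ENNReal.ofReal (‖G‖ + ‖G'‖) ^ (q - 2) * ENNReal.ofReal ‖G - G'‖ *
        ENNReal.ofReal ‖H‖) := by
        gcongr
        refine h1.trans ?_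
        rw [h3, h4]
        gcongr
    _ = _ := by
        rw [ENNReal.ofReal_mul hM, ENNReal.ofReal_mul (by positivity),
          ENNReal.ofReal_mul (by positivity), ← ENNReal.ofReal_rpow_of_nonneg (by positivity) hq2]

theorem integrable (hk : IsViscousKernel μ q M k) (hP : P = ENNReal.ofReal q) (G H : Lp E P μ) :
    Integrable (fun x => k x (G x) (H x)) μ := by
  refine ⟨hk.meas _ _ (Lp.aestronglyMeasurable G) (Lp.aestronglyMeasurable H), ?_⟩
  refine lt_of_le_of_lt ?_ ((hk.lintegral_sub_le hP G 0 H).trans_lt ENNReal.ofReal_lt_top)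
  refine lintegral_mono_ae ?_
  filter_upwards [Lp.coeFn_zero E P μ] with x hx
  rw [hx, Pi.zero_apply, hk.zero, sub_zero]

theorem abs_integral_sub_le (hk : IsViscousKernel μ q M k) (hP : P = ENNReal.ofReal q) (G G' H : Lp E P μ) :
    |(∫ x, k x (G x) (H x) ∂μ) - ∫ x, k x (G' x) (H x) ∂μ| ≤
      M * ((‖G‖ + ‖G'‖) ^ (q - 2) * ‖G - G'‖ * ‖H‖) := by
  have hM := hk.nonneg
  rw [← integral_sub (hk.integrable hP G H) (hk.integrable hP G' H), ← Real.norm_eq_abs,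
    ← ENNReal.ofReal_le_ofReal_iff (by positivity), ofReal_norm]
  exact (enorm_integral_le_lintegral_enorm _).trans (hk.lintegral_sub_le hP G G' H)

theorem abs_integral_le (hk : IsViscousKernel μ q M k) (hP : P = ENNReal.ofReal q) (G H : Lp E P μ) :
    |∫ x, k x (G x) (H x) ∂μ| ≤ M * ‖G‖ ^ (q - 1) * ‖H‖ := by
  have h := hk.abs_integral_sub_le hP G 0 H
  have h0 : ∫ x, k x ((0 : Lp E P μ) x) (H x) ∂μ = 0 := by
    refine integral_eq_zero_of_ae ?_
    filter_upwards [Lp.coeFn_zero E P μ] with x hx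
    rw [hx, Pi.zero_apply, hk.zero, Pi.zero_apply]
  rw [h0, sub_zero, sub_zero, norm_zero, add_zero] at h
  refine h.trans (le_of_eq ?_)
  have : ‖G‖ ^ (q - 1) = ‖G‖ ^ (q - 2) * ‖G‖ := by
    have h2 := hk.two_le
    rw [show q - 1 = q - 2 + 1 by ring, Real.rpow_add_of_nonneg (norm_nonneg _) (by linarith)
      zero_le_one, Real.rpow_one]
  rw [this]
  ring

theorem exists_clm (hk : IsViscousKernel μ q M k) (hP : P = ENNReal.ofReal q) (G : Lp E P μ) :
    ∃ L : Lp E P μ →L[ℝ] ℝ, ∀ H, L H = ∫ x, k x (G x) (H x) ∂μ := by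
  let L : Lp E P μ →ₗ[ℝ] ℝ :=
    { toFun := fun H => ∫ x, k x (G x) (H x) ∂μ
      map_add' := fun H H' => by
        rw [← integral_add (hk.integrable hP G H) (hk.integrable hP G H')]
        refine integral_congr_ae ?_
        filter_upwards [Lp.coeFn_add H H'] with x hx
        rw [hx, Pi.add_apply, hk.add]
      map_smul' := fun c H => by
        rw [RingHom.id_apply, smul_eq_mul, ← integral_const_mul]
        refine integral_congr_ae ?_
        filter_upwards [Lp.coeFn_smul c H] with x hx
        rw [hx, Pi.smul_apply, hk.smul] }
  exact ⟨L.mkContinuous (M * ‖G‖ ^ (q - 1)) fun H => hk.abs_integral_le hP G H, fun H => rfl⟩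

theorem continuous_integral (hk : IsViscousKernel μ q M k) (hP : P = ENNReal.ofReal q) (H : Lp E P μ) :
    Continuous fun G : Lp E P μ => ∫ x, k x (G x) (H x) ∂μ := by
  rw [continuous_iff_continuousAt]
  intro G
  rw [ContinuousAt, tendsto_iff_dist_tendsto_zero]
  have hc : Continuous fun G' : Lp E P μ =>
      M * ((‖G'‖ + ‖G‖) ^ (q - 2) * ‖G' - G‖ * ‖H‖) := by
    have h1 : Continuous fun G' : Lp E P μ => (‖G'‖ + ‖G‖) ^ (q - 2) :=
      (continuous_norm.add continuous_const).rpow_const fun _ => Or.inr (by linarith [hk.two_le])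
    fun_prop
  have h0 := hc.tendsto G
  rw [sub_self, norm_zero, mul_zero, zero_mul, mul_zero] at h0
  exact squeeze_zero (fun _ => dist_nonneg) (fun G' => hk.abs_integral_sub_le hP G' G H) h0

end IsViscousKernel

/-- For `‖B‖ ≤ ‖A‖` the difference is `‖A‖^q (A - B) + (‖A‖^q - ‖B‖^q) B`. The factor `‖B‖` must be
kept in the second term, because `t ↦ t^q` is not Lipschitz near `0` when `0 < q < 1`. -/
theorem norm_rpow_smul_sub_le {q : ℝ} (hq : 0 ≤ q) (A B : E) :
    ‖‖A‖ ^ q • A - ‖B‖ ^ q • B‖ ≤ (q + 2) * (‖A‖ + ‖B‖) ^ q * ‖A - B‖ := by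
  wlog h : ‖B‖ ≤ ‖A‖ generalizing A B
  · rw [norm_sub_rev, norm_sub_rev A B, add_comm ‖A‖]
    exact this B A (le_of_not_ge h)
  have hA := norm_nonneg A
  have hB := norm_nonneg B
  have h1 : ‖A‖ ^ q • A - ‖B‖ ^ q • B = ‖A‖ ^ q • (A - B) + (‖A‖ ^ q - ‖B‖ ^ q) • B := by
    rw [smul_sub, sub_smul]; abel
  have h2 : (‖A‖ ^ q - ‖B‖ ^ q) * ‖B‖ ≤ (q + 1) * ‖A‖ ^ q * (‖A‖ - ‖B‖) := by
    rcases hA.eq_or_lt with h0 | h0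
    · have hB0 : ‖B‖ = 0 := le_antisymm (h0 ▸ h) hB
      rw [hB0, ← h0]; simp
    -- Bernoulli's inequality for the exponent `q + 1` at `‖B‖ / ‖A‖`: the tangent line at `1` lies
    -- below the power.
    · have hb := one_add_mul_self_le_rpow_one_add (s := ‖B‖ / ‖A‖ - 1) (p := q + 1)
        (by have : 0 ≤ ‖B‖ / ‖A‖ := by positivity
            linarith) (by linarith)
      rw [add_sub_cancel, Real.div_rpow hB hA, le_div_iff₀ (by positivity)] at hb
      have e1 : ‖B‖ ^ (q + 1) = ‖B‖ ^ q * ‖B‖ := by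
        rw [Real.rpow_add_of_nonneg hB hq zero_le_one, Real.rpow_one]
      have e2 : ‖A‖ ^ (q + 1) = ‖A‖ ^ q * ‖A‖ := by
        rw [Real.rpow_add_of_nonneg hA hq zero_le_one, Real.rpow_one]
      rw [e1, e2] at hb
      have e3 : (1 + (q + 1) * (‖B‖ / ‖A‖ - 1)) * (‖A‖ ^ q * ‖A‖) =
          ‖A‖ ^ q * ‖A‖ - (q + 1) * ‖A‖ ^ q * (‖A‖ - ‖B‖) := by
        field_simp; ring
      rw [e3] at hb
      have e4 : ‖A‖ ^ q * ‖B‖ ≤ ‖A‖ ^ q * ‖A‖ := by gcongr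
      nlinarith
  have h3 : ‖B‖ ^ q ≤ ‖A‖ ^ q := Real.rpow_le_rpow hB h hq
  have h4 : ‖A‖ - ‖B‖ ≤ ‖A - B‖ := norm_sub_norm_le A B
  have h5 : ‖A‖ ^ q ≤ (‖A‖ + ‖B‖) ^ q := Real.rpow_le_rpow hA (by linarith) hq
  calc ‖‖A‖ ^ q • A - ‖B‖ ^ q • B‖
      ≤ ‖A‖ ^ q * ‖A - B‖ + (‖A‖ ^ q - ‖B‖ ^ q) * ‖B‖ := by
        rw [h1]
        refine (norm_add_le _ _).trans (le_of_eq ?_)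
        rw [norm_smul, norm_smul, Real.norm_of_nonneg (by positivity),
          Real.norm_of_nonneg (sub_nonneg.2 h3)]
    _ ≤ ‖A‖ ^ q * ‖A - B‖ + (q + 1) * ‖A‖ ^ q * ‖A - B‖ := by
        refine add_le_add le_rfl (h2.trans ?_)
        gcongr
    _ = (q + 2) * ‖A‖ ^ q * ‖A - B‖ := by ring
    _ ≤ _ := by gcongr

theorem isViscousKernel_power {q M : ℝ} (hq : 2 ≤ q) (hM : 0 ≤ M) {β : α → ℝ}
    (hβ : AEStronglyMeasurable β μ) (hb : ∀ᵐ x ∂μ, |β x| ≤ M) :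
    IsViscousKernel μ q (M * q) fun x (A B : E) => β x * ‖A‖ ^ (q - 2) * ⟪A, B⟫ where
  two_le := hq
  nonneg := by positivity
  meas G H hG hH := by
    have h1 : AEStronglyMeasurable (fun x => ‖G x‖ ^ (q - 2)) μ :=
      (hG.norm.aemeasurable.pow_const _).aestronglyMeasurable
    exact (hβ.mul h1).mul (hG.inner hH)
  zero x B := by simp
  add x A B B' := by rw [inner_add_right]; ring
  smul x A c B := by rw [inner_smul_right]; ring
  bound := by
    filter_upwards [hb] with x hx A A' B
    have h1 := norm_rpow_smul_sub_le (q := q - 2) (by linarith) A A'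
    have h2 : β x * ‖A‖ ^ (q - 2) * ⟪A, B⟫ - β x * ‖A'‖ ^ (q - 2) * ⟪A', B⟫ =
        β x * ⟪‖A‖ ^ (q - 2) • A - ‖A'‖ ^ (q - 2) • A', B⟫ := by
      rw [inner_sub_left, real_inner_smul_left, real_inner_smul_left]; ring
    rw [h2, abs_mul]
    calc _ ≤ M * (‖‖A‖ ^ (q - 2) • A - ‖A'‖ ^ (q - 2) • A'‖ * ‖B‖) := by
          gcongr
          exact abs_real_inner_le_norm _ _
      _ ≤ M * ((q - 2 + 2) * (‖A‖ + ‖A'‖) ^ (q - 2) * ‖A - A'‖ * ‖B‖) := by gcongr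
      _ = _ := by ring

end Kernel

theorem isViscousKernel_matrix {α : Type*} [MeasurableSpace α] {μ : Measure α} {N : ℕ} {M : ℝ}
    (hM : 0 ≤ M) {c : α → Matrix (Fin N) (Fin N) ℝ}
    (hc : ∀ i j, AEStronglyMeasurable (fun x => c x i j) μ) (hb : ∀ᵐ x ∂μ, ∀ i j, |c x i j| ≤ M) :
    IsViscousKernel μ 2 (N ^ 3 * M) fun x (A B : Mat N) =>
      ∑ i, ∑ j, ∑ k, c x i j * A (j, k) * B (i, k) where
  two_le := le_rfl
  nonneg := by positivity
  meas G H hG hH := by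
    have hcoord : ∀ {F : α → Mat N}, AEStronglyMeasurable F μ → ∀ ij,
        AEStronglyMeasurable (fun x => F x ij) μ := fun hF ij =>
      (EuclideanSpace.proj (𝕜 := ℝ) ij).continuous.comp_aestronglyMeasurable hF
    refine Finset.aestronglyMeasurable_fun_sum _ fun i _ =>
      Finset.aestronglyMeasurable_fun_sum _ fun j _ =>
      Finset.aestronglyMeasurable_fun_sum _ fun k _ => ?_
    exact ((hc i j).mul (hcoord hG _)).mul (hcoord hH _)
  zero x B := by simp
  add x A B B' := by
    simp only [← Finset.sum_add_distrib, PiLp.add_apply, mul_add]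
  smul x A t B := by
    simp only [Finset.mul_sum, PiLp.smul_apply, smul_eq_mul]
    exact Finset.sum_congr rfl fun i _ => Finset.sum_congr rfl fun j _ =>
      Finset.sum_congr rfl fun k _ => by ring
  bound := by
    filter_upwards [hb] with x hx A A' B
    have h1 : (∑ i, ∑ j, ∑ k, c x i j * A (j, k) * B (i, k)) -
        ∑ i, ∑ j, ∑ k, c x i j * A' (j, k) * B (i, k) =
        ∑ i, ∑ j, ∑ k, c x i j * (A - A') (j, k) * B (i, k) := by
      simp only [← Finset.sum_sub_distrib, PiLp.sub_apply]
      exact Finset.sum_congr rfl fun i _ => Finset.sum_congr rfl fun j _ =>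
        Finset.sum_congr rfl fun k _ => by ring
    rw [h1, sub_self, Real.rpow_zero, one_mul]
    have h2 : ∀ i j k, |c x i j * (A - A') (j, k) * B (i, k)| ≤ M * (‖A - A'‖ * ‖B‖) := by
      intro i j k
      rw [abs_mul, abs_mul, mul_assoc]
      gcongr
      · exact hx i j
      · exact PiLp.norm_apply_le (A - A') (j, k)
      · exact PiLp.norm_apply_le B (i, k)
    calc _ ≤ ∑ i : Fin N, ∑ j : Fin N, ∑ k : Fin N, M * (‖A - A'‖ * ‖B‖) := by
          refine (Finset.abs_sum_le_sum_abs _ _).trans (Finset.sum_le_sum fun i _ => ?_)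
          refine (Finset.abs_sum_le_sum_abs _ _).trans (Finset.sum_le_sum fun j _ => ?_)
          exact (Finset.abs_sum_le_sum_abs _ _).trans (Finset.sum_le_sum fun k _ => h2 i j k)
      _ = _ := by
          simp only [Finset.sum_const, Finset.card_univ, Fintype.card_fin, nsmul_eq_mul]
          ring

/-! ### Gronwall's lemma and the abstract energy estimate -/

/-- The differential form of Gronwall's lemma is applied to the majorant `b + K ∫ y`, which is right
differentiable with derivative `K y`, at most `K` times itself. -/
theorem le_mul_exp_of_le_add_integral {T b K : ℝ} {y : ℝ → ℝ} (hK : 0 ≤ K)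
    (hb : 0 ≤ b) (hy : ContinuousOn y (Icc 0 T))
    (h : ∀ t ∈ Icc 0 T, y t ≤ b + K * ∫ s in (0 : ℝ)..t, y s) :
    ∀ t ∈ Icc 0 T, y t ≤ b * Real.exp (K * T) := by
  intro t ht
  have hT : (0 : ℝ) ≤ T := ht.1.trans ht.2
  have hyi : IntervalIntegrable y volume 0 T := hy.intervalIntegrable_of_Icc hT
  have hsub : ∀ t ∈ Icc 0 T, IntervalIntegrable y volume 0 t := fun t ht =>
    hyi.mono_set (uIcc_subset_uIcc_left (by rwa [uIcc_of_le hT]))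
  set f : ℝ → ℝ := fun t => b + K * ∫ s in (0 : ℝ)..t, y s with hf
  have hd : ∀ x ∈ Ico 0 T, HasDerivWithinAt f (K * y x) (Ici x) x := by
    intro x hx
    have hxI : x ∈ Icc 0 T := Ico_subset_Icc_self hx
    have hmem : Icc 0 T ∈ 𝓝[>] x :=
      mem_of_superset (Ioo_mem_nhdsGT hx.2) fun z hz => ⟨hx.1.trans hz.1.le, hz.2.le⟩
    have h1 : HasDerivWithinAt (fun t => ∫ s in (0 : ℝ)..t, y s) (y x) (Ici x) x := by
      refine intervalIntegral.integral_hasDerivWithinAt_right (hsub x hxI) (t := Ioi x) ?_ ?_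
      · exact ⟨Icc 0 T, hmem, hy.aestronglyMeasurable measurableSet_Icc⟩
      · exact (hy x hxI).mono_of_mem_nhdsWithin hmem
    exact (h1.const_mul K).const_add b
  have hfc : ContinuousOn f (Icc 0 T) := by
    have := intervalIntegral.continuousOn_primitive_interval' hyi left_mem_uIcc
    rw [uIcc_of_le hT] at this
    exact (this.const_mul K).const_add b
  have key := le_gronwallBound_of_liminf_deriv_right_le (f := f) (f' := fun x => K * y x)
    (δ := b) (K := K) (ε := 0) hfc
    (fun x hx r hr => (hd x hx).liminf_right_slope_le hr)
    (by simp [hf]) (fun x hx => by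
      rw [add_zero]
      exact mul_le_mul_of_nonneg_left (h x (Ico_subset_Icc_self hx)) hK) t ht
  rw [gronwallBound_ε0, sub_zero] at key
  refine (h t ht).trans (key.trans ?_)
  gcongr
  exact ht.2

/-- A measurable family of operators `A s` into the dual, demicontinuous and of growth `m`. -/
structure IsDualOperator {V : Type*} [NormedAddCommGroup V] [NormedSpace ℝ V] (μ : Measure ℝ)
    (A : ℝ → V → V → ℝ) (m : V → ℝ) : Prop where
  nonneg : ∀ u, 0 ≤ m u
  linear : ∀ᵐ s ∂μ, ∀ u, ∃ L : V →L[ℝ] ℝ, ∀ v, L v = A s u v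
  bound : ∀ᵐ s ∂μ, ∀ u v, |A s u v| ≤ m u * ‖v‖
  cont : ∀ᵐ s ∂μ, ∀ v, Continuous fun u => A s u v
  meas : ∀ u v, AEStronglyMeasurable (fun s => A s u v) μ

namespace IsDualOperator

variable {V W : Type*} [NormedAddCommGroup V] [NormedSpace ℝ V] [NormedAddCommGroup W]
  [NormedSpace ℝ W] {μ : Measure ℝ} {A A' : ℝ → V → V → ℝ} {m m' : V → ℝ}

theorem add (h : IsDualOperator μ A m) (h' : IsDualOperator μ A' m') :
    IsDualOperator μ (fun s u v => A s u v + A' s u v) (fun u => m u + m' u) where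
  nonneg u := add_nonneg (h.nonneg u) (h'.nonneg u)
  linear := by
    filter_upwards [h.linear, h'.linear] with s hs hs' u
    obtain ⟨L, hL⟩ := hs u
    obtain ⟨L', hL'⟩ := hs' u
    exact ⟨L + L', fun v => by rw [add_apply, hL, hL']⟩
  bound := by
    filter_upwards [h.bound, h'.bound] with s hs hs' u v
    rw [add_mul]
    exact (abs_add_le _ _).trans (add_le_add (hs u v) (hs' u v))
  cont := by
    filter_upwards [h.cont, h'.cont] with s hs hs' v
    exact (hs v).add (hs' v)
  meas u v := (h.meas u v).add (h'.meas u v)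

theorem comp (h : IsDualOperator μ A m) (L : W →L[ℝ] V) {K : ℝ} (hK : 0 ≤ K)
    (hL : ∀ w, ‖L w‖ ≤ K * ‖w‖) :
    IsDualOperator μ (fun s u v => A s (L u) (L v)) (fun u => m (L u) * K) where
  nonneg u := mul_nonneg (h.nonneg _) hK
  linear := by
    filter_upwards [h.linear] with s hs u
    obtain ⟨l, hl⟩ := hs (L u)
    exact ⟨l.comp L, fun v => by rw [ContinuousLinearMap.comp_apply, hl]⟩
  bound := by
    filter_upwards [h.bound] with s hs u v
    rw [mul_assoc]
    exact (hs _ _).trans (mul_le_mul_of_nonneg_left (hL v) (h.nonneg _))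
  cont := by
    filter_upwards [h.cont] with s hs v
    exact (hs (L v)).comp L.continuous
  meas u v := h.meas _ _

theorem congr (h : IsDualOperator μ A m) (hA : ∀ s u v, A' s u v = A s u v) :
    IsDualOperator μ A' m := by
  have : A' = A := funext fun s => funext fun u => funext fun v => hA s u v
  rwa [this]

theorem exists_dual (h : IsDualOperator μ A m) {x : ℝ → V} (hx : AEStronglyMeasurable x μ) :
    ∃ g : ℝ → V →L[ℝ] ℝ, (∀ v, AEStronglyMeasurable (fun s => g s v) μ) ∧
      (∀ᵐ s ∂μ, ‖g s‖ ≤ m (x s)) ∧ ∀ᵐ s ∂μ, ∀ v, g s v = A s (x s) v := by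
  classical
  -- At the exceptional null set of times where `A s (x s)` need not be a continuous linear form,
  -- the value `0` serves as a default.
  let g : ℝ → V →L[ℝ] ℝ := fun s =>
    if hs : ∃ L : V →L[ℝ] ℝ, ∀ v, L v = A s (x s) v then hs.choose else 0
  have hg : ∀ᵐ s ∂μ, ∀ v, g s v = A s (x s) v := by
    filter_upwards [h.linear] with s hs
    have e : g s = (hs (x s)).choose := dif_pos (hs (x s))
    rw [e]
    exact (hs (x s)).choose_spec
  refine ⟨g, fun v => ?_, ?_, hg⟩
  · refine (aestronglyMeasurable_caratheodory_comp (G := fun s u => A s u v) ?_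
      (fun u => h.meas u v) hx).congr ?_
    · filter_upwards [h.cont] with s hs using hs v
    · filter_upwards [hg] with s hs using (hs v).symm
  · filter_upwards [hg, h.bound] with s hs hb
    refine ContinuousLinearMap.opNorm_le_bound _ (h.nonneg _) fun v => ?_
    rw [hs, Real.norm_eq_abs]
    exact hb _ _

variable {H : Type*} [NormedAddCommGroup H] [NormedSpace ℝ H] [CompleteSpace H]
  [TopologicalSpace.SeparableSpace V] {p q : ℝ≥0∞} [ENNReal.HolderConjugate p q]

/-- Existence of a continuous representative, and the energy estimate, for weak solutions of
`B ∂ₜu + A u + D u = F u` with `D` without contribution to the energy balance. -/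
theorem energy_estimate {T c₀ c₁ K : ℝ} {B : H →L[ℝ] H →L[ℝ] ℝ} {ι : V →L[ℝ] H} {u0 : H}
    {x : ℝ → V} {F D : ℝ → V → V → ℝ} {mF mD : V → ℝ} (hT : 0 < T) (hp : p ≠ ⊤) (hq : q ≠ ⊤)
    (hq1 : 1 ≤ q) (hB : ∀ a b, B a b = B b a) (hc₀ : 0 < c₀) (hc : ∀ a, c₀ * ‖a‖ ^ 2 ≤ B a a)
    (hc₁ : ∀ a, B a a ≤ c₁ * ‖a‖ ^ 2) (hι : DenseRange ι)
    (hx : MemLp x p (volume.restrict (Ioo 0 T)))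
    (hF : IsDualOperator (volume.restrict (Ioo 0 T)) F mF)
    (hA : IsDualOperator (volume.restrict (Ioo 0 T)) A m)
    (hD : IsDualOperator (volume.restrict (Ioo 0 T)) D mD)
    (hmF : MemLp (fun s => mF (x s)) q (volume.restrict (Ioo 0 T)))
    (hmA : MemLp (fun s => m (x s)) q (volume.restrict (Ioo 0 T)))
    (hmD : MemLp (fun s => mD (x s)) q (volume.restrict (Ioo 0 T)))
    (hD0 : ∀ s u, D s u u = 0) (hK : 0 ≤ K)
    (hFK : ∀ s u, F s u u ≤ K * (1 + ‖ι u‖ ^ 2))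
    (hA0 : ∀ᵐ s ∂(volume.restrict (Ioo 0 T)), ∀ u, 0 ≤ A s u u)
    (heq : ∀ v, ∀ᵐ t ∂(volume.restrict (Ioo 0 T)),
      B (ι (x t)) (ι v) + ∫ s in (0 : ℝ)..t, (A s (x s) v + D s (x s) v) =
        B u0 (ι v) + ∫ s in (0 : ℝ)..t, F s (x s) v) :
    ∃ w : ℝ → H, ContinuousOn w (Icc 0 T) ∧
      (∀ᵐ t ∂(volume.restrict (Ioo 0 T)), ι (x t) = w t) ∧
      (∀ t ∈ Icc 0 T, ‖w t‖ ^ 2 ≤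
        (c₁ * ‖u0‖ ^ 2 + 2 * K * T) / c₀ * Real.exp (2 * K / c₀ * T)) ∧
      ∫⁻ s in Ioo 0 T, ENNReal.ofReal (A s (x s) (x s)) ≤ ENNReal.ofReal
        (c₁ * ‖u0‖ ^ 2 + K * T * (1 +
          (c₁ * ‖u0‖ ^ 2 + 2 * K * T) / c₀ * Real.exp (2 * K / c₀ * T))) := by
  obtain ⟨gF, gF1, gF2, gF3⟩ := hF.exists_dual hx.1
  obtain ⟨gA, gA1, gA2, gA3⟩ := hA.exists_dual hx.1
  obtain ⟨gD, gD1, gD2, gD3⟩ := hD.exists_dual hx.1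
  have hb0 : 0 ≤ c₁ * ‖u0‖ ^ 2 := le_trans (by positivity) ((hc u0).trans (hc₁ u0))
  set g : ℝ → V →L[ℝ] ℝ := fun s => gF s - (gA s + gD s) with hg
  set M : ℝ → ℝ := fun s => mF (x s) + (m (x s) + mD (x s)) with hM
  have hgm : ∀ v, AEStronglyMeasurable (fun s => g s v) (volume.restrict (Ioo 0 T)) := fun v =>
    (gF1 v).sub ((gA1 v).add (gD1 v))
  have hMq : MemLp M q (volume.restrict (Ioo 0 T)) := hmF.add (hmA.add hmD)
  have hgM : ∀ᵐ s ∂(volume.restrict (Ioo 0 T)), ‖g s‖ ≤ M s := by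
    filter_upwards [gF2, gA2, gD2] with s h1 h2 h3
    exact (norm_sub_le _ _).trans (add_le_add h1 ((norm_add_le _ _).trans (add_le_add h2 h3)))
  have hii : ∀ {G : ℝ → V →L[ℝ] ℝ} {n : V → ℝ} {y : ℝ → V},
      (∀ v, AEStronglyMeasurable (fun s => G s v) (volume.restrict (Ioo 0 T))) →
      (∀ᵐ s ∂(volume.restrict (Ioo 0 T)), ‖G s‖ ≤ n (x s)) →
      MemLp (fun s => n (x s)) q (volume.restrict (Ioo 0 T)) →
      MemLp y p (volume.restrict (Ioo 0 T)) → ∀ t ∈ Icc 0 T,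
      IntervalIntegrable (fun s => G s (y s)) volume 0 t := by
    intro G n y h1 h2 h3 h4 t ht
    rw [intervalIntegrable_iff_integrableOn_Ioo_of_le ht.1]
    exact (integrableOn_dual_apply h1 h3 h2 h4).mono_set (Ioo_subset_Ioo_right ht.2)
  have haet : ∀ {P : ℝ → Prop}, (∀ᵐ s ∂(volume.restrict (Ioo 0 T)), P s) → ∀ t ∈ Icc 0 T,
      ∀ᵐ s ∂(volume.restrict (Ioc 0 t)), P s := by
    intro P hP t ht
    rw [← restrict_Ioo_eq_restrict_Ioc]
    exact ae_mono (Measure.restrict_mono (Ioo_subset_Ioo_right ht.2) le_rfl) hP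
  have hcongr : ∀ {P R : ℝ → ℝ}, (∀ᵐ s ∂(volume.restrict (Ioo 0 T)), P s = R s) →
      ∀ t ∈ Icc 0 T, ∫ s in (0 : ℝ)..t, P s = ∫ s in (0 : ℝ)..t, R s := by
    intro P R hPR t ht
    rw [intervalIntegral.integral_of_le ht.1, intervalIntegral.integral_of_le ht.1]
    exact integral_congr_ae (haet hPR t ht)
  have hev : IsWeakEvolution T B ι u0 x g M p q := by
    refine ⟨hT, hx, hgm, hMq, hgM, ae_forall_weak_equation hgm hq1 hMq hgM fun v => ?_⟩
    filter_upwards [heq v, ae_restrict_mem measurableSet_Ioo] with t ht htT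
    have htT' := Ioo_subset_Icc_self htT
    have e1 := hcongr (P := fun s => A s (x s) v + D s (x s) v) (R := fun s => gA s v + gD s v)
      (by filter_upwards [gA3, gD3] with s h1 h2; rw [h1, h2]) t htT'
    have e2 := hcongr (P := fun s => F s (x s) v) (R := fun s => gF s v)
      (by filter_upwards [gF3] with s h1; rw [h1]) t htT'
    have e3 : ∫ s in (0 : ℝ)..t, g s v =
        (∫ s in (0 : ℝ)..t, gF s v) - ∫ s in (0 : ℝ)..t, (gA s v + gD s v) :=
      intervalIntegral.integral_sub (hii gF1 gF2 hmF (memLp_const v) t htT')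
        ((hii gA1 gA2 hmA (memLp_const v) t htT').add (hii gD1 gD2 hmD (memLp_const v) t htT'))
    rw [e1, e2] at ht
    rw [e3]
    linarith
  obtain ⟨w, hwc, hw, hwe⟩ := hev.exists_continuousOn hp hq hB hc₀ hc hι
  have hwi : ∀ t ∈ Icc 0 T, IntervalIntegrable (fun s => ‖w s‖ ^ 2) volume 0 t := fun t ht =>
    ((hwc.norm.pow 2).mono (Icc_subset_Icc_right ht.2)).intervalIntegrable_of_Icc ht.1
  have hgle : ∀ᵐ s ∂(volume.restrict (Ioo 0 T)), gF s (x s) ≤ K * (1 + ‖w s‖ ^ 2) := by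
    filter_upwards [gF3, hw] with s h1 h2
    rw [h1, ← h2]
    exact hFK _ _
  have hgdec : ∀ᵐ s ∂(volume.restrict (Ioo 0 T)), g s (x s) = gF s (x s) - gA s (x s) := by
    filter_upwards [gD3] with s h1
    simp [hg, h1, hD0]
  have hA0' : ∀ᵐ s ∂(volume.restrict (Ioo 0 T)), 0 ≤ gA s (x s) := by
    filter_upwards [gA3, hA0] with s h1 h2
    rw [h1]
    exact h2 _
  have hyK : ∀ t ∈ Icc 0 T, IntervalIntegrable (fun s => K * (1 + ‖w s‖ ^ 2)) volume 0 t :=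
    fun t ht => ((intervalIntegrable_const (c := (1 : ℝ))).add (hwi t ht)).const_mul K
  have hFint : ∀ t ∈ Icc 0 T, ∫ s in (0 : ℝ)..t, gF s (x s) ≤
      K * t + K * ∫ s in (0 : ℝ)..t, ‖w s‖ ^ 2 := by
    intro t ht
    have h1 : ∫ s in (0 : ℝ)..t, gF s (x s) ≤ ∫ s in (0 : ℝ)..t, K * (1 + ‖w s‖ ^ 2) := by
      refine intervalIntegral.integral_mono_ae_restrict ht.1 (hii gF1 gF2 hmF hx t ht) (hyK t ht) ?_
      rw [← restrict_Ioc_eq_restrict_Icc]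
      exact haet hgle t ht
    refine h1.trans (le_of_eq ?_)
    rw [intervalIntegral.integral_const_mul, intervalIntegral.integral_add intervalIntegrable_const
      (hwi t ht), intervalIntegral.integral_const]
    simp
    ring
  have hsplit : ∀ t ∈ Icc 0 T, ∫ s in (0 : ℝ)..t, g s (x s) =
      (∫ s in (0 : ℝ)..t, gF s (x s)) - ∫ s in (0 : ℝ)..t, gA s (x s) := by
    intro t ht
    rw [hcongr hgdec t ht]
    exact intervalIntegral.integral_sub (hii gF1 gF2 hmF hx t ht) (hii gA1 gA2 hmA hx t ht)
  have hApos : ∀ t ∈ Icc 0 T, 0 ≤ ∫ s in (0 : ℝ)..t, gA s (x s) := fun t ht =>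
    intervalIntegral.integral_nonneg_of_ae_restrict ht.1
      (by rw [← restrict_Ioc_eq_restrict_Icc]; exact haet hA0' t ht)
  -- The energy identity, with the dissipation dropped, gives `c₀‖w t‖² ≤ c₁‖u0‖² + 2KT + 2K ∫
  -- ‖w‖²`, to which Gronwall's lemma applies.
  have hwb : ∀ t ∈ Icc 0 T, ‖w t‖ ^ 2 ≤
      (c₁ * ‖u0‖ ^ 2 + 2 * K * T) / c₀ * Real.exp (2 * K / c₀ * T) := by
    refine le_mul_exp_of_le_add_integral (by positivity) (by positivity) (hwc.norm.pow 2) ?_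
    intro t ht
    have h1 := hwe t ht
    have h2 := hsplit t ht
    have h3 := hFint t ht
    have h4 := hApos t ht
    have h5 := hc (w t)
    have h6 := hc₁ u0
    have h7 : K * t ≤ K * T := mul_le_mul_of_nonneg_left ht.2 hK
    have e : (c₁ * ‖u0‖ ^ 2 + 2 * K * T) / c₀ + 2 * K / c₀ * ∫ s in (0 : ℝ)..t, ‖w s‖ ^ 2 =
        (c₁ * ‖u0‖ ^ 2 + 2 * K * T + 2 * (K * ∫ s in (0 : ℝ)..t, ‖w s‖ ^ 2)) / c₀ := by ring
    change _ ≤ (c₁ * ‖u0‖ ^ 2 + 2 * K * T) / c₀ + 2 * K / c₀ * ∫ s in (0 : ℝ)..t, ‖w s‖ ^ 2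
    rw [e, le_div_iff₀ hc₀]
    linarith
  refine ⟨w, hwc, hw, hwb, ?_⟩
  set C₁ := (c₁ * ‖u0‖ ^ 2 + 2 * K * T) / c₀ * Real.exp (2 * K / c₀ * T) with hC₁
  have hTT : T ∈ Icc 0 T := right_mem_Icc.2 hT.le
  have h1 : ∫⁻ s in Ioo 0 T, ENNReal.ofReal (A s (x s) (x s)) =
      ∫⁻ s in Ioo 0 T, ENNReal.ofReal (gA s (x s)) :=
    lintegral_congr_ae (by filter_upwards [gA3] with s hs; rw [hs])
  rw [h1, ← ofReal_integral_eq_lintegral_ofReal (integrableOn_dual_apply gA1 hmA gA2 hx) hA0',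
    ← integral_Ioc_eq_integral_Ioo, ← intervalIntegral.integral_of_le hT.le]
  refine ENNReal.ofReal_le_ofReal ?_
  have h2 := hsplit T hTT
  have h3 := hFint T hTT
  have h4 := hwe T hTT
  have h5 : 0 ≤ B (w T) (w T) := le_trans (by positivity) (hc (w T))
  have h6 := hc₁ u0
  -- The identity at `T`, now keeping the dissipation: `2 ∫ A ≤ c₁‖u0‖² + 2KT + 2K ∫ ‖w‖²`, with the
  -- last integral bounded by the Gronwall estimate. Halving gives slightly more than is claimed.
  have h7 : ∫ s in (0 : ℝ)..T, ‖w s‖ ^ 2 ≤ C₁ * T := by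
    have := intervalIntegral.integral_mono_on hT.le (hwi T hTT) intervalIntegrable_const hwb
    rw [intervalIntegral.integral_const] at this
    simpa [mul_comm] using this
  have h8 := mul_le_mul_of_nonneg_left h7 hK
  nlinarith

end IsDualOperator

/-! ### Rescaled coefficients -/

section Scaling

theorem quasiMeasurePreserving_smul {E : Type*} [NormedAddCommGroup E] [NormedSpace ℝ E]
    [MeasurableSpace E] [BorelSpace E] [FiniteDimensional ℝ E] (μ : Measure E)
    [μ.IsAddHaarMeasure] {r : ℝ} (hr : r ≠ 0) : Measure.QuasiMeasurePreserving (r • · : E → E) μ μ := by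
  refine ⟨measurable_const_smul r, ?_⟩
  rw [Measure.map_addHaar_smul μ hr]
  exact Measure.smul_absolutelyContinuous

/-- The rescaling `(s, x) ↦ (x / ε, s / ε²)`. -/
noncomputable def rescale {N : ℕ} (ε : ℝ) (z : ℝ × Vec N) : Vec N × ℝ := (ε⁻¹ • z.2, z.1 / ε ^ 2)

theorem quasiMeasurePreserving_rescale {N : ℕ} {ε : ℝ} (hε : 0 < ε) (I : Set ℝ) (Q : Set (Vec N)) :
    Measure.QuasiMeasurePreserving (rescale ε)
      ((volume.restrict I).prod (volume.restrict Q)) (volume : Measure (Vec N × ℝ)) := by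
  have h1 : Measure.QuasiMeasurePreserving (fun x : Vec N => ε⁻¹ • x) (volume.restrict Q) volume :=
    (quasiMeasurePreserving_smul volume (inv_ne_zero hε.ne')).mono_left
      Measure.absolutelyContinuous_restrict
  have h2 : Measure.QuasiMeasurePreserving (fun s : ℝ => s / ε ^ 2) (volume.restrict I) volume := by
    have := (quasiMeasurePreserving_smul (volume : Measure ℝ)
      (inv_ne_zero (pow_ne_zero 2 hε.ne'))).mono_left
      (Measure.absolutelyContinuous_restrict (s := I))
    convert this using 2 with s
    rw [smul_eq_mul, div_eq_inv_mul]
  exact (MeasureTheory.QuasiMeasurePreserving.prodMap h1 h2).comp Measure.measurePreserving_swap.quasiMeasurePreserving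

variable {N : ℕ} {ε : ℝ} {I : Set ℝ} {Q : Set (Vec N)}

/-- Source of the uniformity in `ε`: dilations pull null sets back to null sets, so a.e. bounds on
the coefficients persist with the same constants on a.e. time slice. -/
theorem ae_ae_rescale (hε : 0 < ε) {P : Vec N × ℝ → Prop} (h : ∀ᵐ z, P z) :
    ∀ᵐ s ∂(volume.restrict I), ∀ᵐ x ∂(volume.restrict Q), P (ε⁻¹ • x, s / ε ^ 2) :=
  Measure.ae_ae_of_ae_prod ((quasiMeasurePreserving_rescale hε I Q).ae h)

theorem aestronglyMeasurable_rescale (hε : 0 < ε) {c : Vec N × ℝ → ℝ}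
    (hc : AEStronglyMeasurable c volume) : AEStronglyMeasurable
      (fun z : ℝ × Vec N => c (rescale ε z)) ((volume.restrict I).prod (volume.restrict Q)) :=
  hc.comp_quasiMeasurePreserving (quasiMeasurePreserving_rescale hε I Q)

theorem ae_aestronglyMeasurable_rescale (hε : 0 < ε) {c : Vec N × ℝ → ℝ}
    (hc : AEStronglyMeasurable c volume) : ∀ᵐ s ∂(volume.restrict I),
      AEStronglyMeasurable (fun x => c (ε⁻¹ • x, s / ε ^ 2)) (volume.restrict Q) :=
  (aestronglyMeasurable_rescale hε hc).prodMk_left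

end Scaling

/-! ### Operators from kernels and forces, and the weighted inner product -/

theorem isDualOperator_kernel {α E : Type*} [MeasurableSpace α] {ν : Measure α} [SFinite ν]
    {μ : Measure ℝ} [SFinite μ]
    [NormedAddCommGroup E] [InnerProductSpace ℝ E] {q M : ℝ} {P : ℝ≥0∞} [Fact (1 ≤ P)]
    (hP : P = ENNReal.ofReal q) (hM : 0 ≤ M) {k : ℝ → α → E → E → ℝ}
    (hk : ∀ᵐ s ∂μ, IsViscousKernel ν q M (k s))
    (hm : ∀ G H : α → E, AEStronglyMeasurable G ν → AEStronglyMeasurable H ν →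
      AEStronglyMeasurable (fun z : ℝ × α => k z.1 z.2 (G z.2) (H z.2)) (μ.prod ν)) :
    IsDualOperator μ (fun s (G H : Lp E P ν) => ∫ x, k s x (G x) (H x) ∂ν)
      (fun G => M * (1 + ‖G‖ ^ (q - 1))) where
  nonneg G := by positivity
  linear := by
    filter_upwards [hk] with s hs G
    exact hs.exists_clm hP G
  bound := by
    filter_upwards [hk] with s hs G H
    refine (hs.abs_integral_le hP G H).trans ?_
    gcongr
    linarith
  cont := by
    filter_upwards [hk] with s hs H
    exact hs.continuous_integral hP H
  meas G H := (hm G H (Lp.aestronglyMeasurable G) (Lp.aestronglyMeasurable H)).integral_prod_right'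

/-- The exponent in `‖a‖ ^ (1 : ℝ)` is kept so that the force has the shape expected by
`IsDualOperator.exists_comp_growth`. -/
theorem isDualOperator_of_continuous {H : Type*} [NormedAddCommGroup H] [NormedSpace ℝ H]
    {μ : Measure ℝ} {Φ : ℝ × H → H} (hΦ : Continuous Φ) {K Λ : ℝ} (hK : 0 ≤ K) (hΛ : 0 ≤ Λ)
    (hb : ∀ τ h, ‖Φ (τ, h)‖ ≤ K * (1 + ‖h‖)) (B : H →L[ℝ] H →L[ℝ] ℝ)
    (hB : ∀ a b, |B a b| ≤ Λ * ‖a‖ * ‖b‖) (c : ℝ) :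
    IsDualOperator μ (fun s a b => B (Φ (s / c, a)) b) (fun a => Λ * K * (1 + ‖a‖ ^ (1 : ℝ))) where
  nonneg a := by positivity
  linear := Eventually.of_forall fun s a => ⟨B (Φ (s / c, a)), fun _ => rfl⟩
  bound := Eventually.of_forall fun s a b => (hB _ _).trans (by
    rw [Real.rpow_one, mul_assoc Λ K]
    gcongr
    exact hb _ _)
  cont := Eventually.of_forall fun s b => by fun_prop
  meas a b := by
    have : Continuous fun s : ℝ => B (Φ (s / c, a)) b := by fun_prop
    exact this.aestronglyMeasurable

/-- Multiplication by `β ∈ L^∞` is a bounded operator on `L²`, and `B` is its quadratic form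
restricted to `H`. With `β = ρ^ε`, `B` depends on `ε` but the bounds `Λ⁻¹` and `Λ` do not. -/
theorem exists_weighted_inner {α E : Type*} [MeasurableSpace α] {μ : Measure α}
    [NormedAddCommGroup E] [InnerProductSpace ℝ E] (H : Submodule ℝ (Lp E 2 μ)) {β : α → ℝ} {Λ : ℝ}
    (hΛ : 0 < Λ) (hβ : AEStronglyMeasurable β μ) (hb : ∀ᵐ x ∂μ, Λ⁻¹ ≤ β x ∧ β x ≤ Λ) :
    ∃ B : H →L[ℝ] H →L[ℝ] ℝ, (∀ h k : H, B h k = ∫ x, β x * ⟪h.1 x, k.1 x⟫ ∂μ) ∧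
      (∀ h k, B h k = B k h) ∧ (∀ h, Λ⁻¹ * ‖h‖ ^ 2 ≤ B h h) ∧
      ∀ h k, |B h k| ≤ Λ * ‖h‖ * ‖k‖ := by
  have habs : ∀ᵐ x ∂μ, |β x| ≤ Λ := by
    filter_upwards [hb] with x hx
    rw [abs_of_nonneg ((inv_nonneg.2 hΛ.le).trans hx.1)]
    exact hx.2
  have hm : MemLp β ⊤ μ := memLp_top_of_bound hβ Λ habs
  let Mβ : Lp E 2 μ →L[ℝ] Lp E 2 μ := (ContinuousLinearMap.lsmul ℝ ℝ).holderL μ ⊤ 2 2 (hm.toLp β)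
  have hMβ : ∀ h : Lp E 2 μ, Mβ h =ᵐ[μ] fun x => β x • h x := by
    intro h
    filter_upwards [(ContinuousLinearMap.lsmul ℝ ℝ).coeFn_holder (r := 2) (hm.toLp β) h,
      hm.coeFn_toLp] with x h1 h2
    change ((ContinuousLinearMap.lsmul ℝ ℝ).holder 2 (hm.toLp β) h) x = _
    rw [h1, h2]
    rfl
  let B : H →L[ℝ] H →L[ℝ] ℝ :=
    ((innerSL ℝ (E := Lp E 2 μ)).comp Mβ).bilinearComp H.subtypeL H.subtypeL
  have hBdef : ∀ h k : H, B h k = ⟪Mβ h.1, k.1⟫ := fun h k => rfl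
  have hB : ∀ h k : H, B h k = ∫ x, β x * ⟪h.1 x, k.1 x⟫ ∂μ := by
    intro h k
    rw [hBdef, L2.inner_def]
    refine integral_congr_ae ?_
    filter_upwards [hMβ h.1] with x hx
    rw [hx, real_inner_smul_left]
  have hi : ∀ h k : H, Integrable (fun x => β x * ⟪h.1 x, k.1 x⟫) μ := by
    intro h k
    refine (L2.integrable_inner (𝕜 := ℝ) (Mβ h.1) k.1).congr ?_
    filter_upwards [hMβ h.1] with x hx
    rw [hx, real_inner_smul_left]
  refine ⟨B, hB, fun h k => ?_, fun h => ?_, fun h k => ?_⟩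
  · simp only [hB, real_inner_comm]
  · have e : ‖h‖ ^ 2 = ∫ x, ⟪h.1 x, h.1 x⟫ ∂μ := by
      rw [← L2.inner_def (𝕜 := ℝ), real_inner_self_eq_norm_sq]
      rfl
    rw [e, hB, ← integral_const_mul]
    refine integral_mono_ae ((L2.integrable_inner (𝕜 := ℝ) h.1 h.1).const_mul _) (hi h h) ?_
    filter_upwards [hb] with x hx
    exact mul_le_mul_of_nonneg_right hx.1 real_inner_self_nonneg
  · have h1 : ‖Mβ h.1‖ ≤ Λ * ‖h.1‖ := by
      refine Lp.norm_le_mul_norm_of_ae_le_mul ?_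
      filter_upwards [hMβ h.1, habs] with x h1 h2
      rw [h1, norm_smul]
      exact mul_le_mul_of_nonneg_right h2 (norm_nonneg _)
    rw [hBdef]
    exact (abs_real_inner_le_norm _ _).trans (mul_le_mul_of_nonneg_right h1 (norm_nonneg _))

/-! ### Growth conditions and integrability in time -/

section Growth

theorem rpow_le_one_add_rpow {t e e' : ℝ} (ht : 0 ≤ t) (he : 0 ≤ e) (hee : e ≤ e') :
    t ^ e ≤ 1 + t ^ e' := by
  rcases le_total t 1 with h | h
  · have := Real.rpow_le_one ht h he
    have := Real.rpow_nonneg ht e'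
    linarith
  · have := Real.rpow_le_rpow_of_exponent_le h hee
    linarith

variable {V W : Type*} [NormedAddCommGroup V] [NormedSpace ℝ V] [NormedAddCommGroup W]
  [NormedSpace ℝ W] {μ : Measure ℝ}

/-- Brings the matrix part and the force (growth `1`) and the power part (growth `p - 1`), living on
different spaces, to operators on `𝕍` with the common growth `p - 1`. -/
theorem IsDualOperator.exists_comp_growth {A : ℝ → V → V → ℝ} {M e e' : ℝ}
    (h : IsDualOperator μ A fun v => M * (1 + ‖v‖ ^ e)) (hM : 0 ≤ M) (he : 0 ≤ e) (hee : e ≤ e')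
    (L : W →L[ℝ] V) : ∃ K : ℝ, 0 ≤ K ∧
      IsDualOperator μ (fun s u v => A s (L u) (L v)) fun w => K * (1 + ‖w‖ ^ e') := by
  have h1 := h.comp L (norm_nonneg L) L.le_opNorm
  have hl := norm_nonneg L
  refine ⟨M * (1 + 1 * ‖L‖ ^ e) * ‖L‖ + M * ‖L‖ ^ e * ‖L‖, by positivity,
    fun w => by positivity, h1.linear, ?_, h1.cont, h1.meas⟩
  filter_upwards [h1.bound] with s hs u v
  refine (hs u v).trans (mul_le_mul_of_nonneg_right ?_ (norm_nonneg v))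
  have h2 : ‖L u‖ ^ e ≤ ‖L‖ ^ e * (1 + ‖u‖ ^ e') := by
    refine (Real.rpow_le_rpow (norm_nonneg _) (L.le_opNorm u) he).trans ?_
    rw [Real.mul_rpow hl (norm_nonneg _)]
    exact mul_le_mul_of_nonneg_left (rpow_le_one_add_rpow (norm_nonneg _) he hee) (by positivity)
  have h3 : 0 ≤ ‖u‖ ^ e' := by positivity
  have h4 : 0 ≤ ‖L‖ ^ e := by positivity
  calc M * (1 + ‖L u‖ ^ e) * ‖L‖ ≤ M * (1 + ‖L‖ ^ e * (1 + ‖u‖ ^ e')) * ‖L‖ := by gcongr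
    _ ≤ M * (1 + ‖L‖ ^ e * (1 + ‖u‖ ^ e')) * ‖L‖ +
        (M * ‖u‖ ^ e' * ‖L‖ + M * ‖L‖ ^ e * ‖L‖ * (1 + ‖u‖ ^ e')) := by
        have : 0 ≤ M * ‖u‖ ^ e' * ‖L‖ + M * ‖L‖ ^ e * ‖L‖ * (1 + ‖u‖ ^ e') := by positivity
        linarith
    _ = _ := by ring

theorem IsDualOperator.add_growth {A A' : ℝ → V → V → ℝ} {K K' e : ℝ}
    (h : IsDualOperator μ A fun v => K * (1 + ‖v‖ ^ e))
    (h' : IsDualOperator μ A' fun v => K' * (1 + ‖v‖ ^ e)) :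
    IsDualOperator μ (fun s u v => A s u v + A' s u v) fun v => (K + K') * (1 + ‖v‖ ^ e) := by
  have := h.add h'
  simp only [← add_mul] at this
  exact this

theorem memLp_growth [IsFiniteMeasure μ] {p : ℝ} (hp : 1 < p) {x : ℝ → V}
    (hx : MemLp x (ENNReal.ofReal p) μ) (K : ℝ) :
    MemLp (fun s => K * (1 + ‖x s‖ ^ (p - 1))) (ENNReal.ofReal (p / (p - 1))) μ := by
  have h1 := hx.norm_rpow_div (ENNReal.ofReal (p - 1))
  rw [ENNReal.toReal_ofReal (by linarith), ← ENNReal.ofReal_div_of_pos (by linarith)] at h1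
  exact ((memLp_const (1 : ℝ)).add h1).const_mul K

/-- With `‖ι (x s)‖` bounded, interpolation gives `‖e (x s)‖² ≲ ‖d (x s)‖^{2p₀/r}`, and `2p₀/r = p₀
- 1 ≤ p - 1`. Thus the dual norm of convection is dominated by `1 + ‖x‖^{p-1}`, which lies in
`L^{p/(p-1)}`. -/
theorem memLp_mul_of_interpolation {R D H : Type*} [NormedAddCommGroup R] [NormedSpace ℝ R]
    [NormedAddCommGroup D] [NormedSpace ℝ D] [NormedAddCommGroup H] [NormedSpace ℝ H]
    [IsFiniteMeasure μ] {p p₀ r α C K w : ℝ} (hp₀ : 2 ≤ p₀) (hpp : p₀ ≤ p) (hr : 0 < r)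
    (hpr : 1 / p₀ + 2 / r = 1) (hα : 0 ≤ α) (hC : 0 ≤ C) (hK : 0 ≤ K)
    (ι : V →L[ℝ] H) (e : V →L[ℝ] R) (d : V →L[ℝ] D)
    (h : ∀ v, ‖e v‖ ^ r ≤ C * ((‖ι v‖ ^ (2 : ℝ)) ^ α * ‖d v‖ ^ p₀)) {x : ℝ → V}
    (hx : MemLp x (ENNReal.ofReal p) μ) (hw : ∀ᵐ s ∂μ, ‖ι (x s)‖ ≤ w) :
    MemLp (fun s => K * ‖e (x s)‖ * ‖e (x s)‖) (ENNReal.ofReal (p / (p - 1))) μ := by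
  have hd := norm_nonneg d
  have hm : AEStronglyMeasurable (fun s => ‖e (x s)‖) μ :=
    (e.continuous.comp_aestronglyMeasurable hx.1).norm
  refine (memLp_growth (by linarith) hx
    (K * ((C * (w ^ (2 : ℝ)) ^ α) ^ (2 / r) * ‖d‖ ^ (p₀ - 1)))).of_le
    ((hm.const_mul K).mul hm) ?_
  filter_upwards [hw] with s hs
  have hw0 : 0 ≤ w := (norm_nonneg _).trans hs
  have h1 : ‖e (x s)‖ ^ r ≤ C * (w ^ (2 : ℝ)) ^ α * (‖d‖ * ‖x s‖) ^ p₀ := by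
    refine (h (x s)).trans ?_
    rw [mul_assoc]
    gcongr
    exact d.le_opNorm _
  have h2 : ‖e (x s)‖ * ‖e (x s)‖ = (‖e (x s)‖ ^ r) ^ (2 / r) := by
    rw [← Real.rpow_mul (norm_nonneg _), mul_div_cancel₀ _ hr.ne', Real.rpow_two, sq]
  have h3 : p₀ * (2 / r) = p₀ - 1 := by
    have : 2 / r = 1 - 1 / p₀ := by linarith
    rw [this, mul_sub, mul_one, mul_one_div_cancel (by linarith)]
  have h4 : ((‖d‖ * ‖x s‖) ^ p₀) ^ (2 / r) ≤ ‖d‖ ^ (p₀ - 1) * (1 + ‖x s‖ ^ (p - 1)) := by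
    rw [← Real.rpow_mul (by positivity), h3, Real.mul_rpow hd (norm_nonneg _)]
    exact mul_le_mul_of_nonneg_left
      (rpow_le_one_add_rpow (norm_nonneg _) (by linarith) (by linarith)) (by positivity)
  have h5 : ‖e (x s)‖ * ‖e (x s)‖ ≤
      (C * (w ^ (2 : ℝ)) ^ α) ^ (2 / r) * (‖d‖ ^ (p₀ - 1) * (1 + ‖x s‖ ^ (p - 1))) := by
    rw [h2]
    refine (Real.rpow_le_rpow (by positivity) h1 (by positivity)).trans ?_
    rw [Real.mul_rpow (by positivity) (by positivity)]
    exact mul_le_mul_of_nonneg_left h4 (by positivity)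
  rw [Real.norm_of_nonneg (by positivity), Real.norm_of_nonneg (by positivity), mul_assoc]
  calc _ ≤ K * ((C * (w ^ (2 : ℝ)) ^ α) ^ (2 / r) * (‖d‖ ^ (p₀ - 1) * (1 + ‖x s‖ ^ (p - 1)))) :=
        mul_le_mul_of_nonneg_left h5 hK
    _ = _ := by ring

end Growth

theorem mul_eLpNorm_rpow_le_ofReal_integral {α E : Type*} [MeasurableSpace α] {μ : Measure α}
    [NormedAddCommGroup E] {k : α → ℝ} {q c : ℝ} {G : α → E} (hq : 0 < q) (hc : 0 ≤ c)
    (hk : Integrable k μ) (h : ∀ᵐ x ∂μ, c * ‖G x‖ ^ q ≤ k x) :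
    0 ≤ ∫ x, k x ∂μ ∧
      ENNReal.ofReal c * eLpNorm G (ENNReal.ofReal q) μ ^ q ≤ ENNReal.ofReal (∫ x, k x ∂μ) := by
  have h0 : 0 ≤ᵐ[μ] k := by
    filter_upwards [h] with x hx
    exact le_trans (by positivity) hx
  refine ⟨integral_nonneg_of_ae h0, ?_⟩
  rw [ofReal_integral_eq_lintegral_ofReal hk h0, eLpNorm_ofReal_rpow hq,
    ← lintegral_const_mul' _ _ ENNReal.ofReal_ne_top]
  refine lintegral_mono_ae ?_
  filter_upwards [h] with x hx
  rw [← ofReal_norm, ENNReal.ofReal_rpow_of_nonneg (norm_nonneg _) hq.le, ← ENNReal.ofReal_mul hc]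
  exact ENNReal.ofReal_le_ofReal hx

theorem exists_ae_abs_le {α : Type*} [MeasurableSpace α] {μ : Measure α} {c : α → ℝ}
    (hc : MemLp c ⊤ μ) : ∃ M : ℝ, 0 ≤ M ∧ ∀ᵐ x ∂μ, |c x| ≤ M := by
  refine ⟨(eLpNorm c ⊤ μ).toReal, ENNReal.toReal_nonneg, ?_⟩
  have h := ae_le_eLpNormEssSup (f := c) (μ := μ)
  filter_upwards [h] with x hx
  rw [← Real.norm_eq_abs, ← ENNReal.ofReal_le_iff_le_toReal hc.2.ne, ofReal_norm, eLpNorm_exponent_top]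
  exact hx

/-! ### The viscous form: growth and coercivity -/

section Viscous

variable {N : ℕ} {Q : Set (Vec N)} {p : ℝ} [Fact (1 ≤ ENNReal.ofReal p)]

instance : SecondCountableTopology (SpaceV Q p) := by
  have : Fact (ENNReal.ofReal p ≠ ⊤) := ⟨ENNReal.ofReal_ne_top⟩
  have h1 : SecondCountableTopology (Lp (Vec N) (ENNReal.ofReal p) (volume.restrict Q)) :=
    Lp.SecondCountableTopology
  have h2 : SecondCountableTopology (Lp (Mat N) (ENNReal.ofReal p) (volume.restrict Q)) :=
    Lp.SecondCountableTopology
  have h3 := @TopologicalSpace.instSecondCountableTopologyProd _ _ _ _ h1 h2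
  exact TopologicalSpace.Subtype.secondCountableTopology _

instance : CompleteSpace (SpaceH Q) :=
  (Submodule.isClosed_topologicalClosure _).completeSpace_coe

section Matrix

theorem sum_mul_mul_eq (c : Matrix (Fin N) (Fin N) ℝ) (A : Mat N) :
    ∑ i, ∑ j, ∑ k, c i j * A (j, k) * A (i, k) =
      ∑ k, ∑ i, ∑ j, c i j * A (j, k) * A (i, k) := by
  rw [Finset.sum_comm' (s := Finset.univ) (t := fun _ => Finset.univ) (t' := Finset.univ)
    (s' := fun _ => Finset.univ) (by simp)]
  rw [Finset.sum_congr rfl fun j _ => Finset.sum_comm, Finset.sum_comm]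
  exact Finset.sum_congr rfl fun k _ => Finset.sum_comm

/-- Coercivity on vectors is applied to each column `A (·, k)`, the gradient of the `k`-th
component, and summed. -/
theorem mul_norm_rpow_two_le {c : Matrix (Fin N) (Fin N) ℝ} {ν₀ : ℝ}
    (h : ∀ ξ : Vec N, ν₀ * ‖ξ‖ ^ 2 ≤ ∑ i, ∑ j, c i j * ξ j * ξ i) (A : Mat N) :
    ν₀ * ‖A‖ ^ (2 : ℝ) ≤ ∑ i, ∑ j, ∑ k, c i j * A (j, k) * A (i, k) := by
  rw [sum_mul_mul_eq, Real.rpow_two, EuclideanSpace.norm_sq_eq, Fintype.sum_prod_type_right,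
    Finset.mul_sum]
  refine Finset.sum_le_sum fun k _ => ?_
  have := h (WithLp.toLp 2 fun i => A (i, k))
  rw [EuclideanSpace.norm_sq_eq] at this
  exact this

end Matrix

variable [IsFiniteMeasure (volume.restrict Q)]

/-- The gradient of an element of `𝕍`, as a continuous linear map into `L²`. -/
noncomputable def gradL2 (hp : 2 ≤ p) : SpaceV Q p →L[ℝ] Lp (Mat N) 2 (volume.restrict Q) :=
  (lpIncl (Mat N) (volume.restrict Q) (two_le_ofReal hp)).comp gradLp

theorem coeFn_gradL2 (hp : 2 ≤ p) (v : SpaceV Q p) :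
    gradL2 hp v =ᵐ[volume.restrict Q] SpaceV.grad v :=
  coeFn_lpIncl (two_le_ofReal hp) (gradLp v)

variable {a : Vec N × ℝ → Matrix (Fin N) (Fin N) ℝ} {b : Vec N × ℝ → ℝ}

theorem viscousForm_eq (hp : 2 ≤ p) (ε s : ℝ) (u v : SpaceV Q p) :
    viscousForm a b ε s u v =
      (∫ x in Q, ∑ i, ∑ j, ∑ k,
        a (ε⁻¹ • x, s / ε ^ 2) i j * gradL2 hp u x (j, k) * gradL2 hp v x (i, k)) +
      ∫ x in Q, b (ε⁻¹ • x, s / ε ^ 2) * ‖gradLp u x‖ ^ (p - 2) * ⟪gradLp u x, gradLp v x⟫ := by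
  refine congrArg₂ (· + ·) (integral_congr_ae ?_) rfl
  filter_upwards [coeFn_gradL2 hp u, coeFn_gradL2 hp v] with x hu hv
  rw [hu, hv]

theorem ofReal_two_eq : (2 : ℝ≥0∞) = ENNReal.ofReal 2 := (ENNReal.ofReal_ofNat 2).symm

/-- The matrix part of the viscous form, on `L²`. -/
theorem exists_isViscousKernel_matrix {ε : ℝ} (hε : 0 < ε) (I : Set ℝ) (Q : Set (Vec N))
    (ha : AssumptionA1 a) : ∃ M : ℝ, 0 ≤ M ∧ ∀ᵐ s ∂(volume.restrict I),
      IsViscousKernel (volume.restrict Q) 2 M fun x (A B : Mat N) =>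
        ∑ i, ∑ j, ∑ k, a (ε⁻¹ • x, s / ε ^ 2) i j * A (j, k) * B (i, k) := by
  choose M hM0 hM using fun ij : Fin N × Fin N => exists_ae_abs_le (ha.bounded ij.1 ij.2)
  have hs : 0 ≤ ∑ ij, M ij := Finset.sum_nonneg fun ij _ => hM0 ij
  refine ⟨N ^ 3 * ∑ ij, M ij, by positivity, ?_⟩
  have hb : ∀ᵐ z, ∀ i j, |a z i j| ≤ ∑ ij, M ij := by
    filter_upwards [ae_all_iff.2 hM] with z hz i j
    exact (hz (i, j)).trans (Finset.single_le_sum (fun ij _ => hM0 ij) (Finset.mem_univ (i, j)))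
  have hmeas : ∀ᵐ s ∂(volume.restrict I), ∀ ij : Fin N × Fin N, AEStronglyMeasurable
      (fun x => a (ε⁻¹ • x, s / ε ^ 2) ij.1 ij.2) (volume.restrict Q) :=
    ae_all_iff.2 fun ij => ae_aestronglyMeasurable_rescale hε (ha.bounded ij.1 ij.2).1
  filter_upwards [ae_ae_rescale (Q := Q) hε hb, hmeas] with s h1 h2
  exact isViscousKernel_matrix hs (fun i j => h2 (i, j)) h1

theorem AssumptionA2.exists_isViscousKernel {ε : ℝ} (hε : 0 < ε) (I : Set ℝ) (Q : Set (Vec N))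
    (hp : 2 ≤ p) (hb : AssumptionA2 b) : ∃ M : ℝ, 0 ≤ M ∧ ∀ᵐ s ∂(volume.restrict I),
      IsViscousKernel (volume.restrict Q) p M fun x (A B : Mat N) =>
        b (ε⁻¹ • x, s / ε ^ 2) * ‖A‖ ^ (p - 2) * ⟪A, B⟫ := by
  obtain ⟨M, hM0, hM⟩ := exists_ae_abs_le hb.bounded
  refine ⟨M * p, by positivity, ?_⟩
  filter_upwards [ae_ae_rescale (Q := Q) hε hM, ae_aestronglyMeasurable_rescale hε hb.bounded.1]
    with s h1 h2
  exact isViscousKernel_power hp hM0 h2 h1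

theorem isDualOperator_viscousForm {ε : ℝ} (hε : 0 < ε) (I : Set ℝ) (hp : 2 ≤ p)
    (ha : AssumptionA1 a) (hb : AssumptionA2 b) : ∃ K : ℝ,
      IsDualOperator (volume.restrict I)
        (viscousForm a b ε : ℝ → SpaceV Q p → SpaceV Q p → ℝ)
        fun u => K * (1 + ‖u‖ ^ (p - 1)) := by
  obtain ⟨M, hM0, hM⟩ := exists_isViscousKernel_matrix hε I Q ha
  obtain ⟨M', hM0', hM'⟩ := hb.exists_isViscousKernel hε I Q hp
  have hcoord : ∀ {F : Vec N → Mat N}, AEStronglyMeasurable F (volume.restrict Q) → ∀ ij,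
      AEStronglyMeasurable (fun x => F x ij) (volume.restrict Q) := fun hF ij =>
    (EuclideanSpace.proj (𝕜 := ℝ) ij).continuous.comp_aestronglyMeasurable hF
  have h1 := isDualOperator_kernel (P := 2) ofReal_two_eq hM0 hM fun G H hG hH =>
    Finset.aestronglyMeasurable_fun_sum _ fun i _ =>
      Finset.aestronglyMeasurable_fun_sum _ fun j _ =>
      Finset.aestronglyMeasurable_fun_sum _ fun k _ =>
      ((aestronglyMeasurable_rescale hε (ha.bounded i j).1).mul (hcoord hG (j, k)).comp_snd).mul
        (hcoord hH (i, k)).comp_snd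
  have h2 := isDualOperator_kernel (P := ENNReal.ofReal p) rfl hM0' hM' fun G H hG hH => by
    have hn : AEStronglyMeasurable (fun x => ‖G x‖ ^ (p - 2)) (volume.restrict Q) :=
      (hG.norm.aemeasurable.pow_const _).aestronglyMeasurable
    exact ((aestronglyMeasurable_rescale hε hb.bounded.1).mul hn.comp_snd).mul
      (hG.inner hH).comp_snd
  obtain ⟨K, hK, h1'⟩ := h1.exists_comp_growth hM0 (e' := p - 1) (by norm_num) (by linarith)
    (gradL2 (Q := Q) hp)
  obtain ⟨K', hK', h2'⟩ := h2.exists_comp_growth hM0' (e' := p - 1) (by linarith) le_rfl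
    (gradLp (Q := Q))
  exact ⟨K + K', (h1'.add_growth h2').congr fun s u v => viscousForm_eq hp ε s u v⟩

theorem IsViscousKernel.coercive {α E : Type*} [MeasurableSpace α] {μ : Measure α}
    [NormedAddCommGroup E] [InnerProductSpace ℝ E] {q M c : ℝ} {k : α → E → E → ℝ} {P : ℝ≥0∞}
    [Fact (1 ≤ P)] (hk : IsViscousKernel μ q M k) (hP : P = ENNReal.ofReal q) (hc : 0 ≤ c)
    (h : ∀ᵐ x ∂μ, ∀ A, c * ‖A‖ ^ q ≤ k x A A) (G : Lp E P μ) :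
    0 ≤ ∫ x, k x (G x) (G x) ∂μ ∧
      ENNReal.ofReal c * eLpNorm G P μ ^ q ≤ ENNReal.ofReal (∫ x, k x (G x) (G x) ∂μ) := by
  have hi := hk.integrable hP G G
  subst hP
  refine mul_eLpNorm_rpow_le_ofReal_integral (by linarith [hk.two_le]) hc hi ?_
  filter_upwards [h] with x hx
  exact hx _

theorem le_ofReal_of_eq_add {V X Y : ℝ} {A B : ℝ≥0∞} (e : V = X + Y) (hX : 0 ≤ X)
    (hA : A ≤ ENNReal.ofReal X) (hY : 0 ≤ Y) (hB : B ≤ ENNReal.ofReal Y) :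
    0 ≤ V ∧ A ≤ ENNReal.ofReal V ∧ B ≤ ENNReal.ofReal V := by
  subst e
  exact ⟨add_nonneg hX hY, hA.trans (ENNReal.ofReal_le_ofReal (le_add_of_nonneg_right hY)),
    hB.trans (ENNReal.ofReal_le_ofReal (le_add_of_nonneg_left hX))⟩

theorem mul_norm_rpow_le {E : Type*} [NormedAddCommGroup E] [InnerProductSpace ℝ E] {β c : ℝ}
    (hp : 2 ≤ p) (h : c ≤ β) (A : E) : c * ‖A‖ ^ p ≤ β * ‖A‖ ^ (p - 2) * ⟪A, A⟫ := by
  have e : ‖A‖ ^ p = ‖A‖ ^ (p - 2) * ‖A‖ ^ 2 := by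
    rw [← Real.rpow_two, ← Real.rpow_add_of_nonneg (norm_nonneg _) (by linarith) zero_le_two,
      sub_add_cancel]
  rw [e, real_inner_self_eq_norm_sq, mul_assoc]
  exact mul_le_mul_of_nonneg_right h (by positivity)

/-- Both parts are nonnegative, so their sum dominates each lower bound separately. The exceptional
times depend on the coefficients only, hence the statement holds for all `u` simultaneously. -/
theorem viscousForm_coercive {ε ν₀ ν₁ : ℝ} (hε : 0 < ε) (I : Set ℝ) (hp : 2 ≤ p)
    (ha : AssumptionA1 a) (hb : AssumptionA2 b) (hν₀ : 0 ≤ ν₀) (hν₁ : 0 ≤ ν₁)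
    (ha₀ : ∀ᵐ z, ∀ ξ : Vec N, ν₀ * ‖ξ‖ ^ 2 ≤ ∑ i, ∑ j, a z i j * ξ j * ξ i)
    (hb₁ : ∀ᵐ z, ν₁ ≤ b z) : ∀ᵐ s ∂(volume.restrict I), ∀ u : SpaceV Q p,
      0 ≤ viscousForm a b ε s u u ∧
      ENNReal.ofReal ν₀ * eLpNorm (SpaceV.grad u) 2 (volume.restrict Q) ^ 2 ≤
        ENNReal.ofReal (viscousForm a b ε s u u) ∧
      ENNReal.ofReal ν₁ * eLpNorm (SpaceV.grad u) (ENNReal.ofReal p) (volume.restrict Q) ^ p ≤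
        ENNReal.ofReal (viscousForm a b ε s u u) := by
  obtain ⟨M, hM0, hM⟩ := exists_isViscousKernel_matrix hε I Q ha
  obtain ⟨M', hM0', hM'⟩ := hb.exists_isViscousKernel hε I Q hp
  filter_upwards [hM, hM', ae_ae_rescale (Q := Q) hε ha₀, ae_ae_rescale (Q := Q) hε hb₁]
    with s h1 h2 h3 h4 u
  have k1 := h1.coercive ofReal_two_eq hν₀ (h3.mono fun x hx A => mul_norm_rpow_two_le hx A)
    (gradL2 hp u)
  have k2 := h2.coercive rfl hν₁ (h4.mono fun x hx A => mul_norm_rpow_le hp hx A) (gradLp u)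
  rw [ENNReal.rpow_two, eLpNorm_congr_ae (coeFn_gradL2 hp u)] at k1
  have k3 : ENNReal.ofReal ν₁ * eLpNorm (SpaceV.grad u) (ENNReal.ofReal p) (volume.restrict Q) ^ p ≤
    _ := k2.2
  have e := viscousForm_eq (a := a) (b := b) hp ε s u u
  exact le_ofReal_of_eq_add e k1.1 k1.2 k2.1 k3

end Viscous

/-! ### Weak solutions as weak evolutions -/

section WeakSolutions

variable {N : ℕ} {Q : Set (Vec N)} {p : ℝ}

theorem AssumptionA3.ae_rescale {ρ : Vec N → ℝ} {ε Λ : ℝ} (hε : 0 < ε)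
    (hb : ∀ᵐ y, Λ⁻¹ ≤ ρ y ∧ ρ y ≤ Λ) :
    ∀ᵐ x ∂(volume.restrict Q), Λ⁻¹ ≤ ρ (ε⁻¹ • x) ∧ ρ (ε⁻¹ • x) ≤ Λ :=
  ae_mono Measure.restrict_le_self
    ((quasiMeasurePreserving_smul (volume : Measure (Vec N)) (inv_ne_zero hε.ne')).ae hb)

theorem AssumptionA3.aestronglyMeasurable_rescale {ρ : Vec N → ℝ} (hρ : AssumptionA3 ρ) {ε : ℝ}
    (hε : 0 < ε) : AEStronglyMeasurable (fun x => ρ (ε⁻¹ • x)) (volume.restrict Q) :=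
  (hρ.bounded.1.comp_quasiMeasurePreserving
    (quasiMeasurePreserving_smul (volume : Measure (Vec N)) (inv_ne_zero hε.ne'))).restrict

/-- Comparison with the image of `0`: the Lipschitz bound contributes `k ‖h‖`, and `|f(τ, 0)| ≤ k`
contributes `k |Q|^{1/2}`. The resulting `K` does not depend on `τ`, hence not on `ε` after
rescaling. -/
theorem AssumptionA4.exists_bound [IsFiniteMeasure (volume.restrict Q)] {f : ℝ → Vec N → Vec N}
    (hf : AssumptionA4 Q f) : ∃ (Φ : ℝ × SpaceH Q → SpaceH Q) (K : ℝ), Continuous Φ ∧ 0 ≤ K ∧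
      (∀ τ h, SpaceH.field (Φ (τ, h)) =ᵐ[volume.restrict Q] fun x => f τ (SpaceH.field h x)) ∧
      ∀ τ h, ‖Φ (τ, h)‖ ≤ K * (1 + ‖h‖) := by
  obtain ⟨Φ, hΦ, hΦf⟩ := hf.maps_H
  obtain ⟨k, hk, hk0, hkl⟩ := hf.lipschitz
  set c : ℝ := ((volume.restrict Q).real univ) ^ ((2 : ℝ≥0∞).toReal⁻¹) * k
  have hc : 0 ≤ c := by positivity
  have h0 : ∀ τ, ‖(Φ (τ, 0)).1‖ ≤ c := by
    intro τ
    refine Lp.norm_le_of_ae_bound hk.le ?_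
    filter_upwards [hΦf τ 0, Lp.coeFn_zero (Vec N) 2 (volume.restrict Q)] with x hx hx0
    have e : SpaceH.field (0 : SpaceH Q) x = 0 := hx0
    have e' : (Φ (τ, 0)).1 x = f τ 0 := hx.trans (by rw [e])
    rw [e']
    exact hk0 τ
  have h1 : ∀ τ h, ‖(Φ (τ, h)).1 - (Φ (τ, 0)).1‖ ≤ k * ‖h.1‖ := by
    intro τ h
    refine Lp.norm_le_mul_norm_of_ae_le_mul ?_
    filter_upwards [hΦf τ 0, hΦf τ h, Lp.coeFn_zero (Vec N) 2 (volume.restrict Q),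
      Lp.coeFn_sub (Φ (τ, h)).1 (Φ (τ, 0)).1] with x hx hx' hx0 hs
    have e : SpaceH.field (0 : SpaceH Q) x = 0 := hx0
    have e1 : (Φ (τ, 0)).1 x = f τ 0 := hx.trans (by rw [e])
    have e2 : (Φ (τ, h)).1 x = f τ (h.1 x) := hx'
    rw [hs, Pi.sub_apply, e1, e2]
    simpa using hkl τ (h.1 x) 0
  refine ⟨Φ, c + k, hΦ, by positivity, hΦf, fun τ h => ?_⟩
  have h2 : ‖(Φ (τ, h)).1‖ ≤ ‖(Φ (τ, h)).1 - (Φ (τ, 0)).1‖ + ‖(Φ (τ, 0)).1‖ :=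
    norm_le_norm_sub_add _ _
  have h3 : ‖(Φ (τ, h)).1‖ ≤ k * ‖h.1‖ + c := h2.trans (add_le_add (h1 τ h) (h0 τ))
  have h4 : 0 ≤ ‖h.1‖ := norm_nonneg _
  change ‖(Φ (τ, h)).1‖ ≤ (c + k) * (1 + ‖h.1‖)
  nlinarith

theorem innerEps_eq {ρ : Vec N → ℝ} {ε : ℝ} {B : SpaceH Q →L[ℝ] SpaceH Q →L[ℝ] ℝ}
    (hB : ∀ h k : SpaceH Q, B h k = ∫ x in Q, ρ (ε⁻¹ • x) * ⟪h.1 x, k.1 x⟫)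
    {φ ψ : Vec N → Vec N} {h k : SpaceH Q} (hφ : SpaceH.field h =ᵐ[volume.restrict Q] φ)
    (hψ : SpaceH.field k =ᵐ[volume.restrict Q] ψ) : innerEps Q ρ ε φ ψ = B h k := by
  rw [hB]
  refine integral_congr_ae ?_
  filter_upwards [hφ, hψ] with x h1 h2
  have h1' : h.1 x = φ x := h1
  have h2' : k.1 x = ψ x := h2
  rw [h1', h2']

variable [Fact (1 ≤ ENNReal.ofReal p)] [IsFiniteMeasure (volume.restrict Q)]
  {p₀ r α : ℝ} {C : ℝ≥0∞} [Fact (1 ≤ ENNReal.ofReal p₀)] [Fact (1 ≤ ENNReal.ofReal r)]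

theorem IsDualOperator.of_trilinear {V R : Type*} [NormedAddCommGroup V] [NormedSpace ℝ V]
    [NormedAddCommGroup R] (μ : Measure ℝ) {c : V → V → V → ℝ} {e : V → R} {K : ℝ} (hK : 0 ≤ K)
    {L : V → V →L[ℝ] ℝ} (hL : ∀ u v, L u v = c u u v)
    (hb : ∀ u v, |c u u v| ≤ K * ‖e u‖ * ‖e u‖ * ‖v‖)
    (hc : Continuous fun z : V × V × V => c z.1 z.2.1 z.2.2) :
    IsDualOperator μ (fun _ u v => c u u v) fun u => K * ‖e u‖ * ‖e u‖ where
  nonneg u := by positivity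
  linear := Eventually.of_forall fun s u => ⟨L u, hL u⟩
  bound := Eventually.of_forall fun s => hb
  cont := Eventually.of_forall fun s v => hc.comp (g := fun z : V × V × V => c z.1 z.2.1 z.2.2)
    (continuous_id.prodMk (continuous_id.prodMk continuous_const))
  meas u v := aestronglyMeasurable_const

theorem ConvectiveExponents.exists_isDualOperator (h : ConvectiveExponents Q p p₀ r α C)
    (μ : Measure ℝ) : ∃ K : ℝ, 0 ≤ K ∧ IsDualOperator μ
      (fun _ (u v : SpaceV Q p) => convectiveForm u u v) fun u => K * ‖h.embR u‖ * ‖h.embR u‖ := by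
  obtain ⟨K, hK, hb⟩ := h.exists_abs_convectiveForm_le
  exact ⟨K, hK, IsDualOperator.of_trilinear (c := convectiveForm) (e := h.embR) μ hK
    h.convectiveL_apply hb h.continuous_convectiveForm⟩

theorem holderConjugate_ofReal {p : ℝ} (hp : 1 < p) :
    ENNReal.HolderConjugate (ENNReal.ofReal p) (ENNReal.ofReal (p / (p - 1))) := by
  have h1 : 0 < p - 1 := by linarith
  constructor
  rw [← ENNReal.ofReal_inv_of_pos (by linarith), ← ENNReal.ofReal_inv_of_pos (by positivity),
    ← ENNReal.ofReal_add (by positivity) (by positivity), inv_one, ← ENNReal.ofReal_one]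
  congr 1
  field_simp
  ring

theorem one_le_ofReal_conjugate {p : ℝ} (hp : 1 < p) : 1 ≤ ENNReal.ofReal (p / (p - 1)) := by
  rw [← ENNReal.ofReal_one]
  refine ENNReal.ofReal_le_ofReal ?_
  rw [one_le_div (by linarith)]
  linarith

theorem one_add_mul_self_le {K t : ℝ} (hK : 0 ≤ K) : K * (1 + t) * t ≤ 2 * K * (1 + t ^ 2) := by
  nlinarith [mul_nonneg hK (sq_nonneg (t - 1)), mul_nonneg hK (sq_nonneg t)]

set_option maxHeartbeats 2000000 in
/-- The energy estimate for weak solutions. -/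
theorem IsWeakSolution.energy_estimate (h : ConvectiveExponents Q p p₀ r α C)
    {T : ℝ} (hT : 0 < T)
    {a : Vec N × ℝ → Matrix (Fin N) (Fin N) ℝ} (ha : AssumptionA1 a)
    {b : Vec N × ℝ → ℝ} (hb : AssumptionA2 b) {ν₀ ν₁ : ℝ} (hν₀ : 0 < ν₀) (hν₁ : 0 < ν₁)
    (ha₀ : ∀ᵐ z, ∀ ξ : Vec N, ν₀ * ‖ξ‖ ^ 2 ≤ ∑ i, ∑ j, a z i j * ξ j * ξ i)
    (hb₁ : ∀ᵐ z, ν₁ ≤ b z)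
    {ρ : Vec N → ℝ} (hρ : AssumptionA3 ρ) {Λ : ℝ} (hΛ : 0 < Λ)
    (hρb : ∀ᵐ y, Λ⁻¹ ≤ ρ y ∧ ρ y ≤ Λ) {f : ℝ → Vec N → Vec N}
    {Φ : ℝ × SpaceH Q → SpaceH Q} {K : ℝ} (hΦ : Continuous Φ) (hK : 0 ≤ K)
    (hΦf : ∀ τ h, SpaceH.field (Φ (τ, h)) =ᵐ[volume.restrict Q] fun x => f τ (SpaceH.field h x))
    (hΦb : ∀ τ h, ‖Φ (τ, h)‖ ≤ K * (1 + ‖h‖)) {u0 : SpaceH Q} {ε : ℝ} (hε : 0 < ε)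
    {u : ℝ → SpaceV Q p} (hu : IsWeakSolution T a b ρ f u0 ε u) :
    ∃ w : ℝ → SpaceH Q, ContinuousOn w (Icc 0 T) ∧
      (∀ᵐ t ∂(volume.restrict (Ioo 0 T)), embH h.two_le_p (u t) = w t) ∧
      (∀ t ∈ Icc 0 T, ‖w t‖ ^ 2 ≤ (Λ * ‖u0‖ ^ 2 + 2 * (2 * (Λ * K)) * T) / Λ⁻¹ *
        Real.exp (2 * (2 * (Λ * K)) / Λ⁻¹ * T)) ∧
      ∫⁻ s in Ioo 0 T, ENNReal.ofReal (viscousForm a b ε s (u s) (u s)) ≤ ENNReal.ofReal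
        (Λ * ‖u0‖ ^ 2 + 2 * (Λ * K) * T * (1 +
          (Λ * ‖u0‖ ^ 2 + 2 * (2 * (Λ * K)) * T) / Λ⁻¹ *
            Real.exp (2 * (2 * (Λ * K)) / Λ⁻¹ * T))) := by
  have hp2 := h.two_le_p
  have hp1 : 1 < p := by linarith
  have := holderConjugate_ofReal hp1
  obtain ⟨B, hB, hBs, hBc, hBb⟩ := exists_weighted_inner (SpaceH Q) hΛ
    (hρ.aestronglyMeasurable_rescale (Q := Q) hε) (AssumptionA3.ae_rescale (Q := Q) hε hρb)
  obtain ⟨KA, hA⟩ := isDualOperator_viscousForm (Q := Q) (p := p) hε (Ioo 0 T) hp2 ha hb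
  obtain ⟨KD, hKD, hD⟩ := h.exists_isDualOperator (volume.restrict (Ioo 0 T))
  have hF₀ := isDualOperator_of_continuous (μ := volume.restrict (Ioo 0 T)) hΦ hK hΛ.le hΦb B hBb
    (ε ^ 2)
  obtain ⟨KF, -, hF⟩ := hF₀.exists_comp_growth (mul_nonneg hΛ.le hK) zero_le_one
    (e' := p - 1) (by linarith) (embH (Q := Q) hp2)
  obtain ⟨z, hz, huz⟩ := hu.memLinfty
  -- This bound may depend on `ε` and on the solution. It serves only to place the convective term
  -- in the dual exponent class and does not enter the final constants.
  have hw : ∀ᵐ s ∂(volume.restrict (Ioo 0 T)), ‖embH hp2 (u s)‖ ≤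
      (eLpNorm z ⊤ (volume.restrict (Ioo 0 T))).toReal := by
    filter_upwards [huz, ae_le_eLpNormEssSup (f := z) (μ := volume.restrict (Ioo 0 T))]
      with s h1 h2
    rw [(sameField_iff hp2 _ _).1 h1, ← ENNReal.ofReal_le_iff_le_toReal hz.2.ne, ofReal_norm,
      eLpNorm_exponent_top]
    exact h2
  have hcoer := viscousForm_coercive (Q := Q) (p := p) hε (Ioo 0 T) hp2 ha hb hν₀.le hν₁.le ha₀ hb₁
  have hmF := memLp_growth hp1 hu.memLp KF
  have hmA := memLp_growth hp1 hu.memLp KA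
  have hmD := memLp_mul_of_interpolation h.two_le h.le h.r_pos h.holder h.nonneg
    ENNReal.toReal_nonneg hKD (embH hp2) h.embR (gradLpOfLe h.le) h.norm_embR_rpow_le hu.memLp hw
  have hB₁ : ∀ v, B v v ≤ Λ * ‖v‖ ^ 2 := fun v => by
    refine (le_abs_self _).trans ((hBb v v).trans (le_of_eq ?_))
    rw [mul_assoc, sq]
  have hFK : ∀ (s : ℝ) (v : SpaceV Q p), B (Φ (s / ε ^ 2, embH hp2 v)) (embH hp2 v) ≤
      2 * (Λ * K) * (1 + ‖embH hp2 v‖ ^ 2) := by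
    intro s v
    refine (le_abs_self _).trans ((hBb _ _).trans ?_)
    refine le_trans ?_ (one_add_mul_self_le (mul_nonneg hΛ.le hK))
    refine mul_le_mul_of_nonneg_right ?_ (norm_nonneg _)
    rw [mul_assoc]
    exact mul_le_mul_of_nonneg_left (hΦb _ _) hΛ.le
  have heq : ∀ v : SpaceV Q p, ∀ᵐ t ∂(volume.restrict (Ioo 0 T)),
      B (embH hp2 (u t)) (embH hp2 v) +
        ∫ s in (0 : ℝ)..t, (viscousForm a b ε s (u s) v + convectiveForm (u s) (u s) v) =
      B u0 (embH hp2 v) +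
        ∫ s in (0 : ℝ)..t, B (Φ (s / ε ^ 2, embH hp2 (u s))) (embH hp2 v) := by
    intro v
    filter_upwards [hu.equation v] with t ht
    have e1 := innerEps_eq hB (embH_field hp2 (u t)) (embH_field hp2 v)
    have e2 := innerEps_eq hB (h := u0) (EventuallyEq.refl _ _) (embH_field hp2 v)
    have e3 : (fun s => innerEps Q ρ ε (fun x => f (s / ε ^ 2) (SpaceV.field (u s) x))
        (SpaceV.field v)) = fun s => B (Φ (s / ε ^ 2, embH hp2 (u s))) (embH hp2 v) := by
      funext s
      refine innerEps_eq hB ((hΦf _ _).trans ?_) (embH_field hp2 v)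
      filter_upwards [embH_field hp2 (u s)] with x hx
      rw [hx]
    rw [e1, e2, e3] at ht
    exact ht
  have hA0 : ∀ᵐ s ∂(volume.restrict (Ioo 0 T)), ∀ v : SpaceV Q p, 0 ≤ viscousForm a b ε s v v :=
    hcoer.mono fun s hs v => (hs v).1
  have hΛK : 0 ≤ 2 * (Λ * K) := by positivity
  have hq := one_le_ofReal_conjugate hp1
  exact IsDualOperator.energy_estimate hT ENNReal.ofReal_ne_top ENNReal.ofReal_ne_top hq hBs
    (inv_pos.2 hΛ) hBc hB₁ (denseRange_embH hp2) hu.memLp hF hA hD hmF hmA hmD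
    (fun _ v => h.convectiveForm_self v v) hΛK hFK hA0 heq

end WeakSolutions

/-! ### Bounds independent of `ε` -/

section UniformBounds

theorem le_ofReal_inv_mul {ν : ℝ} (hν : 0 < ν) {X Y : ℝ≥0∞} (h : ENNReal.ofReal ν * X ≤ Y) :
    X ≤ ENNReal.ofReal ν⁻¹ * Y := by
  have e : ENNReal.ofReal ν⁻¹ * (ENNReal.ofReal ν * X) = X := by
    rw [← mul_assoc, ← ENNReal.ofReal_mul (by positivity), inv_mul_cancel₀ hν.ne',
      ENNReal.ofReal_one, one_mul]
  rw [← e]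
  gcongr

theorem lintegral_le_of_mul_le {T D ν C₀ : ℝ} {F G X : ℝ → ℝ≥0∞} (hν : 0 < ν)
    (hC₀ : 0 ≤ C₀)
    (hD : ∫⁻ s in Ioo 0 T, F s ≤ ENNReal.ofReal D)
    (hG : ∀ᵐ s ∂(volume.restrict (Ioo 0 T)), ENNReal.ofReal ν * G s ≤ F s)
    (hX : ∀ᵐ s ∂(volume.restrict (Ioo 0 T)), X s ≤ ENNReal.ofReal C₀) :
    ∫⁻ s in Ioo 0 T, (X s + G s) ≤ ENNReal.ofReal (C₀ * T) + ENNReal.ofReal (ν⁻¹ * D) := by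
  calc ∫⁻ s in Ioo 0 T, (X s + G s)
      ≤ ∫⁻ s in Ioo 0 T, (ENNReal.ofReal C₀ + ENNReal.ofReal ν⁻¹ * F s) := by
        refine lintegral_mono_ae ?_
        filter_upwards [hG, hX] with s h1 h2
        exact add_le_add h2 (le_ofReal_inv_mul hν h1)
    _ = ENNReal.ofReal (C₀ * T) + ENNReal.ofReal ν⁻¹ * ∫⁻ s in Ioo 0 T, F s := by
        rw [lintegral_add_left measurable_const, lintegral_const_mul' _ _ ENNReal.ofReal_ne_top,
          setLIntegral_const, Real.volume_Ioo, sub_zero, ← ENNReal.ofReal_mul hC₀]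
    _ ≤ _ := by
        rw [ENNReal.ofReal_mul (p := ν⁻¹) (by positivity)]
        gcongr

theorem enorm_sq_le_ofReal {E : Type*} [NormedAddCommGroup E] {x : E} {C : ℝ} (h : ‖x‖ ^ 2 ≤ C) :
    ‖x‖ₑ ^ 2 ≤ ENNReal.ofReal C := by
  rw [← ofReal_norm, ← ENNReal.ofReal_pow (norm_nonneg _)]
  exact ENNReal.ofReal_le_ofReal h

variable {N : ℕ} {Q : Set (Vec N)} {p : ℝ} [Fact (1 ≤ ENNReal.ofReal p)]

set_option maxHeartbeats 2000000 in
/-- The energy estimate for weak solutions, in terms of the norms of the solution and with the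
constant independent of `ε`. -/
theorem exists_uniform_bound [IsFiniteMeasure (volume.restrict Q)] {p₀ r α : ℝ} {C₀ : ℝ≥0∞}
    (h : ConvectiveExponents Q p p₀ r α C₀) {T : ℝ} (hT : 0 < T)
    {a : Vec N × ℝ → Matrix (Fin N) (Fin N) ℝ} (ha : AssumptionA1 a)
    {b : Vec N × ℝ → ℝ} (hb : AssumptionA2 b) {ρ : Vec N → ℝ} (hρ : AssumptionA3 ρ)
    {f : ℝ → Vec N → Vec N} (hf : AssumptionA4 Q f) (u0 : SpaceH Q) :
    ∃ C : ℝ, 0 < C ∧ ∀ ε : ℝ, 0 < ε → ∀ u : ℝ → SpaceV Q p, IsWeakSolution T a b ρ f u0 ε u →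
      (∃ w : ℝ → SpaceH Q, ContinuousOn w (Icc 0 T) ∧
        (∀ᵐ t ∂(volume.restrict (Ioo 0 T)), SameField (u t) (w t)) ∧
        ∀ t ∈ Icc 0 T, ‖w t‖ ^ 2 ≤ C) ∧
      (∫⁻ t in Ioo 0 T, (eLpNorm (SpaceV.grad (u t)) (ENNReal.ofReal p)
        (volume.restrict Q)) ^ p ≤ ENNReal.ofReal C) ∧
      (∫⁻ t in Ioo 0 T, ((eLpNorm (SpaceV.field (u t)) 2 (volume.restrict Q)) ^ 2 +
        (eLpNorm (SpaceV.grad (u t)) 2 (volume.restrict Q)) ^ 2) ≤ ENNReal.ofReal C) := by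
  have : Fact (1 ≤ ENNReal.ofReal p₀) := ⟨one_le_two.trans (two_le_ofReal h.two_le)⟩
  have : Fact (1 ≤ ENNReal.ofReal r) := ⟨one_le_two.trans (two_le_ofReal h.two_le_r)⟩
  obtain ⟨ν₀, hν₀, ha₀⟩ := ha.coercive
  obtain ⟨ν₁, ν₂, hν₁, -, hb₁⟩ := hb.bounds
  obtain ⟨Λ, hΛ, hρb⟩ := hρ.bounds
  obtain ⟨Φ, K, hΦ, hK, hΦf, hΦb⟩ := hf.exists_bound
  have hb₁' : ∀ᵐ z, ν₁ ≤ b z := hb₁.mono fun z hz => hz.1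
  have est := fun (ε : ℝ) (hε : 0 < ε) (u : ℝ → SpaceV Q p)
    (hu : IsWeakSolution T a b ρ f u0 ε u) => IsWeakSolution.energy_estimate h hT ha hb hν₀ hν₁
      ha₀ hb₁' hρ hΛ hρb hΦ hK hΦf hΦb hε hu
  have hn : 0 ≤ ‖u0‖ := norm_nonneg _
  -- The two bounds of the energy estimate involve only `Λ`, `K`, `T` and `‖u0‖`; they are made
  -- opaque as `C₁` (supremum) and `C₂` (dissipation).
  generalize ‖u0‖ = n at est hn
  have hC₁ : 0 ≤ (Λ * n ^ 2 + 2 * (2 * (Λ * K)) * T) / Λ⁻¹ *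
      Real.exp (2 * (2 * (Λ * K)) / Λ⁻¹ * T) := by positivity
  generalize (Λ * n ^ 2 + 2 * (2 * (Λ * K)) * T) / Λ⁻¹ *
      Real.exp (2 * (2 * (Λ * K)) / Λ⁻¹ * T) = C₁ at est hC₁
  have hC₂ : 0 ≤ Λ * n ^ 2 + 2 * (Λ * K) * T * (1 + C₁) := by positivity
  generalize Λ * n ^ 2 + 2 * (Λ * K) * T * (1 + C₁) = C₂ at est hC₂
  have h1 : 0 ≤ C₁ * T := by positivity
  have h2 : 0 ≤ ν₀⁻¹ * C₂ := by positivity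
  have h3 : 0 ≤ ν₁⁻¹ * C₂ := by positivity
  -- The sum covers all three estimates: `C₁` for the supremum, `ν₁⁻¹ C₂` for the `L^p` gradient,
  -- `C₁ T + ν₀⁻¹ C₂` for the `H¹` norm; the `1` ensures positivity.
  refine ⟨1 + C₁ + C₁ * T + ν₀⁻¹ * C₂ + ν₁⁻¹ * C₂, by positivity, fun ε hε u hu => ?_⟩
  obtain ⟨w, hwc, hw, hwb, hwi⟩ := est ε hε u hu
  have hcoer := viscousForm_coercive (Q := Q) (p := p) hε (Ioo 0 T) h.two_le_p ha hb hν₀.le hν₁.le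
    ha₀ hb₁'
  refine ⟨⟨w, hwc, ?_, fun t ht => (hwb t ht).trans (by linarith)⟩, ?_, ?_⟩
  · filter_upwards [hw] with t ht
    exact (sameField_iff h.two_le_p _ _).2 ht
  · have key := lintegral_le_of_mul_le (X := 0) hν₁ le_rfl hwi
      (hcoer.mono fun s hs => (hs (u s)).2.2) (Eventually.of_forall fun s => zero_le)
    simp only [Pi.zero_apply, zero_add, zero_mul, ENNReal.ofReal_zero] at key
    exact key.trans (ENNReal.ofReal_le_ofReal (by linarith))
  · have hX : ∀ᵐ t ∂(volume.restrict (Ioo 0 T)),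
        eLpNorm (SpaceV.field (u t)) 2 (volume.restrict Q) ^ 2 ≤ ENNReal.ofReal C₁ := by
      filter_upwards [hw, ae_restrict_mem measurableSet_Ioo] with t ht htT
      rw [← enorm_embH h.two_le_p, ht]
      exact enorm_sq_le_ofReal (hwb t (Ioo_subset_Icc_self htT))
    refine (lintegral_le_of_mul_le hν₀ hC₁ hwi
      (hcoer.mono fun s hs => (hs (u s)).2.1) hX).trans ?_
    rw [← ENNReal.ofReal_add h1 h2]
    exact ENNReal.ofReal_le_ofReal (by linarith)

end UniformBounds

end Ladyzhenskaya

/-! ### The theorem -/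

theorem lemma1 (N : ℕ) (hN : N = 2 ∨ N = 3)
    (Q : Set (Ladyzhenskaya.Vec N)) (hQo : IsOpen Q) (hQb : Bornology.IsBounded Q)
    (p : ℝ) (hp : 1 + 2 * (N : ℝ) / ((N : ℝ) + 2) ≤ p) [Fact (1 ≤ ENNReal.ofReal p)]
    (T : ℝ) (hT : 0 < T)
    (a : Ladyzhenskaya.Vec N × ℝ → Matrix (Fin N) (Fin N) ℝ) (ha : Ladyzhenskaya.AssumptionA1 a)
    (b : Ladyzhenskaya.Vec N × ℝ → ℝ) (hb : Ladyzhenskaya.AssumptionA2 b)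
    (ρ : Ladyzhenskaya.Vec N → ℝ) (hρ : Ladyzhenskaya.AssumptionA3 ρ)
    (f : ℝ → Ladyzhenskaya.Vec N → Ladyzhenskaya.Vec N) (hf : Ladyzhenskaya.AssumptionA4 Q f)
    (u0 : Ladyzhenskaya.SpaceH Q) :
    ∃ C : ℝ, 0 < C ∧
      ∀ ε : ℝ, 0 < ε → ∀ u : ℝ → Ladyzhenskaya.SpaceV Q p,
        Ladyzhenskaya.IsWeakSolution T a b ρ f u0 ε u →
        (∃ w : ℝ → Ladyzhenskaya.SpaceH Q, ContinuousOn w (Set.Icc 0 T) ∧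
          (∀ᵐ t ∂(MeasureTheory.volume.restrict (Set.Ioo 0 T)),
            Ladyzhenskaya.SameField (u t) (w t)) ∧
          ∀ t ∈ Set.Icc 0 T, ‖w t‖ ^ 2 ≤ C) ∧
        (∫⁻ t in Set.Ioo 0 T,
          (MeasureTheory.eLpNorm (Ladyzhenskaya.SpaceV.grad (u t)) (ENNReal.ofReal p)
            (MeasureTheory.volume.restrict Q)) ^ p ≤ ENNReal.ofReal C) ∧
        (∫⁻ t in Set.Ioo 0 T,
          ((MeasureTheory.eLpNorm (Ladyzhenskaya.SpaceV.field (u t)) 2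
              (MeasureTheory.volume.restrict Q)) ^ 2 +
            (MeasureTheory.eLpNorm (Ladyzhenskaya.SpaceV.grad (u t)) 2
              (MeasureTheory.volume.restrict Q)) ^ 2) ≤ ENNReal.ofReal C) := by
  obtain ⟨p₀, r, α, C₀, h1, h2, h3, h4, h5, h6, h7, h8⟩ :=
    Ladyzhenskaya.exists_gagliardoNirenberg hN hQb hp
  have h : Ladyzhenskaya.ConvectiveExponents Q p p₀ r α C₀ := ⟨h1, h2, h3, h4, h5, h6, h7, h8⟩
  have : MeasureTheory.IsFiniteMeasure (MeasureTheory.volume.restrict Q) :=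
    ⟨by rw [MeasureTheory.Measure.restrict_apply_univ]; exact hQb.measure_lt_top⟩
  exact Ladyzhenskaya.exists_uniform_bound h hT ha hb hρ hf u0
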